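/- Setting. Let $X$ be a compact connected Riemann surface with a spin structure $\omega_X^{1/2}$ and let $D$ be an effective divisor on $X$. Let $P$ be a Schrödinger operator on $(X,D)$: an $\hbar$-family of maps of sheaves $\omega_X^{-1/2}\to\omega_X^{3/2}(2D)$ which in every local coordinate $x$ (with the induced generators $dx^{-1/2}$, $dx^{3/2}$) has the form $\hbar^2\partial_x^2-Q(x,\hbar)$, where $Q=\sum_k Q_k\hbar^k$ is a polynomial in $\hbar$ and the $Q_k$ are meromorphic with poles bounded by $2D$; $D$ is minimal with this property. For $k\neq2$ put $\phi_k=Q_k\,dx^2\in H^0(X,\omega_X^2(2D))$. Assume that all zeros of $\phi_0$ are simple and that every pole of any $Q_k$ is a pole of $Q_0$ of at least the same order. A point of $X$ is regular if it is neither a zero nor a pole of $\phi_0$. Let $\pi:\Sigma\to X$ be the spectral curve, i.e. the curve of points $(p,\eta)$ in the total space of $\omega_X(D)$ with $\eta\otimes\eta=\phi_0(p)$, let $\iota$ be its involution $\eta\mapsto-\eta$, $\lambda$ its tautological (Liouville) form, $\sigma=\lambda-\iota^*\lambda=2\lambda$, $R$ the ramification divisor of $\pi$, $\Delta=\pi^*D\smallsetminus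 2R$ and $R_\Delta=R\smallsetminus\Delta$, where $A\smallsetminus B=A-\min(A,B)$. The support of $R_\Delta$ is the set of transition points (preimages of zeros and simple poles of $\phi_0$). A point of $\Sigma$ is regular if its image in $X$ is. Let $V$ be the meromorphic vector field on $\Sigma$ with $\sigma(V)=1$. Near a regular point $p_0\in X$ a canonical generator of $\omega_X^{-1/2}$ is a section $a_0=\exp\bigl(-\tfrac14\int^x d\log Q_0\bigr)dx^{-1/2}$ (well defined up to a nonzero constant). For a preimage $q\in\Sigma$ of $p_0$, the formal WKB solution based at $q$, normalised by $a_0$, is the expression $\hat\psi=e^{-S/\hbar}\hat a$, with $S$ a holomorphic function near $p_0$ and $\hat a$ a power series in $\hbar$ of holomorphic sections of $\omega_X^{-1/2}$ near $p_0$, that formally satisfies $P\hat\psi=0$ and has $\hat\psi(p_0)=a_0(p_0)$ (so $S(p_0)=0$) and $dS(p_0)=\lambda(q)$. (1) There is a formal differential $\hat\Lambda(\hbar)=\sum_{k\ge0}\Lambda_k\hbar^k$ with all $\Lambda_k\in H^0\bigl(\Sigma,\omega_\Sigma(\Delta)(*R_\Delta)\bigr)$ such that for every regular $q\in\Sigma$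 and every canonical generator $a_0$ near $\pi(q)$ the formal WKB solution based at $q$ exists, is unique as a germ at $\pi(q)$, and is given near $\pi(q)$ by $$\hat\psi=a_0\,e^{-S/\hbar}\,\hat A,\qquad S(p)=\int_q^{\tilde p}\lambda,\qquad \hat A(p,\hbar)=\exp\Bigl(-\int_q^{\tilde p}\hat\Lambda(\hbar)\Bigr),$$ where $\tilde p$ is the preimage of $p$ near $q$. The formal differential $\hat\Lambda$ is the unique one with this property, and $\Lambda_0=\pi^*\phi_1/\sigma$. (2) Put $w=\Lambda_0/\lambda=2\,\pi^*\phi_1/\sigma^2$ and $W=\sum_{k\ge0}W_k\hbar^k=-\dfrac{\Lambda_1}{\sigma}-\sum_{k\ge1}\dfrac{\pi^*\phi_{k+2}}{\sigma^2}\hbar^k$. Then $w$ and all $W_k$ are global meromorphic functions on $\Sigma$ with poles only at transition points, and $$\hat\Lambda=\Lambda_0+\hat f\,\sigma,$$ where $\hat f=\sum_n f_n\hbar^n$, with $f_n$ meromorphic functions on $\Sigma$ with poles only at transition points, is the unique formal power series solution of the Riccati equation $$\hbar V(f)-f=\hbar\,(f^2+wf+W).$$ -/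

import Mathlib

open Set Filter Topology
open scoped Manifold ContDiff

namespace WKB

noncomputable section

/-! ## Local coordinates on a Riemann surface -/

section Surface

variable {X : Type*} [TopologicalSpace X] [ChartedSpace ℂ X]

/-- The local holomorphic coordinate charts of a Riemann surface. -/
abbrev Coord (X : Type*) [TopologicalSpace X] [ChartedSpace ℂ X] :
    Set (OpenPartialHomeomorph X ℂ) :=
  IsManifold.maximalAtlas 𝓘(ℂ) ω X

/-- The derivative `∂F/∂x` of a function `F` in the local coordinate `x = e`, as a function of the
point. In particular `pd e e'` is the Jacobian `dx'/dx` of a change of coordinates. -/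
def pd (e : OpenPartialHomeomorph X ℂ) (F : X → ℂ) (p : X) : ℂ :=
  deriv (F ∘ e.symm) (e p)

/-- `F` is holomorphic near `p`. -/
def HolAt (F : X → ℂ) (p : X) : Prop :=
  AnalyticAt ℂ (F ∘ (chartAt ℂ p).symm) (chartAt ℂ p p)

/-- `F` is meromorphic near `p` (its value at `p` is irrelevant). -/
def MerAt (F : X → ℂ) (p : X) : Prop :=
  MeromorphicAt (F ∘ (chartAt ℂ p).symm) (chartAt ℂ p p)

/-- The order of vanishing at `p` of a function `F` meromorphic near `p`
(negative at poles, `⊤` if `F` vanishes identically near `p`). -/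
def ordAt (F : X → ℂ) (p : X) : WithTop ℤ :=
  meromorphicOrderAt (F ∘ (chartAt ℂ p).symm) (chartAt ℂ p p)

/-- `F` is meromorphic near `p` with a pole of order at most `n` at `p`. -/
def PoleLE (F : X → ℂ) (p : X) (n : ℕ) : Prop :=
  MerAt F p ∧ ((-(n : ℤ) : ℤ) : WithTop ℤ) ≤ ordAt F p

end Surface

/-! ## Spin structures and Schrödinger operators -/

/-- A spin structure on `X`, i.e. a holomorphic line bundle with an isomorphism of its square with
the cotangent bundle, given by a trivialising atlas: `frames` is a covering set of coordinate
charts `x = b` over which a generator `dx^{1/2}` is chosen, and the holomorphic transition functions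
`trans` satisfy `dx_c^{1/2} = trans b c · dx_b^{1/2}`, so that `(trans b c)² = dx_c/dx_b`. -/
structure SpinStructure (X : Type*) [TopologicalSpace X] [ChartedSpace ℂ X] where
  frames : Set (OpenPartialHomeomorph X ℂ)
  frames_subset : frames ⊆ Coord X
  covers : ∀ p : X, ∃ b ∈ frames, p ∈ b.source
  trans : OpenPartialHomeomorph X ℂ → OpenPartialHomeomorph X ℂ → X → ℂ
  trans_hol : ∀ b ∈ frames, ∀ c ∈ frames, ∀ p ∈ b.source ∩ c.source, HolAt (trans b c) p
  trans_sq : ∀ b ∈ frames, ∀ c ∈ frames, ∀ p ∈ b.source ∩ c.source,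
    trans b c p ^ 2 = pd b c p
  trans_cocycle : ∀ b ∈ frames, ∀ c ∈ frames, ∀ d ∈ frames,
    ∀ p ∈ b.source ∩ c.source ∩ d.source, trans b d p = trans b c p * trans c d p

namespace SpinStructure

variable {X : Type*} [TopologicalSpace X] [ChartedSpace ℂ X] (S : SpinStructure X)

/-- `ψ` is a holomorphic section over `U` of the line bundle `ω_X^{m/2}(E)`, where `E ≥ 0` is a
divisor: `ψ = ψ_b · (dx_b^{1/2})^m` over every frame `b`, with poles bounded by `E`. -/
structure IsSection (m : ℤ) (E : X → ℕ) (U : Set X)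
    (ψ : OpenPartialHomeomorph X ℂ → X → ℂ) : Prop where
  hol : ∀ b ∈ S.frames, ∀ p ∈ U ∩ b.source, E p = 0 → HolAt (ψ b) p
  pole : ∀ b ∈ S.frames, ∀ p ∈ U ∩ b.source, PoleLE (ψ b) p (E p)
  glue : ∀ b ∈ S.frames, ∀ c ∈ S.frames, ∀ p ∈ U ∩ (b.source ∩ c.source), E p = 0 →
    ψ b p = ψ c p * S.trans b c p ^ m

/-- `r` is a generator `dx^{1/2}` of `ω_X^{1/2}` over `V` with `dx^{1/2} ⊗ dx^{1/2} = dx`,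
where `x = e` is a coordinate on `V`; over the frame `b` it reads `r_b · dx_b^{1/2}`. -/
def IsRoot (e : OpenPartialHomeomorph X ℂ) (V : Set X)
    (r : OpenPartialHomeomorph X ℂ → X → ℂ) : Prop :=
  S.IsSection 1 (fun _ => 0) V r ∧
    ∀ b ∈ S.frames, ∀ p ∈ V ∩ b.source, r b p ^ 2 = pd b e p

/-- Over `V`, the section `ψ` of weight `m/2` equals `F · (dx^{1/2})^m`,
where `dx^{1/2}` is the generator `r`. -/
def HasCoeff (m : ℤ) (V : Set X) (r ψ : OpenPartialHomeomorph X ℂ → X → ℂ) (F : X → ℂ) : Prop :=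
  ∀ b ∈ S.frames, ∀ p ∈ V ∩ b.source, ψ b p = F p * r b p ^ m

end SpinStructure

/-- A Schrödinger operator on the marked curve `(X, D)` with spin structure `S`: an `ħ`-family of
maps `ω_X^{-1/2} → ω_X^{3/2}(2D)` which in every local coordinate `x = e`, and in terms of the
induced generators `dx^{-1/2}` and `dx^{3/2}`, is `ħ² ∂_x² - ∑_k Q_k(x) ħ^k`
(a polynomial in `ħ`), with `Q_k = Q e k` meromorphic with poles bounded by `2D`. -/
structure SchrodingerOperator {X : Type*} [TopologicalSpace X] [ChartedSpace ℂ X]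
    (S : SpinStructure X) (D : X →₀ ℕ) where
  Q : OpenPartialHomeomorph X ℂ → ℕ → X → ℂ
  degree : ℕ
  Q_degree : ∀ e ∈ Coord X, ∀ k, degree < k → ∀ p ∈ e.source, Q e k p = 0
  Q_hol : ∀ e ∈ Coord X, ∀ k, ∀ p ∈ e.source, D p = 0 → HolAt (Q e k) p
  Q_pole : ∀ e ∈ Coord X, ∀ k, ∀ p ∈ e.source, PoleLE (Q e k) p (2 * D p)
  /-- The local expressions define a map of sheaves: every section `ψ` of `ω_X^{-1/2}` over an open
  set `U` has an image `χ`, a section of `ω_X^{3/2}(2D)` over `U`, given in every local coordinate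
  by the local expression. -/
  operator : ∀ (h : ℂ) (U : Set X), IsOpen U →
    ∀ ψ : OpenPartialHomeomorph X ℂ → X → ℂ, S.IsSection (-1) (fun _ => 0) U ψ →
    ∃ χ : OpenPartialHomeomorph X ℂ → X → ℂ, S.IsSection 3 (fun p => 2 * D p) U χ ∧
      ∀ e ∈ Coord X, ∀ V : Set X, IsOpen V → V ⊆ U ∩ e.source → (∀ p ∈ V, D p = 0) →
      ∀ r : OpenPartialHomeomorph X ℂ → X → ℂ, S.IsRoot e V r →
      ∀ F G : X → ℂ, S.HasCoeff (-1) V r ψ F → S.HasCoeff 3 V r χ G →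
      ∀ p ∈ V, G p = h ^ 2 * pd e (pd e F) p
        - (∑ k ∈ Finset.range (degree + 1), Q e k p * h ^ k) * F p
  /-- `D` is minimal: the operator does not restrict to `(X, D')` for a proper subdivisor. -/
  minimal : ∀ D' : X →₀ ℕ, D' ≤ D →
    (∀ e ∈ Coord X, ∀ k, ∀ p ∈ e.source, PoleLE (Q e k) p (2 * D' p)) → D' = D

/-- The formal exponential of a power series in `ħ`: `exp(F) = e^{F₀} ∑_m (F - F₀)^m / m!`. -/
def formalExp (F : PowerSeries ℂ) : PowerSeries ℂ :=
  PowerSeries.mk fun n => Complex.exp (PowerSeries.coeff 0 F) *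
    ∑ m ∈ Finset.range (n + 1), ((m.factorial : ℂ))⁻¹ *
      PowerSeries.coeff n ((F - PowerSeries.C (PowerSeries.coeff 0 F)) ^ m)

namespace SchrodingerOperator

variable {X : Type*} [TopologicalSpace X] [ChartedSpace ℂ X]
variable {S : SpinStructure X} {D : X →₀ ℕ} (P : SchrodingerOperator S D)

/-- All zeros of the classical quadratic differential `φ₀ = Q₀ dx²` are simple
(in particular `φ₀` does not vanish identically). -/
def ZerosSimple : Prop :=
  ∀ e ∈ Coord X, ∀ p ∈ e.source, 0 < ordAt (P.Q e 0) p → ordAt (P.Q e 0) p = 1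

/-- Every pole of some `Q_k` is a pole of `Q₀` of no smaller order. -/
def PolesDominated : Prop :=
  ∀ e ∈ Coord X, ∀ k, ∀ p ∈ e.source, ordAt (P.Q e k) p < 0 →
    ordAt (P.Q e 0) p ≤ ordAt (P.Q e k) p

/-- Regular points of `X`: neither a pole nor a zero of `φ₀`. -/
def IsRegularPoint (p : X) : Prop :=
  D p = 0 ∧ P.Q (chartAt ℂ p) 0 p ≠ 0

/-! ### The spectral curve -/

/-- The spectral curve `Σ` inside the total space of `ω_X(D)`. The pair `(p, v)` stands for the
element `v · z^{-D(p)} dz` of the fibre at `p`, where `z` is the coordinate `chartAt ℂ p` translated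
so that `z(p) = 0`; it lies on `Σ` iff its square is the value at `p` of the section `φ₀` of
`ω_X²(2D)`, i.e. iff `v²` is the value of `z^{2D(p)} Q₀` at `p`. -/
def SpectralCurve : Type _ :=
  {q : X × ℂ // Tendsto
    (fun x : ℂ => (x - chartAt ℂ q.1 q.1) ^ (2 * D q.1) *
      P.Q (chartAt ℂ q.1) 0 ((chartAt ℂ q.1).symm x))
    (𝓝[≠] (chartAt ℂ q.1 q.1)) (𝓝 (q.2 ^ 2))}

variable {P}

namespace SpectralCurve

/-- The projection `π : Σ → X`. -/
def proj (q : P.SpectralCurve) : X := q.1.1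

/-- The fibre component `v` of the point `(p, v)` of the spectral curve. -/
def fib (q : P.SpectralCurve) : ℂ := q.1.2

/-- The covering involution `ι : (p, v) ↦ (p, -v)`. -/
def invol (q : P.SpectralCurve) : P.SpectralCurve :=
  ⟨(q.1.1, -q.1.2), by simpa using q.2⟩

/-- The linear fibre coordinate `y` of the total space of `ω_X(D)` over a neighbourhood of `p`,
relative to the generator `(x - x(p))^{-D(p)} dx` with `x = chartAt ℂ p`. -/
def fibreCoord (p : X) (q : P.SpectralCurve) : ℂ :=
  open Classical in
  if proj q = p then fib q
  else fib q * pd (chartAt ℂ p) (chartAt ℂ (proj q)) (proj q) *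
    (chartAt ℂ p (proj q) - chartAt ℂ p p) ^ D p

/-- `γ` is a local holomorphic parametrisation of the curve `Σ` centred at `q`: in the local
coordinates `(x, y)` of the total space of `ω_X(D)` near `q` it is an immersed analytic curve.
Such parametrisations give the complex structure on the embedded smooth curve `Σ`. -/
structure IsLocalParam (q : P.SpectralCurve) (γ : ℂ → P.SpectralCurve) : Prop where
  base : γ 0 = q
  mem_chart : ∀ᶠ t in 𝓝 (0 : ℂ), proj (γ t) ∈ (chartAt ℂ (proj q)).source
  x_analytic : AnalyticAt ℂ (fun t => chartAt ℂ (proj q) (proj (γ t))) 0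
  y_analytic : AnalyticAt ℂ (fun t => fibreCoord (proj q) (γ t)) 0
  immersed : deriv (fun t => chartAt ℂ (proj q) (proj (γ t))) 0 ≠ 0 ∨
    deriv (fun t => fibreCoord (proj q) (γ t)) 0 ≠ 0

/-- The ramification index of `π` at `q` (it does not depend on the parametrisation). -/
def ramIndex (q : P.SpectralCurve) : ℕ :=
  sInf {n | ∃ γ, IsLocalParam q γ ∧
    n = analyticOrderNatAt
      (fun t => chartAt ℂ (proj q) (proj (γ t)) - chartAt ℂ (proj q) (proj q)) 0}

/-- The ramification divisor `R` of `π`. -/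
def R (q : P.SpectralCurve) : ℕ := ramIndex q - 1

/-- The divisor `Δ = π^*D ∖ 2R`, where `A ∖ B = A - min(A, B)`. -/
def Delta (q : P.SpectralCurve) : ℕ :=
  ramIndex q * D (proj q) - min (ramIndex q * D (proj q)) (2 * R q)

/-- The divisor `R_Δ = R ∖ Δ` of transition points. -/
def RDelta (q : P.SpectralCurve) : ℕ := R q - min (R q) (Delta q)

/-- The regular points of `Σ`: those over regular points of `X`. -/
def IsRegular (q : P.SpectralCurve) : Prop := P.IsRegularPoint (proj q)

end SpectralCurve

open SpectralCurve

variable (P)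

/-- Meromorphic differentials on `Σ`, written in terms of `π^*dx`: via `π^*ω_X ≅ ω_Σ(-R)` a
meromorphic differential on `Σ` is a meromorphic section of `π^*ω_X`. Here `α q` is the coefficient
at `q` with respect to `π^*dz`, for `z = chartAt ℂ (π q)`. Only values at regular points matter. -/
abbrev Form : Type _ := P.SpectralCurve → ℂ

variable {P}

/-- The coefficient of the differential `α` at `q` with respect to `π^*dx`, for `x = e`. -/
def coeffIn (e : OpenPartialHomeomorph X ℂ) (α : P.Form) (q : P.SpectralCurve) : ℂ :=
  α q * pd e (chartAt ℂ (proj q)) (proj q)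

/-- The coefficient of `dt` in the pullback `γ^*α`. -/
def pullback (α : P.Form) (γ : ℂ → P.SpectralCurve) (t : ℂ) : ℂ :=
  α (γ t) * deriv (fun s => chartAt ℂ (proj (γ t)) (proj (γ s))) t

/-- `α` is a global section of `ω_Σ(Δ)(*R_Δ)`: a meromorphic differential on `Σ`, holomorphic at
regular points, with pole orders bounded by `Δ` outside the support of `R_Δ`. -/
structure IsFormSection (α : P.Form) : Prop where
  hol : ∀ q : P.SpectralCurve, q.IsRegular → ∃ γ, IsLocalParam q γ ∧ AnalyticAt ℂ (pullback α γ) 0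
  mer : ∀ q : P.SpectralCurve, ∃ γ, IsLocalParam q γ ∧ MeromorphicAt (pullback α γ) 0 ∧
    (RDelta q = 0 → ((-(Delta q : ℤ) : ℤ) : WithTop ℤ) ≤ meromorphicOrderAt (pullback α γ) 0)

/-- `f` is a global section of `O_Σ(*R_Δ)`: a meromorphic function on `Σ`, holomorphic outside the
support of `R_Δ` (values at critical points are irrelevant). -/
structure IsFunSection (f : P.SpectralCurve → ℂ) : Prop where
  hol : ∀ q : P.SpectralCurve, q.IsRegular → ∃ γ, IsLocalParam q γ ∧ AnalyticAt ℂ (f ∘ γ) 0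
  mer : ∀ q : P.SpectralCurve, ∃ γ, IsLocalParam q γ ∧ MeromorphicAt (f ∘ γ) 0 ∧
    (RDelta q = 0 → 0 ≤ meromorphicOrderAt (f ∘ γ) 0)

variable (P)

/-- The Liouville form: the restriction to `Σ` of the tautological form. -/
def liouville : P.Form := fun q => fib q

/-- The canonical differential `σ = λ - ι^*λ`. -/
def sigma : P.Form := fun q => P.liouville q - P.liouville (invol q)

/-- The pullback `π^*φ_k` of `φ_k = Q_k dx²` (for `k ≠ 2`), as coefficient of `(π^*dz)²` at `q` with
`z = chartAt ℂ (π q)`. -/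
def pullQuad (k : ℕ) (q : P.SpectralCurve) : ℂ := P.Q (chartAt ℂ (proj q)) k (proj q)

/-! ### Formal WKB solutions -/

/-- The exponential perturbative series `e^{-S/ħ} ∑_n a_n ħ^n`, with `S` a holomorphic function and
`a_n` holomorphic sections of `ω_X^{-1/2}` over `U`, formally satisfies the Schrödinger equation,
i.e. `e^{S/ħ} (ħ² ∂_x² - Q) (e^{-S/ħ} ∑_n a_n ħ^n) = 0` as a power series in `ħ`. -/
structure IsFormalWKB (U : Set X) (s : X → ℂ)
    (a : ℕ → OpenPartialHomeomorph X ℂ → X → ℂ) : Prop where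
  s_hol : ∀ p ∈ U, HolAt s p
  a_section : ∀ n, S.IsSection (-1) (fun _ => 0) U (a n)
  equation : ∀ b ∈ S.frames, ∀ p ∈ U ∩ b.source, D p = 0 →
    (PowerSeries.C (pd b s p ^ 2) * PowerSeries.mk (fun n => a n b p)
      - PowerSeries.X * (PowerSeries.C (pd b (pd b s) p) * PowerSeries.mk (fun n => a n b p)
          + 2 * PowerSeries.C (pd b s p) * PowerSeries.mk (fun n => pd b (a n b) p))
      + PowerSeries.X ^ 2 * PowerSeries.mk (fun n => pd b (pd b (a n b)) p)
      - PowerSeries.mk (fun k => P.Q b k p) * PowerSeries.mk (fun n => a n b p)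
      : PowerSeries ℂ) = 0

/-- `a₀` is a canonical generator of `ω_X^{-1/2}` over the set `U` of regular points: in every local
coordinate `x` it is locally of the form `exp(-¼ ∫ dlog Q₀) dx^{-1/2}`, where `∫ dlog Q₀` is any
local primitive of `dlog Q₀`. -/
structure IsCanonicalGenerator (U : Set X) (a₀ : OpenPartialHomeomorph X ℂ → X → ℂ) : Prop where
  regular : ∀ p ∈ U, P.IsRegularPoint p
  isSection : S.IsSection (-1) (fun _ => 0) U a₀
  formula : ∀ b ∈ S.frames, ∀ p ∈ U ∩ b.source, ∃ L : X → ℂ, ∀ᶠ p' in 𝓝 p,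
    HolAt L p' ∧ pd b L p' = pd b (P.Q b 0) p' / P.Q b 0 p' ∧
      a₀ b p' = Complex.exp (-(L p') / 4)

/-- The series `e^{-S/ħ} ∑_n a_n ħ^n` is a formal WKB solution near `π q` based at the point `q`
of `Σ`, normalised by `a₀`: `ψ(π q) = a₀(π q)` (in particular `S(π q) = 0`) and
`dS(π q) = λ(q)`. -/
structure IsBasedWKB (q : P.SpectralCurve) (a₀ : OpenPartialHomeomorph X ℂ → X → ℂ)
    (U : Set X) (s : X → ℂ) (a : ℕ → OpenPartialHomeomorph X ℂ → X → ℂ) : Prop where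
  isOpen : IsOpen U
  mem : proj q ∈ U
  isFormalWKB : P.IsFormalWKB U s a
  s_base : s (proj q) = 0
  ds_base : pd (chartAt ℂ (proj q)) s (proj q) = P.liouville q
  a_base : ∀ b ∈ S.frames, proj q ∈ b.source → ∀ n,
    a n b (proj q) = if n = 0 then a₀ b (proj q) else 0

variable {P}

/-- `l` is the local holomorphic section of `π` over `V` through the regular point `q`; it
assigns to `p` near `π q` the preimage of `p` near `q`. -/
structure IsLift (q : P.SpectralCurve) (V : Set X) (l : X → P.SpectralCurve) : Prop where
  base : l (proj q) = q
  proj_eq : ∀ p ∈ V, proj (l p) = p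
  hol : ∀ p ∈ V, HolAt (fun p' => fibreCoord (proj q) (l p')) p

/-- `F(p) = ∫_q^{l(p)} α` over `V`: the primitive of `l^*α` which vanishes at `π q`. -/
structure IsIntegral (q : P.SpectralCurve) (V : Set X) (l : X → P.SpectralCurve) (α : P.Form)
    (F : X → ℂ) : Prop where
  base : F (proj q) = 0
  hol : ∀ p ∈ V, HolAt F p
  deriv_eq : ∀ p ∈ V, pd (chartAt ℂ (proj q)) F p = coeffIn (chartAt ℂ (proj q)) α (l p)

/-- The formal WKB solutions based at the regular points `q` of `Σ` are expressed by the formal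
differential `∑_k Λ_k ħ^k`: for every canonical generator `a₀` near `π q`, the expression
`a₀ e^{-S/ħ} A` with `S(p) = ∫_q^{l(p)} λ` and `A(p) = exp(-∫_q^{l(p)} ∑_k Λ_k ħ^k)`, where `l(p)`
is the preimage of `p` near `q`, is a formal WKB solution based at `q`, and every formal WKB
solution based at `q` (with the same `a₀`) coincides with it near `π q`. -/
def ExpressesWKB (Λ : ℕ → P.Form) : Prop :=
  ∀ q : P.SpectralCurve, q.IsRegular →
  ∀ (U : Set X) (a₀ : OpenPartialHomeomorph X ℂ → X → ℂ), IsOpen U → proj q ∈ U →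
  P.IsCanonicalGenerator U a₀ →
  ∃ (V : Set X) (l : X → P.SpectralCurve) (s : X → ℂ) (L : ℕ → X → ℂ),
    IsOpen V ∧ IsPreconnected V ∧ proj q ∈ V ∧ V ⊆ U ∩ (chartAt ℂ (proj q)).source ∧
    IsLift q V l ∧ IsIntegral q V l P.liouville s ∧ (∀ k, IsIntegral q V l (Λ k) (L k)) ∧
    P.IsBasedWKB q a₀ V s (fun n b p => a₀ b p *
      PowerSeries.coeff n (formalExp (-PowerSeries.mk (fun k => L k p)))) ∧
    ∀ (U' : Set X) (s' : X → ℂ) (a' : ℕ → OpenPartialHomeomorph X ℂ → X → ℂ),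
      P.IsBasedWKB q a₀ U' s' a' →
      ∀ᶠ p in 𝓝 (proj q), s' p = s p ∧ ∀ b ∈ S.frames, p ∈ b.source → ∀ n,
        a' n b p = a₀ b p *
          PowerSeries.coeff n (formalExp (-PowerSeries.mk (fun k => L k p)))

/-! ### The global Riccati equation -/

/-- `V(f)(q) = d`, where `V` is the meromorphic vector field on `Σ` with `σ(V) = 1`; that is,
`df = d · σ` at `q`. -/
def HasVDeriv (f : P.SpectralCurve → ℂ) (q : P.SpectralCurve) (d : ℂ) : Prop :=
  ∃ γ, IsLocalParam q γ ∧ HasDerivAt (f ∘ γ) (d * pullback P.sigma γ 0) 0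

variable (P)

/-- The coefficient `w = 2 π^*φ₁ / σ²`. -/
def w (q : P.SpectralCurve) : ℂ := 2 * P.pullQuad 1 q / P.sigma q ^ 2

/-- The coefficients of `W = -Λ₁/σ - ∑_{k ≥ 1} (π^*φ_{k+2}/σ²) ħ^k`. -/
def W (Λ : ℕ → P.Form) (k : ℕ) (q : P.SpectralCurve) : ℂ :=
  if k = 0 then -(Λ 1 q) / P.sigma q else -(P.pullQuad (k + 2) q) / P.sigma q ^ 2

variable {P}

/-- The power series `f = ∑_n f_n ħ^n` of functions on `Σ` satisfies the Riccati equation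
`ħ V(f) - f = ħ (f² + w f + W)` at all regular points. -/
def SolvesRiccati (w : P.SpectralCurve → ℂ) (W f : ℕ → P.SpectralCurve → ℂ) : Prop :=
  ∀ q : P.SpectralCurve, q.IsRegular → ∃ Vf : ℕ → ℂ, (∀ n, HasVDeriv (f n) q (Vf n)) ∧
    (PowerSeries.X * PowerSeries.mk Vf - PowerSeries.mk (fun n => f n q) : PowerSeries ℂ) =
      PowerSeries.X * (PowerSeries.mk (fun n => f n q) ^ 2
        + PowerSeries.C (w q) * PowerSeries.mk (fun n => f n q)
        + PowerSeries.mk (fun n => W n q))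

end SchrodingerOperator

end

end WKB

namespace WKB

set_option linter.unusedSectionVars false

/-! ## Calculus in local coordinates -/

section ChartCalculus

variable {X : Type*} [TopologicalSpace X] [ChartedSpace ℂ X]
  {e e' : OpenPartialHomeomorph X ℂ} {p : X} {F G : X → ℂ}

/-! The ansatz is a₀ e^{-S/ħ} exp(-∫Λ̂). In a coordinate, let l be the coefficient of λ, let α =
-Q₀'/(4Q₀) be the logarithmic derivative of a₀, and let M be the coefficient of Λ̂. The Schrödinger
equation becomes l² - ħ(l' + 2l(α - M)) + ħ²((α - M)' + (α - M)²) - Q = 0. Order zero is l² = Q₀,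
the equation of Σ. Differentiating it gives l' + 2lα = 0 (`IsDisc.pd_coeff`), which is what makes a₀
the right normalisation: order one then reduces to 2lM₀ = Q₁, that is Λ₀ = π^*φ₁/σ. Write M = lw +
2lf. Along a lift d/dx = 2l V, and the remaining orders turn into the Riccati equation
(`riccati_algebra`). Its order-one part only says f₁ = Λ₁/σ, since W₀ itself contains Λ₁; the value
of f₁ comes from the ħ² part of the Schrödinger equation. After that the Riccati equation is a
recursion giving f_{n+1} from V(f_n), products of earlier terms, w and the φ_k (`riccatiSol`).

Globality rests on transformation laws. Comparing powers of h in the operator, viewed in two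
coordinates, shows that Q_k with k ≠ 2 is a quadratic differential (`Q_transform`). Q₂ alone is not
one, but Q₂ - a₀''/a₀ is, because a₀ is a section (`frame_transform`, `secondRatio_eq`). All
ingredients of the recursion are therefore global on Σ.

For the poles, minimality of D and simplicity of the zeros make φ₀ vanish to order n ∈ {0, 1} as a
section of ω_X²(2D) (`ordAt_Q_zero`). Near any point Σ is then y² = zⁿ g with g non-vanishing, and
it has the explicit parameter `IsStdParam`. Functions with poles only at transition points
(`IsNice`) form a ring containing the pulled back φ_k/φ₀ and `secondRatio`. The ring is stable under
V, because away from transition points σ has no zeros (`IsNice.vderiv`).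

For uniqueness, S is fixed by (S')² = Q₀ and the sign of dS at the base point. The difference of two
candidates for a_n, once all earlier coefficients agree, solves a homogeneous linear first-order
equation and vanishes at the base point (`IsBasedWKB.eventually_eq`). Differentiating exp(-∫Λ̂) at
the base point recovers Λ̂ there, so Λ̂ is unique (`expressesWKB_unique`). -/

lemma tendsto_symm_nhds (hp : p ∈ e.source) : Tendsto e.symm (𝓝 (e p)) (𝓝 p) :=
  (e.symm_map_nhds_eq hp).le

lemma eventually_nhds_iff_symm (hp : p ∈ e.source) {T : X → Prop} :
    (∀ᶠ p' in 𝓝 p, T p') ↔ ∀ᶠ z in 𝓝 (e p), T (e.symm z) := by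
  rw [← e.symm_map_nhds_eq hp, eventually_map]

lemma eventually_mem_target (hp : p ∈ e.source) : ∀ᶠ z in 𝓝 (e p), z ∈ e.target :=
  e.open_target.mem_nhds (e.map_source hp)

lemma tendsto_symm_nhdsNE (hp : p ∈ e.source) : Tendsto e.symm (𝓝[≠] (e p)) (𝓝[≠] p) := by
  refine tendsto_nhdsWithin_iff.2
    ⟨(tendsto_symm_nhds hp).mono_left nhdsWithin_le_nhds, ?_⟩
  filter_upwards [eventually_mem_nhdsWithin, (eventually_mem_target hp).filter_mono
    nhdsWithin_le_nhds] with z hz hz' h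
  exact hz (by rw [← e.right_inv hz', mem_singleton_iff.1 h]; rfl)

lemma eventuallyEq_comp_symm (hp : p ∈ e.source) (hp' : p ∈ e'.source) (F : X → ℂ) :
    F ∘ e.symm =ᶠ[𝓝 (e p)] (F ∘ e'.symm) ∘ (e' ∘ e.symm) := by
  have h := (tendsto_symm_nhds hp).eventually (e'.open_source.mem_nhds hp')
  filter_upwards [h] with z hz
  simp [e'.left_inv hz]

section Basic

lemma eventually_pd_eq_deriv (hp : p ∈ e.source) (F : X → ℂ) :
    (pd e F) ∘ e.symm =ᶠ[𝓝 (e p)] deriv (F ∘ e.symm) := by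
  filter_upwards [eventually_mem_target hp] with z hz
  simp [pd, e.right_inv hz]

lemma eventuallyEq_symm (hp : p ∈ e.source) (h : F =ᶠ[𝓝 p] G) :
    F ∘ e.symm =ᶠ[𝓝 (e p)] G ∘ e.symm :=
  h.comp_tendsto (tendsto_symm_nhds hp)

lemma pd_congr (hp : p ∈ e.source) (h : F =ᶠ[𝓝 p] G) : pd e F p = pd e G p :=
  (eventuallyEq_symm hp h).deriv_eq

lemma pd_congr_eventually (hp : p ∈ e.source) (h : F =ᶠ[𝓝 p] G) : pd e F =ᶠ[𝓝 p] pd e G := by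
  filter_upwards [h.eventuallyEq_nhds, e.open_source.mem_nhds hp] with p' h1 h2
  exact pd_congr h2 h1

lemma pd_self (hp : p ∈ e.source) : pd e e p = 1 := by
  have : e ∘ e.symm =ᶠ[𝓝 (e p)] id := by
    filter_upwards [eventually_mem_target hp] with z hz using e.right_inv hz
  rw [pd, this.deriv_eq, deriv_id]

end Basic

section Manifold

lemma analyticAt_transition (he : e ∈ Coord X) (he' : e' ∈ Coord X) (hp : p ∈ e.source)
    (hp' : p ∈ e'.source) : AnalyticAt ℂ (e' ∘ e.symm) (e p) := by
  have h := IsManifold.compatible_of_mem_maximalAtlas he he'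
  have h1 : ContDiffOn ℂ ω (e' ∘ e.symm) (e.symm.trans e').source := by
    have := (mem_groupoid_of_pregroupoid.1 h).1
    simpa [contDiffPregroupoid] using this
  have hm : e p ∈ (e.symm.trans e').source := by
    simp [e.map_source hp, e.left_inv hp, hp']
  exact (h1.contDiffAt ((e.symm.trans e').open_source.mem_nhds hm)).analyticAt

lemma pd_chain (he : e ∈ Coord X) (he' : e' ∈ Coord X) (hp : p ∈ e.source)
    (hp' : p ∈ e'.source) (hF : DifferentiableAt ℂ (F ∘ e'.symm) (e' p)) :
    pd e F p = pd e' F p * pd e e' p := by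
  have h := (analyticAt_transition he he' hp hp').differentiableAt
  have hv : (e' ∘ e.symm) (e p) = e' p := by simp [e.left_inv hp]
  rw [pd, (eventuallyEq_comp_symm hp hp' F).deriv_eq, deriv_comp _ (by rwa [hv]) h, hv]
  rfl

lemma pd_mul_pd (he : e ∈ Coord X) (he' : e' ∈ Coord X) (hp : p ∈ e.source)
    (hp' : p ∈ e'.source) : pd e' e p * pd e e' p = 1 := by
  rw [← pd_chain he he' hp hp' (analyticAt_transition he' he hp' hp).differentiableAt, pd_self hp]

lemma pd_ne_zero (he : e ∈ Coord X) (he' : e' ∈ Coord X) (hp : p ∈ e.source)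
    (hp' : p ∈ e'.source) : pd e e' p ≠ 0 :=
  right_ne_zero_of_mul_eq_one (pd_mul_pd he he' hp hp')

lemma pd_trans {e'' : OpenPartialHomeomorph X ℂ} (he : e ∈ Coord X) (he' : e' ∈ Coord X)
    (he'' : e'' ∈ Coord X) (hp : p ∈ e.source) (hp' : p ∈ e'.source) (hp'' : p ∈ e''.source) :
    pd e e'' p = pd e' e'' p * pd e e' p :=
  pd_chain he he' hp hp' (analyticAt_transition he' he'' hp' hp'').differentiableAt

variable [IsManifold 𝓘(ℂ) ω X]

lemma chart_mem_coord (p : X) : chartAt ℂ p ∈ Coord X := IsManifold.chart_mem_maximalAtlas p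

lemma analyticAt_comp_symm_iff (he : e ∈ Coord X) (he' : e' ∈ Coord X) (hp : p ∈ e.source)
    (hp' : p ∈ e'.source) : AnalyticAt ℂ (F ∘ e.symm) (e p) ↔ AnalyticAt ℂ (F ∘ e'.symm) (e' p) := by
  have key : ∀ {e e' : OpenPartialHomeomorph X ℂ}, e ∈ Coord X → e' ∈ Coord X → p ∈ e.source →
      p ∈ e'.source → AnalyticAt ℂ (F ∘ e'.symm) (e' p) → AnalyticAt ℂ (F ∘ e.symm) (e p) := by
    intro e e' he he' hp hp' h
    have hv : (e' ∘ e.symm) (e p) = e' p := by simp [e.left_inv hp]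
    exact (AnalyticAt.comp (by rwa [hv]) (analyticAt_transition he he' hp hp')).congr
      (eventuallyEq_comp_symm hp hp' F).symm
  exact ⟨key he' he hp' hp, key he he' hp hp'⟩

lemma holAt_iff (he : e ∈ Coord X) (hp : p ∈ e.source) :
    HolAt F p ↔ AnalyticAt ℂ (F ∘ e.symm) (e p) :=
  analyticAt_comp_symm_iff (chart_mem_coord p) he (mem_chart_source ℂ p) hp

lemma merAt_iff (he : e ∈ Coord X) (hp : p ∈ e.source) :
    MerAt F p ↔ MeromorphicAt (F ∘ e.symm) (e p) := by
  have hc := chart_mem_coord (X := X) p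
  have hpc := mem_chart_source ℂ p
  have hv : (e ∘ (chartAt ℂ p).symm) (chartAt ℂ p p) = e p := by simp
  rw [MerAt, MeromorphicAt.meromorphicAt_congr
    ((eventuallyEq_comp_symm hpc hp F).filter_mono nhdsWithin_le_nhds),
    meromorphicAt_comp_iff_of_deriv_ne_zero (analyticAt_transition hc he hpc hp)
      (pd_ne_zero hc he hpc hp), hv]

lemma ordAt_eq (he : e ∈ Coord X) (hp : p ∈ e.source) :
    ordAt F p = meromorphicOrderAt (F ∘ e.symm) (e p) := by
  have hc := chart_mem_coord (X := X) p
  have hpc := mem_chart_source ℂ p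
  have hv : (e ∘ (chartAt ℂ p).symm) (chartAt ℂ p p) = e p := by simp
  rw [ordAt, meromorphicOrderAt_congr
    ((eventuallyEq_comp_symm hpc hp F).filter_mono nhdsWithin_le_nhds),
    meromorphicOrderAt_comp_of_deriv_ne_zero (analyticAt_transition hc he hpc hp)
      (pd_ne_zero hc he hpc hp), hv]

lemma HolAt.eventually (h : HolAt F p) : ∀ᶠ p' in 𝓝 p, HolAt F p' := by
  have hpc := mem_chart_source ℂ p
  rw [eventually_nhds_iff_symm hpc]
  filter_upwards [h.eventually_analyticAt, eventually_mem_target hpc] with z hz hz'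
  rw [holAt_iff (chart_mem_coord p) ((chartAt ℂ p).map_target hz'), (chartAt ℂ p).right_inv hz']
  exact hz

lemma HolAt.congr (h : HolAt F p) (hFG : F =ᶠ[𝓝 p] G) : HolAt G p :=
  AnalyticAt.congr h (eventuallyEq_symm (mem_chart_source ℂ p) hFG)

lemma HolAt.pd (h : HolAt F p) (he : e ∈ Coord X) (hp : p ∈ e.source) : HolAt (pd e F) p :=
  (holAt_iff he hp).2
    (((holAt_iff he hp).1 h).deriv.congr (eventually_pd_eq_deriv hp F).symm)

lemma HolAt.hasDerivAt (h : HolAt F p) (he : e ∈ Coord X) (hp : p ∈ e.source) :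
    HasDerivAt (F ∘ e.symm) (WKB.pd e F p) (e p) :=
  ((holAt_iff he hp).1 h).differentiableAt.hasDerivAt

lemma HolAt.pd_chain (h : HolAt F p) (he : e ∈ Coord X) (he' : e' ∈ Coord X) (hp : p ∈ e.source)
    (hp' : p ∈ e'.source) : WKB.pd e F p = WKB.pd e' F p * WKB.pd e e' p :=
  WKB.pd_chain he he' hp hp' ((holAt_iff he' hp').1 h).differentiableAt

lemma HolAt.continuousAt (h : HolAt F p) : ContinuousAt F p := by
  have hpc := mem_chart_source ℂ p
  have h1 : ContinuousAt (fun p' => (F ∘ (chartAt ℂ p).symm) (chartAt ℂ p p')) p :=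
    ContinuousAt.comp (f := chartAt ℂ p) (AnalyticAt.continuousAt h)
      ((chartAt ℂ p).continuousAt hpc)
  refine h1.congr ?_
  filter_upwards [(chartAt ℂ p).open_source.mem_nhds hpc] with p' hp'
  simp [(chartAt ℂ p).left_inv hp']

lemma HolAt.mul (h : HolAt F p) (h' : HolAt G p) : HolAt (fun x => F x * G x) p :=
  AnalyticAt.mul h h'

lemma HolAt.inv (h : HolAt F p) (h0 : F p ≠ 0) : HolAt (fun x => (F x)⁻¹) p :=
  AnalyticAt.inv h (by simpa using h0)

lemma holAt_const (c : ℂ) (p : X) : HolAt (fun _ => c) p := analyticAt_const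

lemma holAt_coord (he : e ∈ Coord X) (hp : p ∈ e.source) : HolAt e p :=
  analyticAt_transition (chart_mem_coord p) he (mem_chart_source ℂ p) hp

lemma holAt_jacobian (he : e ∈ Coord X) (he' : e' ∈ Coord X) (hp : p ∈ e.source)
    (hp' : p ∈ e'.source) : HolAt (WKB.pd e e') p := (holAt_coord he' hp').pd he hp

lemma holAt_comp_coord {f : ℂ → ℂ} (he : e ∈ Coord X) (hp : p ∈ e.source)
    (hf : AnalyticAt ℂ f (e p)) : HolAt (fun x => f (e x)) p :=
  AnalyticAt.comp (f := e ∘ (chartAt ℂ p).symm) (by simpa using hf) (holAt_coord he hp)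

lemma pd_comp_coord {f : ℂ → ℂ} (hp : p ∈ e.source) : pd e (fun x => f (e x)) p = deriv f (e p) := by
  refine Filter.EventuallyEq.deriv_eq ?_
  filter_upwards [eventually_mem_target hp] with z hz
  simp [e.right_inv hz]

lemma HolAt.poleLE_zero (h : HolAt F p) : PoleLE F p 0 :=
  ⟨AnalyticAt.meromorphicAt h, by simpa [ordAt] using AnalyticAt.meromorphicOrderAt_nonneg h⟩

lemma ordAt_congr (h : F =ᶠ[𝓝[≠] p] G) : ordAt F p = ordAt G p :=
  meromorphicOrderAt_congr (h.comp_tendsto (tendsto_symm_nhdsNE (mem_chart_source ℂ p)))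

lemma HolAt.ordAt_mul (h : HolAt G p) (h0 : G p ≠ 0) (F : X → ℂ) :
    ordAt (fun x => G x * F x) p = ordAt F p :=
  meromorphicOrderAt_mul_of_ne_zero (g := G ∘ (chartAt ℂ p).symm) h (by simpa using h0)

lemma HolAt.pd_mul (hF : HolAt F p) (hG : HolAt G p) (he : e ∈ Coord X) (hp : p ∈ e.source) :
    WKB.pd e (fun x => F x * G x) p = WKB.pd e F p * G p + F p * WKB.pd e G p := by
  have := ((hF.hasDerivAt he hp).mul (hG.hasDerivAt he hp)).deriv
  simpa [WKB.pd, Function.comp_def, e.left_inv hp, Pi.mul_def] using this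

end Manifold

end ChartCalculus

/-! ## Square roots and logarithmic primitives of analytic functions -/

/-- Dividing by `g x` first moves the argument of the principal logarithm to 1, away from its cut;
the prescribed root `d` fixes the branch. -/
lemma AnalyticAt.exists_sqrt {g : ℂ → ℂ} {x d : ℂ} (hg : AnalyticAt ℂ g x) (hd : d ^ 2 = g x)
    (h0 : d ≠ 0) : ∃ s : ℂ → ℂ, AnalyticAt ℂ s x ∧ s x = d ∧ ∀ᶠ z in 𝓝 x, s z ^ 2 = g z := by
  have hgx : g x ≠ 0 := by rw [← hd]; positivity
  refine ⟨fun z => d * Complex.exp (Complex.log (g z / g x) / 2), ?_, ?_, ?_⟩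
  · have h1 : AnalyticAt ℂ (fun z => g z / g x) x := hg.div analyticAt_const hgx
    have h2 : AnalyticAt ℂ (fun z => Complex.log (g z / g x)) x :=
      h1.clog (by simp [div_self hgx])
    fun_prop
  · simp [div_self hgx]
  · filter_upwards [hg.continuousAt.eventually_ne hgx] with z hz
    rw [mul_pow, ← Complex.exp_nat_mul, hd]
    have : ((2 : ℕ) : ℂ) * (Complex.log (g z / g x) / 2) = Complex.log (g z / g x) := by
      push_cast; ring
    rw [this, Complex.exp_log (div_ne_zero hz hgx)]
    field_simp

/-! ## Transformation laws of the Schrödinger operator -/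

section Operator

variable {X : Type*} [TopologicalSpace X] [ChartedSpace ℂ X] [IsManifold 𝓘(ℂ) ω X]
  {S : SpinStructure X} {D : X →₀ ℕ} {b c e e' : OpenPartialHomeomorph X ℂ} {p : X}

/-- The cocycle law makes the value idempotent, and `trans_sq` with Jacobian 1 makes it nonzero. -/
lemma SpinStructure.trans_self (hb : b ∈ S.frames) (hp : p ∈ b.source) : S.trans b b p = 1 := by
  have h1 := S.trans_cocycle b hb b hb b hb p ⟨⟨hp, hp⟩, hp⟩
  have h2 := S.trans_sq b hb b hb p ⟨hp, hp⟩
  rw [pd_self hp] at h2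
  have h3 : S.trans b b p ≠ 0 := fun h => by simp [h] at h2
  exact mul_left_cancel₀ h3 (by rw [← h1, mul_one])

lemma SpinStructure.trans_mul_trans (hb : b ∈ S.frames) (hc : c ∈ S.frames) (hp : p ∈ b.source)
    (hp' : p ∈ c.source) : S.trans b c p * S.trans c b p = 1 := by
  rw [← S.trans_cocycle b hb c hc b hb p ⟨⟨hp, hp'⟩, hp⟩, trans_self hb hp]

lemma SpinStructure.trans_ne_zero (hb : b ∈ S.frames) (hc : c ∈ S.frames) (hp : p ∈ b.source)
    (hp' : p ∈ c.source) : S.trans b c p ≠ 0 :=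
  left_ne_zero_of_mul_eq_one (trans_mul_trans hb hc hp hp')

lemma SpinStructure.isSection_of_holAt {m : ℤ} {U : Set X}
    {ψ : OpenPartialHomeomorph X ℂ → X → ℂ}
    (hol : ∀ b ∈ S.frames, ∀ p ∈ U ∩ b.source, HolAt (ψ b) p)
    (glue : ∀ b ∈ S.frames, ∀ c ∈ S.frames, ∀ p ∈ U ∩ (b.source ∩ c.source),
      ψ b p = ψ c p * S.trans b c p ^ m) : S.IsSection m (fun _ => 0) U ψ where
  hol b hb p hp _ := hol b hb p hp
  pole b hb p hp := (hol b hb p hp).poleLE_zero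
  glue b hb c hc p hp _ := glue b hb c hc p hp

/-- A generator dx^{1/2} for an arbitrary coordinate is determined by its expression in a single
frame. This supplies the roots at which `operator` is evaluated. -/
lemma SpinStructure.isRoot_of_sq {V : Set X} {g : X → ℂ} (he : e ∈ Coord X) (hb : b ∈ S.frames)
    (hV : V ⊆ e.source ∩ b.source) (hg : ∀ p ∈ V, HolAt g p) (hsq : ∀ p ∈ V, g p ^ 2 = pd b e p) :
    S.IsRoot e V (fun c p => g p * S.trans c b p) := by
  refine ⟨isSection_of_holAt (fun c hc p hp => ?_) (fun c hc d hd p hp => ?_), fun c hc p hp => ?_⟩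
  · exact (hg p hp.1).mul (S.trans_hol c hc b hb p ⟨hp.2, (hV hp.1).2⟩)
  · rw [S.trans_cocycle c hc d hd b hb p ⟨hp.2, (hV hp.1).2⟩]
    simp only [zpow_one]
    ring
  · have h := hV hp.1
    rw [mul_pow, hsq p hp.1, S.trans_sq c hc b hb p ⟨hp.2, h.2⟩,
      pd_trans (S.frames_subset hc) (S.frames_subset hb) he hp.2 h.2 h.1]

namespace SchrodingerOperator

variable (P : SchrodingerOperator S D)

/-- The value at `h` of the polynomial `∑_k Q_k(p) ħ^k`. -/
noncomputable def potential (e : OpenPartialHomeomorph X ℂ) (p : X) (h : ℂ) : ℂ :=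
  ∑ k ∈ Finset.range (P.degree + 1), P.Q e k p * h ^ k

/-- Restates `operator` with a root given by one function `g` in one frame: relative to that root
the coefficient of `ψ` (weight -1) is `ψ b * g`, and that of its image (weight 3) is `χ b / g ^ 3`.
-/
lemma exists_image (h : ℂ) {U : Set X} (hU : IsOpen U) (hD : ∀ p ∈ U, D p = 0)
    {ψ : OpenPartialHomeomorph X ℂ → X → ℂ} (hψ : S.IsSection (-1) (fun _ => 0) U ψ) :
    ∃ χ : OpenPartialHomeomorph X ℂ → X → ℂ,
      (∀ b ∈ S.frames, ∀ c ∈ S.frames, ∀ p ∈ U ∩ (b.source ∩ c.source),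
        χ b p = χ c p * S.trans b c p ^ 3) ∧
      ∀ e ∈ Coord X, ∀ b ∈ S.frames, ∀ V : Set X, IsOpen V → V ⊆ U ∩ (e.source ∩ b.source) →
        ∀ g : X → ℂ, (∀ p ∈ V, HolAt g p) → (∀ p ∈ V, g p ^ 2 = pd b e p) → ∀ p ∈ V,
        χ b p / g p ^ 3 = h ^ 2 * pd e (pd e (fun x => ψ b x * g x)) p
          - P.potential e p h * (ψ b p * g p) := by
  obtain ⟨χ, hχ, hloc⟩ := P.operator h U hU ψ hψ
  have hglue : ∀ b ∈ S.frames, ∀ c ∈ S.frames, ∀ p ∈ U ∩ (b.source ∩ c.source),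
        χ b p = χ c p * S.trans b c p ^ 3 := fun b hb c hc p hp => by
    have := hχ.glue b hb c hc p hp (by simp [hD p hp.1])
    exact_mod_cast this
  refine ⟨χ, hglue, fun e he b hb V hV hVU g hg hsq p hp => ?_⟩
  have hg0 : ∀ p ∈ V, g p ≠ 0 := fun p hp h0 => by
    have := hsq p hp
    have h' := pd_ne_zero (S.frames_subset hb) he (hVU hp).2.2 (hVU hp).2.1
    rw [h0] at this
    exact h' (by simpa using this.symm)
  refine hloc e he V hV (fun p hp => ⟨(hVU hp).1, (hVU hp).2.1⟩) (fun p hp => hD p (hVU hp).1)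
    (fun c p => g p * S.trans c b p)
    (SpinStructure.isRoot_of_sq he hb (fun p hp => (hVU hp).2) hg hsq)
    (fun x => ψ b x * g x) (fun x => χ b x / g x ^ 3) ?_ ?_ p hp
  · intro c hc p hp
    have h1 := hψ.glue c hc b hb p ⟨(hVU hp.1).1, hp.2, (hVU hp.1).2.2⟩ rfl
    have h2 := hg0 p hp.1
    have h3 := SpinStructure.trans_ne_zero hc hb hp.2 (hVU hp.1).2.2
    simp only [zpow_neg, zpow_one] at h1 ⊢
    rw [h1]
    field_simp
  · intro c hc p hp
    have h1 := hglue c hc b hb p ⟨(hVU hp.1).1, hp.2, (hVU hp.1).2.2⟩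
    have h2 := hg0 p hp.1
    have h4 : (g p * S.trans c b p) ^ (3 : ℤ) = (g p * S.trans c b p) ^ 3 := by norm_cast
    simp only [h4]
    rw [h1]
    field_simp

end SchrodingerOperator

/-- Comparison of the coefficients of two proportional polynomials
`u h² - ∑_k A_k h^k` and `u' h² - ∑_k A'_k h^k`. -/
lemma coeff_comparison {N : ℕ} {A A' : ℕ → ℂ} {u u' m : ℂ} (hA : ∀ k, N < k → A k = 0)
    (hA' : ∀ k, N < k → A' k = 0)
    (H : ∀ h : ℂ, h ^ 2 * u - ∑ k ∈ Finset.range (N + 1), A k * h ^ k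
      = m * (h ^ 2 * u' - ∑ k ∈ Finset.range (N + 1), A' k * h ^ k)) :
    (∀ k, k ≠ 2 → A k = m * A' k) ∧ A 2 - u = m * (A' 2 - u') := by
  let p (A : ℕ → ℂ) (u : ℂ) : Polynomial ℂ := Polynomial.C u * Polynomial.X ^ 2 -
    ∑ k ∈ Finset.range (N + 1), Polynomial.C (A k) * Polynomial.X ^ k
  have hp : p A u = Polynomial.C m * p A' u' := by
    refine Polynomial.funext fun h => ?_
    have := H h
    simp only [p, Polynomial.eval_sub, Polynomial.eval_mul, Polynomial.eval_C, Polynomial.eval_pow,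
      Polynomial.eval_X, Polynomial.eval_finsetSum]
    rw [mul_comm u, mul_comm u', this]
  have hc : ∀ (A : ℕ → ℂ) (u : ℂ), (∀ k, N < k → A k = 0) → ∀ k, (p A u).coeff k
      = (if k = 2 then u else 0) - A k := by
    intro A u hA k
    simp only [p, Polynomial.coeff_sub, Polynomial.coeff_C_mul, Polynomial.coeff_X_pow,
      Polynomial.finsetSum_coeff, mul_ite, mul_one, mul_zero, Finset.sum_ite_eq, Finset.mem_range]
    congr 1
    split_ifs with h
    · rfl
    · exact (hA k (by omega)).symm
  have h1 : ∀ k, (if k = 2 then u else 0) - A k = m * ((if k = 2 then u' else 0) - A' k) := by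
    intro k
    rw [← hc A u hA, ← hc A' u' hA', hp, Polynomial.coeff_C_mul]
  refine ⟨fun k hk => ?_, ?_⟩
  · have := h1 k
    simp only [hk, if_false] at this
    linear_combination -this
  · have := h1 2
    simp only [if_true] at this
    linear_combination -this

namespace SchrodingerOperator

variable (P : SchrodingerOperator S D)

lemma Q_eq_zero_of_lt (he : e ∈ Coord X) (hp : p ∈ e.source) {k : ℕ} (hk : P.degree < k) :
    P.Q e k p = 0 := P.Q_degree e he k hk p hp

/-- The second order transformation law between two frames. -/
lemma frame_transform (hb : b ∈ S.frames) (hc : c ∈ S.frames) {U : Set X} (hU : IsOpen U)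
    (hD : ∀ p ∈ U, D p = 0) {ψ : OpenPartialHomeomorph X ℂ → X → ℂ}
    (hψ : S.IsSection (-1) (fun _ => 0) U ψ) (hp : p ∈ U ∩ (b.source ∩ c.source))
    (h0 : ψ b p ≠ 0) (h0' : ψ c p ≠ 0) :
    P.Q b 2 p - pd b (pd b (ψ b)) p / ψ b p
      = pd b c p ^ 2 * (P.Q c 2 p - pd c (pd c (ψ c)) p / ψ c p) := by
  have hbC := S.frames_subset hb
  have hcC := S.frames_subset hc
  -- Divided by ψ, the operator is a polynomial in h into which ψ''/ψ enters only at h². The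
  -- degree-two comparison is the claim.
  refine (coeff_comparison (A := fun k => P.Q b k p) (A' := fun k => P.Q c k p)
    (fun k => P.Q_eq_zero_of_lt hbC hp.2.1) (fun k => P.Q_eq_zero_of_lt hcC hp.2.2)
    fun h => ?_).2
  obtain ⟨χ, hglue, hloc⟩ := P.exists_image h hU hD hψ
  have key : ∀ b ∈ S.frames, p ∈ b.source → χ b p = h ^ 2 * pd b (pd b (ψ b)) p
      - P.potential b p h * ψ b p := fun b hb hpb => by
    have := hloc b (S.frames_subset hb) b hb (U ∩ b.source) (hU.inter b.open_source)
      (fun x hx => ⟨hx.1, hx.2, hx.2⟩) (fun _ => 1) (fun x _ => holAt_const 1 x)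
      (fun x hx => by simp [pd_self hx.2]) p ⟨hp.1, hpb⟩
    simpa using this
  have k1 := key b hb hp.2.1
  have k2 := key c hc hp.2.2
  have k3 := hglue b hb c hc p hp
  have k4 := hψ.glue b hb c hc p hp rfl
  have k5 := SpinStructure.trans_ne_zero hb hc hp.2.1 hp.2.2
  have k6 := S.trans_sq b hb c hc p hp.2
  change h ^ 2 * _ - P.potential b p h = pd b c p ^ 2 * (h ^ 2 * _ - P.potential c p h)
  have e1 : h ^ 2 * (pd b (pd b (ψ b)) p / ψ b p) - P.potential b p h = χ b p / ψ b p := by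
    rw [k1]; field_simp
  have e2 : h ^ 2 * (pd c (pd c (ψ c)) p / ψ c p) - P.potential c p h = χ c p / ψ c p := by
    rw [k2]; field_simp
  rw [e1, e2, k3, k4, ← k6]
  simp only [zpow_neg, zpow_one]
  field_simp

/-- The coefficients `Q_k`, `k ≠ 2`, transform as quadratic differentials. -/
lemma Q_frame_transform (hb : b ∈ S.frames) (he : e ∈ Coord X) (hp : p ∈ b.source)
    (hpe : p ∈ e.source) (hDev : ∀ᶠ p' in 𝓝 p, D p' = 0) {k : ℕ} (hk : k ≠ 2) :
    P.Q b k p = pd b e p ^ 2 * P.Q e k p := by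
  have hbC := S.frames_subset hb
  -- The coordinate `e` need not be a frame, so a local square root of the Jacobian has to be
  -- chosen.
  obtain ⟨d, hd⟩ : ∃ d : ℂ, d ^ 2 = (pd b e ∘ b.symm) (b p) :=
    IsAlgClosed.exists_pow_nat_eq _ two_pos
  have hd' : d ^ 2 = pd b e p := by simpa [b.left_inv hp] using hd
  have hJ := pd_ne_zero hbC he hp hpe
  obtain ⟨s, hs, hsd, hssq⟩ := AnalyticAt.exists_sqrt
    ((holAt_iff hbC hp).1 (holAt_jacobian hbC he hp hpe)) hd
    (by rintro rfl; exact hJ (by simpa using hd'.symm))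
  have hsq : ∀ᶠ p' in 𝓝 p, s (b p') ^ 2 = pd b e p' := by
    rw [eventually_nhds_iff_symm hp]
    filter_upwards [hssq, eventually_mem_target hp] with z hz hz'
    rw [b.right_inv hz', hz]; rfl
  have hev := hsq.and ((holAt_comp_coord hbC hp hs).eventually.and
    (hDev.and ((b.open_source.eventually_mem hp).and (e.open_source.eventually_mem hpe))))
  obtain ⟨V, hV, hVo, hpV⟩ := eventually_nhds_iff.1 hev
  set g : X → ℂ := fun x => s (b x) with hg
  have hgp : g p ≠ 0 := by
    intro h0
    have := (hV p hpV).1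
    rw [show s (b p) = 0 from h0] at this
    exact hJ (by simpa using this.symm)
  -- The test section reads 1 in the frame `b`, so its second derivative there is zero. In `e`
  -- derivatives enter only at h², which is why k = 2 is excluded.
  have hψ : S.IsSection (-1) (fun _ => 0) V (fun c p => (S.trans c b p)⁻¹) := by
    refine SpinStructure.isSection_of_holAt (fun c hc x hx => ?_) (fun c hc d hd x hx => ?_)
    · have hxb := (hV x hx.1).2.2.2.1
      exact (S.trans_hol c hc b hb x ⟨hx.2, hxb⟩).inv
        (SpinStructure.trans_ne_zero hc hb hx.2 hxb)
    · have hxb := (hV x hx.1).2.2.2.1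
      rw [S.trans_cocycle c hc d hd b hb x ⟨hx.2, hxb⟩]
      simp only [zpow_neg, zpow_one]
      rw [mul_inv, mul_comm]
  have hbb : (fun x => (S.trans b b x)⁻¹) =ᶠ[𝓝 p] fun _ => 1 := by
    filter_upwards [hVo.mem_nhds hpV] with x hx
    rw [SpinStructure.trans_self hb (hV x hx).2.2.2.1, inv_one]
  have hbb' := hbb.eq_of_nhds
  simp only [inv_eq_one] at hbb'
  refine (coeff_comparison (A := fun k => P.Q b k p) (A' := fun k => P.Q e k p)
    (u := 0) (u' := pd e (pd e g) p / g p)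
    (fun k => P.Q_eq_zero_of_lt hbC hp) (fun k => P.Q_eq_zero_of_lt he hpe)
    fun h => ?_).1 k hk
  obtain ⟨χ, -, hloc⟩ := P.exists_image h hVo (fun x hx => (hV x hx).2.2.1) hψ
  have k1 := hloc b hbC b hb V hVo (fun x hx => ⟨hx, (hV x hx).2.2.2.1, (hV x hx).2.2.2.1⟩)
      (fun _ => 1) (fun x _ => holAt_const 1 x)
      (fun x hx => by simp [pd_self (hV x hx).2.2.2.1]) p hpV
  have k2 := hloc e he b hb V hVo (fun x hx => ⟨hx, (hV x hx).2.2.2.2, (hV x hx).2.2.2.1⟩)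
      g (fun x hx => (hV x hx).2.1) (fun x hx => (hV x hx).1) p hpV
  have c1 : pd b (pd b (fun x => (S.trans b b x)⁻¹ * 1)) p = 0 := by
    have h1 : pd b (fun x => (S.trans b b x)⁻¹ * 1) =ᶠ[𝓝 p] pd b (fun _ => (1 : ℂ)) := by
      refine pd_congr_eventually hp ?_
      filter_upwards [hbb] with x hx using by rw [hx, mul_one]
    rw [pd_congr hp h1]
    have : pd b (fun _ : X => (1 : ℂ)) = fun _ => 0 := by
      funext x; simp [pd, Function.comp_def]
    rw [this]
    simp [pd, Function.comp_def]
  have c2 : pd e (pd e (fun x => (S.trans b b x)⁻¹ * g x)) p = pd e (pd e g) p := by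
    refine pd_congr hpe (pd_congr_eventually hpe ?_)
    filter_upwards [hbb] with x hx using by rw [hx, one_mul]
  rw [c1, hbb'] at k1
  rw [c2, hbb'] at k2
  change h ^ 2 * 0 - P.potential b p h = pd b e p ^ 2 *
    (h ^ 2 * (pd e (pd e g) p / g p) - P.potential e p h)
  have k3 := (hV p hpV).1
  change g p ^ 2 = _ at k3
  simp only [one_pow, div_one, inv_one, one_mul, mul_one] at k1 k2
  rw [← k1, ← k3]
  rw [div_eq_iff (by positivity)] at k2
  rw [k2]
  field_simp

variable [T1Space X]

lemma eventually_divisor_eq_zero (D : X →₀ ℕ) (p : X) : ∀ᶠ p' in 𝓝[≠] p, D p' = 0 := by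
  have h : ((D.support : Set X) \ {p}).Finite := D.support.finite_toSet.sdiff
  have : ∀ᶠ p' in 𝓝 p, p' ∉ ((D.support : Set X) \ {p}) :=
    h.isClosed.isOpen_compl.mem_nhds (by simp)
  filter_upwards [this.filter_mono nhdsWithin_le_nhds, eventually_mem_nhdsWithin] with x h1 h2
  by_contra h3
  exact h1 ⟨by simpa using h3, h2⟩

lemma eventually_divisor_eq_zero' {D : X →₀ ℕ} {p : X} (h : D p = 0) : ∀ᶠ p' in 𝓝 p, D p' = 0 := by
  have := eventually_divisor_eq_zero D p
  rw [eventually_nhdsWithin_iff] at this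
  filter_upwards [this] with x hx
  by_cases hxp : x = p
  · rw [hxp, h]
  · exact hx hxp

/-- Both coordinates are compared with a frame at `p`, and the common Jacobian cancels. -/
lemma Q_transform (he : e ∈ Coord X) (he' : e' ∈ Coord X) (hp : p ∈ e.source)
    (hp' : p ∈ e'.source) (hDp : D p = 0) {k : ℕ} (hk : k ≠ 2) :
    P.Q e k p = pd e e' p ^ 2 * P.Q e' k p := by
  obtain ⟨b, hb, hpb⟩ := S.covers p
  have hbC := S.frames_subset hb
  have hD := eventually_divisor_eq_zero' hDp
  have h1 := P.Q_frame_transform hb he hpb hp hD hk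
  have h2 := P.Q_frame_transform hb he' hpb hp' hD hk
  rw [pd_trans hbC he he' hpb hp hp', h1] at h2
  have h3 : pd b e p ^ 2 ≠ 0 := pow_ne_zero _ (pd_ne_zero hbC he hpb hp)
  refine mul_left_cancel₀ h3 ?_
  linear_combination h2

end SchrodingerOperator

end Operator

/-! ## Local structure of the spectral curve -/

namespace SchrodingerOperator

section LocalForm

variable {X : Type*} [TopologicalSpace X] [ChartedSpace ℂ X] [IsManifold 𝓘(ℂ) ω X] [T1Space X]
  {S : SpinStructure X} {D : X →₀ ℕ} {b c e e' : OpenPartialHomeomorph X ℂ} {p : X}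
  {P : SchrodingerOperator S D}

/-- Both standing assumptions on the zeros and poles of the coefficients. -/
def Admissible (P : SchrodingerOperator S D) : Prop := P.ZerosSimple ∧ P.PolesDominated

lemma ordAt_Q_eq (he : e ∈ Coord X) (he' : e' ∈ Coord X) (hp : p ∈ e.source)
    (hp' : p ∈ e'.source) {k : ℕ} (hk : k ≠ 2) : ordAt (P.Q e k) p = ordAt (P.Q e' k) p := by
  have hJ := holAt_jacobian he he' hp hp'
  have hJ0 := pd_ne_zero he he' hp hp'
  rw [← HolAt.ordAt_mul (hJ.mul hJ) (mul_ne_zero hJ0 hJ0) (P.Q e' k)]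
  refine ordAt_congr ?_
  filter_upwards [eventually_divisor_eq_zero D p,
    (e.open_source.eventually_mem hp).filter_mono nhdsWithin_le_nhds,
    (e'.open_source.eventually_mem hp').filter_mono nhdsWithin_le_nhds] with x h1 h2 h3
  rw [P.Q_transform he he' h2 h3 h1 hk, sq]

variable (P) in
/-- The order of vanishing of `φ₀` at `p` as a section of `ω_X²(2D)`; it is `0` or `1`. -/
noncomputable def branchOrder (p : X) : ℕ :=
  open Classical in
  if ordAt (P.Q (chartAt ℂ p) 0) p = ((-(2 * D p : ℤ) : ℤ) : WithTop ℤ) then 0 else 1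

lemma branchOrder_le (p : X) : P.branchOrder p ≤ 1 := by
  unfold branchOrder; split_ifs <;> simp

lemma ordAt_Q_ge (he : e ∈ Coord X) (hp : p ∈ e.source) (k : ℕ) :
    ((-(2 * D p : ℤ) : ℤ) : WithTop ℤ) ≤ ordAt (P.Q e k) p := by
  simpa using (P.Q_pole e he k p hp).2

/-- Otherwise D could be lowered by one at `p`: `PolesDominated` passes the weaker pole of Q₀ on to
every Q_k, so the smaller divisor would still bound all poles, against minimality. -/
lemma ordAt_Q_lt (hP : P.Admissible) (hD : D p ≠ 0) :
    ordAt (P.Q (chartAt ℂ p) 0) p < ((-(2 * D p : ℤ) + 2 : ℤ) : WithTop ℤ) := by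
  classical
  by_contra hge
  rw [not_lt] at hge
  set D' : X →₀ ℕ := D - Finsupp.single p 1 with hD'
  have hle : D' ≤ D := fun x => by simp [hD']
  have key := P.minimal D' hle fun e he k x hx => by
    refine ⟨(P.Q_pole e he k x hx).1, ?_⟩
    by_cases hxp : x = p
    · subst hxp
      have hc : D' x = D x - 1 := by simp [hD']
      have hcast : (-((2 * D' x : ℕ) : ℤ) : ℤ) = -(2 * D x : ℤ) + 2 := by
        rw [hc]; push_cast [Nat.one_le_iff_ne_zero.2 hD]; ring
      rw [hcast]
      by_cases hneg : ordAt (P.Q e k) x < 0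
      · refine le_trans ?_ (hP.2 e he k x hx hneg)
        rwa [ordAt_Q_eq he (chart_mem_coord x) hx (mem_chart_source ℂ x) (by norm_num)]
      · refine le_trans ?_ (not_lt.1 hneg)
        have : (-(2 * D x : ℤ) + 2 : ℤ) ≤ 0 := by
          have := Nat.one_le_iff_ne_zero.2 hD
          omega
        exact_mod_cast this
    · have hc : D' x = D x := by simp [hD', Ne.symm hxp]
      rw [hc]
      exact (P.Q_pole e he k x hx).2
  have : D' p = D p := by rw [key]
  simp [hD'] at this
  omega

/-- The excess of the order over -2D is 0 or 1: outside the support of D because zeros are simple,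
on the support by `ordAt_Q_lt`. -/
lemma ordAt_Q_zero (hP : P.Admissible) (he : e ∈ Coord X) (hp : p ∈ e.source) :
    ordAt (P.Q e 0) p = (((P.branchOrder p : ℤ) - 2 * D p : ℤ) : WithTop ℤ) := by
  have hc := chart_mem_coord (X := X) p
  have hpc := mem_chart_source ℂ p
  rw [ordAt_Q_eq he hc hp hpc (by norm_num)]
  unfold branchOrder
  split_ifs with h
  · rw [h]; simp
  · have hge := ordAt_Q_ge (P := P) hc hpc 0
    have hlt : ((-(2 * D p : ℤ) : ℤ) : WithTop ℤ) < ordAt (P.Q (chartAt ℂ p) 0) p :=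
      lt_of_le_of_ne hge (Ne.symm h)
    by_cases hD : D p = 0
    · have := hP.1 _ hc p hpc (by simpa [hD] using hlt)
      rw [this]; simp [hD]
    · have h2 := ordAt_Q_lt hP hD
      generalize ordAt (P.Q (chartAt ℂ p) 0) p = o at *
      induction o using WithTop.recTopCoe with
      | top => simp at h2
      | coe m =>
        have h3 := WithTop.coe_lt_coe.1 hlt
        have h4 := WithTop.coe_lt_coe.1 h2
        have h5 : m = 1 - 2 * (D p : ℤ) := by omega
        rw [h5]
        rfl

/-- In the coordinate `z = chartAt ℂ p`, centred at `p`, one has `Q₀ = z^{n-2D} g` with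
`n = branchOrder p` and `g` holomorphic and non-vanishing. -/
structure IsLocalForm (P : SchrodingerOperator S D) (p : X) (g : ℂ → ℂ) : Prop where
  an : AnalyticAt ℂ g (chartAt ℂ p p)
  ne : g (chartAt ℂ p p) ≠ 0
  eq : ∀ᶠ x in 𝓝[≠] (chartAt ℂ p p), P.Q (chartAt ℂ p) 0 ((chartAt ℂ p).symm x)
    = (x - chartAt ℂ p p) ^ ((P.branchOrder p : ℤ) - 2 * D p) * g x

lemma exists_isLocalForm (hP : P.Admissible) (p : X) : ∃ g, IsLocalForm P p g := by
  have hc := chart_mem_coord (X := X) p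
  have hpc := mem_chart_source ℂ p
  have h := ordAt_Q_zero hP hc hpc
  have hm : MeromorphicAt (P.Q (chartAt ℂ p) 0 ∘ (chartAt ℂ p).symm) (chartAt ℂ p p) :=
    (P.Q_pole _ hc 0 p hpc).1
  obtain ⟨g, h1, h2, h3⟩ := (meromorphicOrderAt_eq_int_iff hm).1 h
  exact ⟨g, h1, h2, h3⟩

lemma isRegularPoint_iff (hP : P.Admissible) :
    P.IsRegularPoint p ↔ D p = 0 ∧ P.branchOrder p = 0 := by
  have hc := chart_mem_coord (X := X) p
  have hpc := mem_chart_source ℂ p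
  refine and_congr_right fun hD => ?_
  have ho := ordAt_Q_zero hP hc hpc
  have han : AnalyticAt ℂ (P.Q (chartAt ℂ p) 0 ∘ (chartAt ℂ p).symm) (chartAt ℂ p p) :=
    P.Q_hol _ hc 0 p hpc hD
  rw [ordAt, han.meromorphicOrderAt_eq] at ho
  have h0 : (P.Q (chartAt ℂ p) 0 ∘ (chartAt ℂ p).symm) (chartAt ℂ p p)
      = P.Q (chartAt ℂ p) 0 p := by simp
  rw [← h0, ← han.analyticOrderAt_eq_zero]
  simp only [hD, Nat.cast_zero, mul_zero, sub_zero] at ho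
  generalize analyticOrderAt (P.Q (chartAt ℂ p) 0 ∘ (chartAt ℂ p).symm) (chartAt ℂ p p) = o at *
  induction o using ENat.recTopCoe with
  | top => simp at ho
  | coe m =>
    rw [ENat.map_natCast] at ho
    norm_cast at ho ⊢
    rw [ho]

lemma isRegularPoint_iff_of_mem (he : e ∈ Coord X) (hp : p ∈ e.source) :
    P.IsRegularPoint p ↔ D p = 0 ∧ P.Q e 0 p ≠ 0 := by
  refine and_congr_right fun hD => ?_
  rw [P.Q_transform he (chart_mem_coord p) hp (mem_chart_source ℂ p) hD (by norm_num)]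
  simp [pd_ne_zero he (chart_mem_coord p) hp (mem_chart_source ℂ p)]

lemma eventually_isRegularPoint (hP : P.Admissible) (p : X) :
    ∀ᶠ p' in 𝓝[≠] p, P.IsRegularPoint p' := by
  obtain ⟨g, hg⟩ := exists_isLocalForm hP p
  set e := chartAt ℂ p with he
  have hpc := mem_chart_source ℂ p
  have h1 : ∀ᶠ x in 𝓝[≠] (e p), P.Q e 0 (e.symm x) ≠ 0 := by
    filter_upwards [hg.eq, (hg.an.continuousAt.eventually_ne hg.ne).filter_mono nhdsWithin_le_nhds,
      eventually_mem_nhdsWithin] with x h1 h2 h3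
    rw [h1]
    exact mul_ne_zero (zpow_ne_zero _ (sub_ne_zero.2 h3)) h2
  have h2 : Tendsto e (𝓝[≠] p) (𝓝[≠] (e p)) := by
    refine tendsto_nhdsWithin_iff.2 ⟨(e.continuousAt hpc).tendsto.mono_left nhdsWithin_le_nhds, ?_⟩
    filter_upwards [eventually_mem_nhdsWithin,
      (e.open_source.eventually_mem hpc).filter_mono nhdsWithin_le_nhds] with x hx hx' h
    exact hx (e.injOn hx' hpc h)
  filter_upwards [h2.eventually h1, eventually_divisor_eq_zero D p,
    (e.open_source.eventually_mem hpc).filter_mono nhdsWithin_le_nhds] with x hx hx' hx''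
  rw [e.left_inv hx''] at hx
  exact (isRegularPoint_iff_of_mem (chart_mem_coord p) hx'').2 ⟨hx', hx⟩

lemma IsRegularPoint.eventually (hP : P.Admissible) (h : P.IsRegularPoint p) :
    ∀ᶠ p' in 𝓝 p, P.IsRegularPoint p' := by
  have := eventually_isRegularPoint hP p
  rw [eventually_nhdsWithin_iff] at this
  filter_upwards [this] with x hx
  by_cases hxp : x = p
  · rwa [hxp]
  · exact hx hxp

end LocalForm

/-! ### Points of the spectral curve and its local equation. -/

section Points

variable {X : Type*} [TopologicalSpace X] [ChartedSpace ℂ X] [IsManifold 𝓘(ℂ) ω X] [T1Space X]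
  {S : SpinStructure X} {D : X →₀ ℕ} {b c e e' : OpenPartialHomeomorph X ℂ} {p : X}
  {P : SchrodingerOperator S D}

open SpectralCurve

lemma fib_sq {q : P.SpectralCurve} (hD : D (proj q) = 0) :
    fib q ^ 2 = P.Q (chartAt ℂ (proj q)) 0 (proj q) := by
  have h := q.2
  have hc := chart_mem_coord (X := X) (proj q)
  have hpc := mem_chart_source ℂ (proj q)
  have h2 : ContinuousAt _ _ := AnalyticAt.continuousAt (P.Q_hol _ hc 0 _ hpc hD)
  have h3 := h2.tendsto.mono_left (nhdsWithin_le_nhds (s := {chartAt ℂ (proj q) (proj q)}ᶜ))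
  have h4 : Tendsto (P.Q (chartAt ℂ (proj q)) 0 ∘ (chartAt ℂ (proj q)).symm)
    (𝓝[≠] (chartAt ℂ (proj q) (proj q))) (𝓝 (fib q ^ 2)) := by
    refine h.congr fun x => ?_
    have : D q.1.1 = 0 := hD
    rw [this]
    simp [proj]
  have := tendsto_nhds_unique h4 h3
  simpa using this

/-- The coefficient of the Liouville form with respect to the coordinate `e`. -/
lemma coeffIn_liouville (e : OpenPartialHomeomorph X ℂ) (q : P.SpectralCurve) :
    coeffIn e P.liouville q = fib q * pd e (chartAt ℂ (proj q)) (proj q) := rfl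

lemma coeffIn_chart (α : P.Form) (q : P.SpectralCurve) :
    coeffIn (chartAt ℂ (proj q)) α q = α q := by
  rw [coeffIn, pd_self (mem_chart_source ℂ (proj q)), mul_one]

lemma coeffIn_change (he : e ∈ Coord X) (he' : e' ∈ Coord X) (α : P.Form) {q : P.SpectralCurve}
    (hp : proj q ∈ e.source) (hp' : proj q ∈ e'.source) :
    coeffIn e' α q = coeffIn e α q * pd e' e (proj q) := by
  rw [coeffIn, coeffIn, pd_trans he' he (chart_mem_coord _) hp' hp (mem_chart_source ℂ (proj q)),
    mul_assoc]

lemma coeffIn_liouville_sq (he : e ∈ Coord X) {q : P.SpectralCurve} (hp : proj q ∈ e.source)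
    (hD : D (proj q) = 0) : coeffIn e P.liouville q ^ 2 = P.Q e 0 (proj q) := by
  rw [coeffIn_liouville, mul_pow, fib_sq hD, P.Q_transform he (chart_mem_coord (proj q)) hp
    (mem_chart_source ℂ (proj q)) hD (by norm_num), mul_comm]

lemma point_ext (he : e ∈ Coord X) {q q' : P.SpectralCurve} (hp : proj q ∈ e.source)
    (h : proj q = proj q') (h' : coeffIn e P.liouville q = coeffIn e P.liouville q') : q = q' := by
  obtain ⟨⟨p, v⟩, hq⟩ := q
  obtain ⟨⟨p', v'⟩, hq'⟩ := q'
  obtain rfl : p = p' := h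
  have hJ := pd_ne_zero he (chart_mem_coord p) hp (mem_chart_source ℂ p)
  have : v = v' := mul_right_cancel₀ hJ h'
  subst this
  rfl

open Classical in
/-- The point of the spectral curve over `p` at which the Liouville form has coefficient `v` in
the coordinate `e` (and `q₀` if there is none). -/
noncomputable def pointOver (e : OpenPartialHomeomorph X ℂ) (q₀ : P.SpectralCurve) (p : X) (v : ℂ) :
    P.SpectralCurve :=
  if h : ∃ q : P.SpectralCurve, proj q = p ∧ coeffIn e P.liouville q = v then h.choose else q₀

lemma pointOver_spec (he : e ∈ Coord X) (q₀ : P.SpectralCurve) (hp : p ∈ e.source) (hD : D p = 0)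
    {v : ℂ} (hv : v ^ 2 = P.Q e 0 p) :
    proj (pointOver e q₀ p v) = p ∧ coeffIn e P.liouville (pointOver e q₀ p v) = v := by
  have hc := chart_mem_coord (X := X) p
  have hpc := mem_chart_source ℂ p
  have hJ := pd_ne_zero he hc hp hpc
  have h : ∃ q : P.SpectralCurve, proj q = p ∧ coeffIn e P.liouville q = v := by
    refine ⟨⟨(p, v / pd e (chartAt ℂ p) p), ?_⟩, rfl, ?_⟩
    · have h2 : ContinuousAt _ _ := AnalyticAt.continuousAt (P.Q_hol _ hc 0 _ hpc hD)
      have h3 := h2.tendsto.mono_left (nhdsWithin_le_nhds (s := {chartAt ℂ p p}ᶜ))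
      rw [P.Q_transform he hc hp hpc hD (by norm_num)] at hv
      have hval : (v / pd e (chartAt ℂ p) p) ^ 2
          = (P.Q (chartAt ℂ p) 0 ∘ (chartAt ℂ p).symm) (chartAt ℂ p p) := by
        rw [div_pow, hv]
        simp only [Function.comp_apply, (chartAt ℂ p).left_inv hpc]
        field_simp
      rw [hval]
      refine h3.congr fun x => ?_
      simp [hD]
    · exact div_mul_cancel₀ v hJ
  rw [pointOver, dif_pos h]
  exact h.choose_spec

/-- At the centre with `D p ≠ 0` the right-hand side is 0 while the fibre coordinate need not be, so
that case is excluded. -/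
lemma fibreCoord_eq {q : P.SpectralCurve} (h : proj q ≠ p ∨ D p = 0) :
    fibreCoord p q = coeffIn (chartAt ℂ p) P.liouville q
      * (chartAt ℂ p (proj q) - chartAt ℂ p p) ^ D p := by
  rw [fibreCoord, coeffIn_liouville]
  split_ifs with h1
  · subst h1
    have hD : D (proj q) = 0 := by simpa using h
    rw [pd_self (mem_chart_source ℂ (proj q)), hD]
    simp
  · rfl

lemma fibreCoord_self (q : P.SpectralCurve) : fibreCoord (proj q) q = fib q := by
  simp [fibreCoord]

/-- Uniqueness of limits: on a punctured neighbourhood z^{2D} Q₀ is zⁿ g, which extends continuously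
to the centre. -/
lemma fib_sq_critical {g : ℂ → ℂ} {q : P.SpectralCurve} (hg : IsLocalForm P (proj q) g) :
    fib q ^ 2 = 0 ^ P.branchOrder (proj q) * g (chartAt ℂ (proj q) (proj q)) := by
  set p := proj q with hp
  set e := chartAt ℂ p
  have h := q.2
  have h1 : Tendsto (fun x => (x - e p) ^ P.branchOrder p * g x) (𝓝[≠] (e p))
      (𝓝 (0 ^ P.branchOrder p * g (e p))) := by
    have : ContinuousAt (fun x => (x - e p) ^ P.branchOrder p * g x) (e p) :=
      ContinuousAt.mul (by fun_prop) hg.an.continuousAt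
    simpa using this.tendsto.mono_left nhdsWithin_le_nhds
  refine tendsto_nhds_unique (f := fun x => (x - e p) ^ (2 * D p) * P.Q e 0 (e.symm x)) h ?_
  refine h1.congr' ?_
  filter_upwards [hg.eq, eventually_mem_nhdsWithin] with x hx hx'
  have hx0 : x - e p ≠ 0 := sub_ne_zero.2 hx'
  rw [hx, ← mul_assoc, ← zpow_natCast _ (2 * D p), ← zpow_add₀ hx0]
  congr 1
  rw [← zpow_natCast]
  congr 1
  push_cast
  ring

/-- This is the local equation y² = zⁿ g of Σ; since n ≤ 1 and g does not vanish, it describes a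
smooth curve. -/
lemma fibreCoord_sq {g : ℂ → ℂ} (hg : IsLocalForm P p g) :
    ∀ᶠ p' in 𝓝 p, ∀ q : P.SpectralCurve, proj q = p' → fibreCoord p q ^ 2 =
      (chartAt ℂ p p' - chartAt ℂ p p) ^ P.branchOrder p * g (chartAt ℂ p p') := by
  set e := chartAt ℂ p
  have hpc : p ∈ e.source := mem_chart_source ℂ p
  have hg' := hg.eq
  have hD := eventually_divisor_eq_zero D p
  rw [eventually_nhdsWithin_iff] at hg' hD
  filter_upwards [(e.continuousAt hpc).eventually hg', hD, e.open_source.eventually_mem hpc]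
    with p' h1 h2 h3 q hq
  by_cases hpp : p' = p
  · subst hpp
    subst hq
    rw [fibreCoord_self, fib_sq_critical hg, sub_self]
  · have hne : e p' ≠ e p := fun h => hpp (e.injOn h3 hpc h)
    have h1 := h1 hne
    have hx0 : e p' - e p ≠ 0 := sub_ne_zero.2 hne
    have h4 := coeffIn_liouville_sq (chart_mem_coord p) (q := q) (by rw [hq]; exact h3)
      (by rw [hq]; exact h2 hpp)
    rw [hq] at h4
    rw [e.left_inv h3] at h1
    rw [fibreCoord_eq (Or.inl (by rw [hq]; exact hpp)), mul_pow, h4, hq]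
    change P.Q e 0 p' * ((e p' - e p) ^ D p) ^ 2 = _
    rw [h1, mul_right_comm, ← pow_mul, ← zpow_natCast _ (D p * 2), ← zpow_add₀ hx0]
    congr 1
    rw [← zpow_natCast]
    congr 1
    push_cast
    ring

lemma branchOrder_eq_zero (hP : P.Admissible) {q : P.SpectralCurve} (hq : q.IsRegular) :
    P.branchOrder (proj q) = 0 := ((isRegularPoint_iff hP).1 hq).2

lemma fib_ne_zero {q : P.SpectralCurve} (hq : q.IsRegular) : fib q ≠ 0 := by
  intro h
  have := fib_sq hq.1
  rw [h] at this
  exact hq.2 (by simpa using this.symm)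

end Points

end SchrodingerOperator

/-! ## Local parameters of the spectral curve -/

namespace SchrodingerOperator

section Params

variable {X : Type*} [TopologicalSpace X] [ChartedSpace ℂ X] [IsManifold 𝓘(ℂ) ω X] [T1Space X]
  {S : SpinStructure X} {D : X →₀ ℕ} {b c e e' : OpenPartialHomeomorph X ℂ} {p : X}
  {P : SchrodingerOperator S D} {q : P.SpectralCurve} {γ : ℂ → P.SpectralCurve}

open SpectralCurve

/-- The definition of `pullback` uses a chart that moves with the point. The chain rule replaces it
by a fixed coordinate, in which analyticity in `t` can be discussed. -/
lemma pullback_eq (he : e ∈ Coord X) (α : P.Form) {t : ℂ}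
    (h : ∀ᶠ s in 𝓝 t, proj (γ s) ∈ e.source)
    (hx : DifferentiableAt ℂ (fun s => e (proj (γ s))) t) :
    pullback α γ t = coeffIn e α (γ t) * deriv (fun s => e (proj (γ s))) t := by
  set c := chartAt ℂ (proj (γ t))
  have ht := h.self_of_nhds
  have h1 : (fun s => c (proj (γ s))) =ᶠ[𝓝 t] (c ∘ e.symm) ∘ (fun s => e (proj (γ s))) := by
    filter_upwards [h] with s hs
    simp [e.left_inv hs]
  rw [pullback, h1.deriv_eq, deriv_comp]
  · rw [coeffIn, mul_assoc]; rfl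
  · exact (analyticAt_transition he (chart_mem_coord _) ht (mem_chart_source ℂ _)).differentiableAt
  · exact hx

lemma tendsto_proj_of_coord {q : X} {x : ℂ → X} {t : ℂ} (hq : q ∈ e.source) (h0 : x t = q)
    (h : ∀ᶠ s in 𝓝 t, x s ∈ e.source) (hx : ContinuousAt (fun s => e (x s)) t) :
    Tendsto x (𝓝 t) (𝓝 q) := by
  have h1 : Tendsto (fun s => e.symm (e (x s))) (𝓝 t) (𝓝 q) := by
    refine (tendsto_symm_nhds hq).comp ?_
    have := hx.tendsto
    rwa [h0] at this
  refine h1.congr' ?_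
  filter_upwards [h] with s hs using e.left_inv hs

namespace SpectralCurve.IsLocalParam

lemma tendsto_proj (h : IsLocalParam q γ) : Tendsto (fun t => proj (γ t)) (𝓝 0) (𝓝 (proj q)) :=
  tendsto_proj_of_coord (e := chartAt ℂ (proj q)) (mem_chart_source ℂ _)
    (by rw [h.base]) h.mem_chart h.x_analytic.continuousAt

lemma fibreCoord_sq (h : IsLocalParam q γ) {g : ℂ → ℂ} (hg : IsLocalForm P (proj q) g) :
    ∀ᶠ t in 𝓝 (0 : ℂ), fibreCoord (proj q) (γ t) ^ 2 =
      (chartAt ℂ (proj q) (proj (γ t)) - chartAt ℂ (proj q) (proj q)) ^ P.branchOrder (proj q)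
        * g (chartAt ℂ (proj q) (proj (γ t))) := by
  filter_upwards [h.tendsto_proj.eventually (SchrodingerOperator.fibreCoord_sq hg)] with t ht
  exact ht _ rfl

/-- Obtained by differentiating y² = zⁿ g at 0. Combined with `immersed`, it decides which of x, y
is a local coordinate on Σ. -/
lemma deriv_fibreCoord (h : IsLocalParam q γ) {g : ℂ → ℂ} (hg : IsLocalForm P (proj q) g) :
    2 * fib q * deriv (fun t => fibreCoord (proj q) (γ t)) 0
      = (if P.branchOrder (proj q) = 0 then deriv g (chartAt ℂ (proj q) (proj q))
          else g (chartAt ℂ (proj q) (proj q)))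
        * deriv (fun t => chartAt ℂ (proj q) (proj (γ t))) 0 := by
  set x : ℂ → ℂ := fun t => chartAt ℂ (proj q) (proj (γ t)) with hxd
  set y : ℂ → ℂ := fun t => fibreCoord (proj q) (γ t) with hyd
  have hx := h.x_analytic.differentiableAt.hasDerivAt
  have hy := h.y_analytic.differentiableAt.hasDerivAt
  have hx0 : x 0 = chartAt ℂ (proj q) (proj q) := by simp [hxd, h.base]
  have hy0 : y 0 = fib q := by simp [hyd, h.base, fibreCoord_self]
  have hgd : HasDerivAt (g ∘ x) (deriv g (x 0) * deriv x 0) 0 :=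
    HasDerivAt.comp (0 : ℂ) (by rw [hx0]; exact hg.an.differentiableAt.hasDerivAt) hx
  have hl := (hy.pow 2)
  have hr := (((hx.sub_const (x 0)).pow (P.branchOrder (proj q))).mul hgd)
  have heq : (y ^ 2) =ᶠ[𝓝 0] ((fun t => x t - x 0) ^ P.branchOrder (proj q) * (g ∘ x)) := by
    filter_upwards [h.fibreCoord_sq hg] with t ht
    simp only [Pi.pow_apply, Pi.mul_apply, hx0]
    exact ht
  have hd := heq.deriv_eq
  rw [hl.deriv, hr.deriv] at hd
  rw [← hy0, ← hx0]
  rcases Nat.le_one_iff_eq_zero_or_eq_one.1 (P.branchOrder_le (proj q)) with h1 | h1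
  · simp only [h1] at hd ⊢
    simp at hd ⊢
    exact hd
  · simp only [h1] at hd ⊢
    simp at hd ⊢
    linear_combination hd

lemma deriv_x_ne_zero (h : IsLocalParam q γ) {g : ℂ → ℂ} (hg : IsLocalForm P (proj q) g)
    (hn : P.branchOrder (proj q) = 0) :
    deriv (fun t => chartAt ℂ (proj q) (proj (γ t))) 0 ≠ 0 := by
  have h1 := h.deriv_fibreCoord hg
  have h2 := fib_sq_critical (q := q) hg
  rw [hn, pow_zero, one_mul] at h2
  have h3 : fib q ≠ 0 := by
    intro h0
    rw [h0] at h2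
    exact hg.ne (by simpa using h2.symm)
  intro hx
  rw [hx, mul_zero] at h1
  rcases h.immersed with h4 | h4
  · exact h4 hx
  · exact mul_ne_zero (mul_ne_zero two_ne_zero h3) h4 h1

/-- For n = 0 the coordinate x is itself a parameter. For n = 1 one has y = 0 at q, hence x' = 0 and
y' ≠ 0; then y² = z g makes the order of z twice that of y. -/
lemma analyticOrderNatAt_eq (h : IsLocalParam q γ) {g : ℂ → ℂ} (hg : IsLocalForm P (proj q) g) :
    analyticOrderNatAt (fun t => chartAt ℂ (proj q) (proj (γ t)) - chartAt ℂ (proj q) (proj q)) 0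
      = P.branchOrder (proj q) + 1 := by
  have hx := h.x_analytic
  have hy := h.y_analytic
  have hx0 : chartAt ℂ (proj q) (proj (γ 0)) = chartAt ℂ (proj q) (proj q) := by rw [h.base]
  have hxa : AnalyticAt ℂ
      (fun t => chartAt ℂ (proj q) (proj (γ t)) - chartAt ℂ (proj q) (proj q)) 0 := by fun_prop
  rcases Nat.le_one_iff_eq_zero_or_eq_one.1 (P.branchOrder_le (proj q)) with hn | hn
  · have := hx.analyticOrderAt_sub_eq_one_of_deriv_ne_zero (h.deriv_x_ne_zero hg hn)
    simp only [hx0] at this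
    rw [analyticOrderNatAt, this, hn]
    rfl
  · have h2 := fib_sq_critical (q := q) hg
    rw [hn, pow_one, zero_mul] at h2
    have hf : fib q = 0 := by simpa using h2
    have h1 := h.deriv_fibreCoord hg
    rw [hf, hn] at h1
    simp only [mul_zero, zero_mul, one_ne_zero, if_false] at h1
    have hx' := (mul_eq_zero.1 h1.symm).resolve_left hg.ne
    have hy' := h.immersed.resolve_left (not_not.2 hx')
    have hy0 : fibreCoord (proj q) (γ 0) = 0 := by rw [h.base, fibreCoord_self, hf]
    have ho := hy.analyticOrderAt_sub_eq_one_of_deriv_ne_zero hy'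
    simp only [hy0, sub_zero] at ho
    have hga : AnalyticAt ℂ (fun t => g (chartAt ℂ (proj q) (proj (γ t)))) 0 :=
      AnalyticAt.comp (f := fun t => chartAt ℂ (proj q) (proj (γ t))) (by rw [hx0]; exact hg.an) hx
    have hgo : analyticOrderAt (fun t => g (chartAt ℂ (proj q) (proj (γ t)))) 0 = 0 :=
      hga.analyticOrderAt_eq_zero.2 (by rw [hx0]; exact hg.ne)
    have e1 := analyticOrderAt_pow hy 2
    have e2 := analyticOrderAt_mul hxa hga
    have e3 : ((fun t => fibreCoord (proj q) (γ t)) ^ 2) =ᶠ[𝓝 0]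
        (fun t => chartAt ℂ (proj q) (proj (γ t)) - chartAt ℂ (proj q) (proj q)) *
          (fun t => g (chartAt ℂ (proj q) (proj (γ t)))) := by
      filter_upwards [h.fibreCoord_sq hg] with t ht
      simpa [hn] using ht
    rw [analyticOrderAt_congr e3, e2, hgo, ho, add_zero] at e1
    rw [analyticOrderNatAt, e1, hn]
    rfl

end SpectralCurve.IsLocalParam

/-- A criterion for local parameters at points outside the support of `D`. -/
lemma isLocalParam_of_coeff (he : e ∈ Coord X) (hD : D (proj q) = 0) (h0 : γ 0 = q)
    (hmem : ∀ᶠ t in 𝓝 (0 : ℂ), proj (γ t) ∈ e.source)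
    (hx : AnalyticAt ℂ (fun t => e (proj (γ t))) 0)
    (hx' : deriv (fun t => e (proj (γ t))) 0 ≠ 0)
    (hy : AnalyticAt ℂ (fun t => coeffIn e P.liouville (γ t)) 0) : IsLocalParam q γ := by
  set c := chartAt ℂ (proj q) with hc
  have hcC : c ∈ Coord X := chart_mem_coord _
  have hqc : proj q ∈ c.source := mem_chart_source ℂ _
  have hqe : proj q ∈ e.source := by have := hmem.self_of_nhds; rwa [h0] at this
  have htend : Tendsto (fun t => proj (γ t)) (𝓝 0) (𝓝 (proj q)) :=
    tendsto_proj_of_coord hqe (by rw [h0]) hmem hx.continuousAt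
  have hmc : ∀ᶠ t in 𝓝 (0 : ℂ), proj (γ t) ∈ c.source :=
    htend.eventually (c.open_source.eventually_mem hqc)
  have hx0 : e (proj (γ 0)) = e (proj q) := by rw [h0]
  have hta := analyticAt_transition he hcC hqe hqc
  have hxc : (fun t => c (proj (γ t))) =ᶠ[𝓝 0] (c ∘ e.symm) ∘ (fun t => e (proj (γ t))) := by
    filter_upwards [hmem] with t ht
    simp [e.left_inv ht]
  have hda : DifferentiableAt ℂ (c ∘ e.symm) (e (proj (γ 0))) := by
    rw [hx0]; exact hta.differentiableAt
  refine ⟨h0, hmc, ?_, ?_, Or.inl ?_⟩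
  · have hta' : AnalyticAt ℂ (c ∘ e.symm) (e (proj (γ 0))) := by rw [hx0]; exact hta
    have h3 : AnalyticAt ℂ ((c ∘ e.symm) ∘ fun t => e (proj (γ t))) 0 :=
      AnalyticAt.comp (f := fun t => e (proj (γ t))) hta' hx
    exact h3.congr hxc.symm
  · have hJ : AnalyticAt ℂ (fun t => (pd c e ∘ e.symm) (e (proj (γ t)))) 0 := by
      have hJ' : AnalyticAt ℂ (pd c e ∘ e.symm) (e (proj (γ 0))) := by
        rw [hx0]
        exact (holAt_iff he hqe).1 (holAt_jacobian hcC he hqc hqe)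
      exact AnalyticAt.comp (f := fun t => e (proj (γ t))) hJ' hx
    refine (hy.mul hJ).congr ?_
    filter_upwards [hmem, hmc] with t ht ht'
    rw [fibreCoord_eq (Or.inr hD), hD, pow_zero, mul_one, coeffIn_change he hcC _ ht ht']
    simp [e.left_inv ht]
  · rw [hxc.deriv_eq, deriv_comp (h := fun t => e (proj (γ t))) (h₂ := c ∘ e.symm) 0 hda
      hx.differentiableAt, hx0]
    exact mul_ne_zero (pd_ne_zero he hcC hqe hqc) hx'

/-- A standard local parameter at `q`: the one with `x = x(q) + t^{n+1}` and `y = t^n k(t)`, where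
`n` is the branch order of `π q`. -/
structure IsStdParam (q : P.SpectralCurve) (γ : ℂ → P.SpectralCurve) (k : ℂ → ℂ) : Prop where
  base : γ 0 = q
  coord : ∀ᶠ t in 𝓝 (0 : ℂ), proj (γ t) ∈ (chartAt ℂ (proj q)).source ∧
    chartAt ℂ (proj q) (proj (γ t)) = chartAt ℂ (proj q) (proj q)
      + t ^ (P.branchOrder (proj q) + 1)
  k_analytic : AnalyticAt ℂ k 0
  k_ne : k 0 ≠ 0
  fibre : ∀ᶠ t in 𝓝 (0 : ℂ), fibreCoord (proj q) (γ t) = t ^ P.branchOrder (proj q) * k t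

/-- Putting z = t^{n+1} turns zⁿ g into t^{2n} g, because n(n+1) = 2n for n ∈ {0, 1}; an analytic
square root k of g(x(q) + t^{n+1}) then gives y = tⁿ k. -/
lemma exists_isStdParam (hP : P.Admissible) (q : P.SpectralCurve) :
    ∃ γ k, IsStdParam q γ k := by
  classical
  obtain ⟨g, hg⟩ := exists_isLocalForm hP (proj q)
  set p := proj q with hp
  set e := chartAt ℂ p with he
  have heC : e ∈ Coord X := chart_mem_coord p
  have hpe : p ∈ e.source := mem_chart_source ℂ p
  set n := P.branchOrder p with hn
  have hn1 : n = 0 ∨ n = 1 := Nat.le_one_iff_eq_zero_or_eq_one.1 (P.branchOrder_le p)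
  have hGa : AnalyticAt ℂ (fun t : ℂ => g (e p + t ^ (n + 1))) 0 :=
    AnalyticAt.comp (f := fun t : ℂ => e p + t ^ (n + 1)) (by simpa using hg.an) (by fun_prop)
  have hG0 : g (e p + (0 : ℂ) ^ (n + 1)) = g (e p) := by simp
  -- For n = 0 the root must be the fibre value, so that the curve passes through q. For n = 1 the
  -- fibre value is zero and either root will do.
  obtain ⟨d, hd, hdf⟩ : ∃ d : ℂ, d ^ 2 = g (e p) ∧ (n = 0 → d = fib q) := by
    rcases hn1 with h | h
    · refine ⟨fib q, ?_, fun _ => rfl⟩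
      have := fib_sq_critical (q := q) hg
      rw [← hp, ← hn, h] at this
      simpa using this
    · obtain ⟨d, hd⟩ := IsAlgClosed.exists_pow_nat_eq (g (e p)) two_pos
      exact ⟨d, hd, by omega⟩
  have hd0 : d ≠ 0 := by
    rintro rfl
    exact hg.ne (by simpa using hd.symm)
  obtain ⟨k, hka, hk0, hk⟩ := AnalyticAt.exists_sqrt hGa (d := d) (by rw [hd, hG0]) hd0
  -- The prescribed value is the coefficient y z^{-D} of λ in the coordinate z. At t = 0 it may be
  -- infinite, so q is inserted by hand.
  let γ : ℂ → P.SpectralCurve := fun t => if t = 0 then q else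
    pointOver e q (e.symm (e p + t ^ (n + 1)))
      (t ^ n * k t * ((t ^ (n + 1)) ^ D p)⁻¹)
  have hxt : Tendsto (fun t : ℂ => e p + t ^ (n + 1)) (𝓝 0) (𝓝 (e p)) := by
    have : ContinuousAt (fun t : ℂ => e p + t ^ (n + 1)) 0 := by fun_prop
    simpa using this.tendsto
  have htar := hxt.eventually (eventually_mem_target hpe)
  have hNE : Tendsto (fun t : ℂ => e p + t ^ (n + 1)) (𝓝[≠] 0) (𝓝[≠] (e p)) := by
    refine tendsto_nhdsWithin_iff.2 ⟨hxt.mono_left nhdsWithin_le_nhds, ?_⟩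
    filter_upwards [eventually_mem_nhdsWithin] with t ht h
    have : t ^ (n + 1) = 0 := by simpa using h
    exact ht (by simpa using this)
  have hform := hNE.eventually hg.eq
  have hDz := ((tendsto_symm_nhdsNE hpe).comp hNE).eventually (eventually_divisor_eq_zero D p)
  rw [eventually_nhdsWithin_iff] at hform hDz
  have key : ∀ᶠ t in 𝓝 (0 : ℂ), t ≠ 0 → proj (γ t) = e.symm (e p + t ^ (n + 1)) ∧
      coeffIn e P.liouville (γ t) = t ^ n * k t * ((t ^ (n + 1)) ^ D p)⁻¹ := by
    filter_upwards [hform, hDz, htar, hk] with t h1 h2 h3 h4 ht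
    have hγ : γ t = pointOver e q (e.symm (e p + t ^ (n + 1)))
      (t ^ n * k t * ((t ^ (n + 1)) ^ D p)⁻¹) := if_neg ht
    rw [hγ]
    refine pointOver_spec heC q (e.map_target h3) (h2 ht) ?_
    rw [h1 ht, mul_pow, mul_pow, h4, add_sub_cancel_left, zpow_sub₀ (pow_ne_zero _ ht),
      zpow_natCast]
    have e1 : (t ^ n) ^ 2 = (t ^ (n + 1)) ^ n := by
      rcases hn1 with h | h <;> simp [h]
    have e2 : (t ^ (n + 1)) ^ (2 * (D p : ℤ)) = ((t ^ (n + 1)) ^ D p) ^ 2 := by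
      rw [← pow_mul, ← zpow_natCast _ (D p * 2)]
      congr 1
      push_cast
      ring
    rw [e1, e2, div_eq_mul_inv, inv_pow]
    ring
  have hγ0 : γ 0 = q := if_pos rfl
  refine ⟨γ, k, hγ0, ?_, hka, by rwa [hk0], ?_⟩
  · filter_upwards [key, htar] with t ht ht'
    by_cases h0 : t = 0
    · subst h0
      rw [hγ0]
      exact ⟨hpe, by simp⟩
    · rw [(ht h0).1]
      exact ⟨e.map_target ht', e.right_inv ht'⟩
  · filter_upwards [key, htar] with t ht ht'
    by_cases h0 : t = 0
    · subst h0
      rw [hγ0, fibreCoord_self]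
      rcases hn1 with h | h
      · rw [← hp, ← hn, h, hk0, hdf h]; simp
      · have := fib_sq_critical (q := q) hg
        rw [← hp, ← hn, h] at this
        rw [← hp, ← hn, h]
        simpa using this
    · have hne : proj (γ t) ≠ p := by
        intro h
        rw [(ht h0).1] at h
        have h2 := e.right_inv ht'
        rw [h] at h2
        have : t ^ (n + 1) = 0 := by simpa using h2.symm
        exact h0 (by simpa using this)
      rw [fibreCoord_eq (Or.inl hne), (ht h0).2, (ht h0).1]
      change _ * (e _ - e p) ^ D p = _
      rw [e.right_inv ht', add_sub_cancel_left]
      have : ((t ^ (n + 1)) ^ D p) ≠ 0 := pow_ne_zero _ (pow_ne_zero _ h0)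
      rw [← hp, ← hn]
      field_simp

end Params

end SchrodingerOperator

/-! ## Meromorphic functions on the spectral curve -/

namespace SchrodingerOperator

section Nice

variable {X : Type*} [TopologicalSpace X] [ChartedSpace ℂ X] [IsManifold 𝓘(ℂ) ω X] [T1Space X]
  {S : SpinStructure X} {D : X →₀ ℕ} {b c e e' : OpenPartialHomeomorph X ℂ} {p : X}
  {P : SchrodingerOperator S D} {q : P.SpectralCurve} {γ γ₁ : ℂ → P.SpectralCurve} {k : ℂ → ℂ}
  {f g : P.SpectralCurve → ℂ}

open SpectralCurve

lemma sigma_eq (q : P.SpectralCurve) : P.sigma q = 2 * fib q := by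
  simp [sigma, liouville, fib, invol]
  ring

lemma coeffIn_sigma (e : OpenPartialHomeomorph X ℂ) (q : P.SpectralCurve) :
    coeffIn e P.sigma q = 2 * coeffIn e P.liouville q := by
  rw [coeffIn, sigma_eq, coeffIn_liouville, mul_assoc]

lemma IsStdParam.coord_eq (h : IsStdParam q γ k) :
    (fun t => chartAt ℂ (proj q) (proj (γ t))) =ᶠ[𝓝 0]
      fun t => chartAt ℂ (proj q) (proj q) + t ^ (P.branchOrder (proj q) + 1) :=
  h.coord.mono fun _ h => h.2

lemma IsStdParam.isLocalParam (h : IsStdParam q γ k) : IsLocalParam q γ where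
  base := h.base
  mem_chart := h.coord.mono fun _ h => h.1
  x_analytic := AnalyticAt.congr (by fun_prop) h.coord_eq.symm
  y_analytic := AnalyticAt.congr (f := fun t => t ^ P.branchOrder (proj q) * k t)
    (AnalyticAt.mul (by fun_prop) h.k_analytic) (EventuallyEq.symm h.fibre)
  immersed := by
    rcases Nat.le_one_iff_eq_zero_or_eq_one.1 (P.branchOrder_le (proj q)) with hn | hn
    · left
      rw [h.coord_eq.deriv_eq, hn]
      simp
    · right
      have h1 : (fun t => fibreCoord (proj q) (γ t)) =ᶠ[𝓝 0] fun t => t * k t := by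
        filter_upwards [h.fibre] with t ht
        rw [ht, hn, pow_one]
      rw [h1.deriv_eq]
      have h2 := ((hasDerivAt_id (0 : ℂ)).mul h.k_analytic.differentiableAt.hasDerivAt).deriv
      simp only [id, one_mul, zero_mul, add_zero] at h2
      exact (show deriv (fun t => t * k t) 0 = k 0 from h2).trans_ne h.k_ne

/-- All local parameters give the same order and one exists, so the infimum is over a singleton. -/
lemma ramIndex_eq (hP : P.Admissible) (q : P.SpectralCurve) :
    ramIndex q = P.branchOrder (proj q) + 1 := by
  obtain ⟨g, hg⟩ := exists_isLocalForm hP (proj q)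
  obtain ⟨γ, k, hγ⟩ := exists_isStdParam hP q
  have : {n | ∃ γ, IsLocalParam q γ ∧ n = analyticOrderNatAt
      (fun t => chartAt ℂ (proj q) (proj (γ t)) - chartAt ℂ (proj q) (proj q)) 0}
      = {P.branchOrder (proj q) + 1} := by
    ext m
    simp only [mem_ofPred_eq, mem_singleton_iff]
    constructor
    · rintro ⟨γ', h, rfl⟩
      exact h.analyticOrderNatAt_eq hg
    · rintro rfl
      exact ⟨γ, hγ.isLocalParam, (hγ.isLocalParam.analyticOrderNatAt_eq hg).symm⟩
  rw [ramIndex, this, csInf_singleton]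

/-- The right-hand side is the order of σ at q (`IsStdParam.order_pullback_sigma`). The two sides
disagree only over a simple zero (n = 1, D = 0), where σ vanishes doubly and Δ = 0; this is a
transition point. -/
lemma neg_Delta_eq (hP : P.Admissible) (h : RDelta q = 0) :
    (-(Delta q : ℤ) : ℤ) = 2 * (P.branchOrder (proj q) : ℤ)
      - ((P.branchOrder (proj q) : ℤ) + 1) * D (proj q) := by
  unfold RDelta at h
  unfold Delta at *
  unfold R at *
  rw [ramIndex_eq hP q] at *
  have hn := Nat.le_one_iff_eq_zero_or_eq_one.1 (P.branchOrder_le (proj q))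
  generalize P.branchOrder (proj q) = n at *
  generalize D (proj q) = d at *
  rcases hn with rfl | rfl <;> omega

/-- The points of `X` that are not transition points of `φ₀`. -/
def NonTransition (P : SchrodingerOperator S D) (p : X) : Prop :=
  P.IsRegularPoint p ∨ (P.branchOrder p : ℤ) - 2 * D p ≤ -2

lemma nonTransition_of_RDelta (hP : P.Admissible) (h : RDelta q = 0) :
    NonTransition P (proj q) := by
  unfold NonTransition
  rw [isRegularPoint_iff hP]
  unfold RDelta at h
  unfold Delta at *
  unfold R at *
  rw [ramIndex_eq hP q] at *
  have hn := Nat.le_one_iff_eq_zero_or_eq_one.1 (P.branchOrder_le (proj q))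
  generalize P.branchOrder (proj q) = n at *
  generalize D (proj q) = d at *
  rcases hn with rfl | rfl <;> omega

lemma IsStdParam.tendsto_nhdsNE (h : IsStdParam q γ k) :
    Tendsto (fun t => proj (γ t)) (𝓝[≠] 0) (𝓝[≠] (proj q)) := by
  refine tendsto_nhdsWithin_iff.2
    ⟨h.isLocalParam.tendsto_proj.mono_left nhdsWithin_le_nhds, ?_⟩
  filter_upwards [eventually_mem_nhdsWithin, h.coord.filter_mono nhdsWithin_le_nhds]
    with t ht ht' heq
  have := ht'.2
  rw [mem_singleton_iff.1 heq] at this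
  have h0 : t ^ (P.branchOrder (proj q) + 1) = 0 := by simpa using this.symm
  exact ht (by simpa using h0)

lemma IsStdParam.eventually_isRegular (hP : P.Admissible) (h : IsStdParam q γ k) :
    ∀ᶠ t in 𝓝[≠] (0 : ℂ), (γ t).IsRegular :=
  h.tendsto_nhdsNE.eventually (eventually_isRegularPoint hP (proj q))

lemma IsStdParam.eventually_coeffIn (h : IsStdParam q γ k) :
    ∀ᶠ t in 𝓝[≠] (0 : ℂ), coeffIn (chartAt ℂ (proj q)) P.liouville (γ t)
      = k t * t ^ ((P.branchOrder (proj q) : ℤ) -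
          ((P.branchOrder (proj q) : ℤ) + 1) * D (proj q)) := by
  filter_upwards [eventually_mem_nhdsWithin, h.tendsto_nhdsNE.eventually eventually_mem_nhdsWithin,
    h.coord.filter_mono nhdsWithin_le_nhds, h.fibre.filter_mono nhdsWithin_le_nhds]
    with t ht h1 h2 h3
  have ht0 : t ≠ 0 := ht
  rw [fibreCoord_eq (Or.inl h1), h2.2, add_sub_cancel_left, ← pow_mul] at h3
  have hpow : t ^ ((P.branchOrder (proj q) + 1) * D (proj q)) ≠ 0 := pow_ne_zero _ ht0
  rw [zpow_sub₀ ht0, ← mul_div_assoc, eq_div_iff]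
  · rw [zpow_natCast, mul_comm (k t), ← h3, ← zpow_natCast]
    push_cast
    rfl
  · exact zpow_ne_zero _ ht0

lemma IsStdParam.eventually_pullback (h : IsStdParam q γ k) (α : P.Form) :
    ∀ᶠ t in 𝓝 (0 : ℂ), pullback α γ t = coeffIn (chartAt ℂ (proj q)) α (γ t)
      * (((P.branchOrder (proj q) : ℂ) + 1) * t ^ P.branchOrder (proj q)) := by
  filter_upwards [h.coord.eventually_nhds] with t ht
  have h1 : (fun s => chartAt ℂ (proj q) (proj (γ s))) =ᶠ[𝓝 t]
      fun s => chartAt ℂ (proj q) (proj q) + s ^ (P.branchOrder (proj q) + 1) :=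
    ht.mono fun _ h => h.2
  have hd : DifferentiableAt ℂ (fun s => chartAt ℂ (proj q) (proj (γ s))) t :=
    h1.differentiableAt_iff.2 (by fun_prop)
  rw [pullback_eq (chart_mem_coord _) α (ht.mono fun _ h => h.1) hd, h1.deriv_eq]
  simp

lemma IsStdParam.eventually_pullback_sigma (h : IsStdParam q γ k) :
    ∀ᶠ t in 𝓝[≠] (0 : ℂ), pullback P.sigma γ t =
      t ^ (2 * (P.branchOrder (proj q) : ℤ) - ((P.branchOrder (proj q) : ℤ) + 1) * D (proj q))
        * (2 * ((P.branchOrder (proj q) : ℂ) + 1) * k t) := by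
  filter_upwards [h.eventually_coeffIn, eventually_mem_nhdsWithin,
    (h.eventually_pullback P.sigma).filter_mono nhdsWithin_le_nhds] with t h1 ht h2
  have ht0 : t ≠ 0 := ht
  rw [h2, coeffIn_sigma, h1, two_mul (P.branchOrder (proj q) : ℤ), add_sub_assoc, zpow_add₀ ht0,
    zpow_natCast]
  ring

lemma IsStdParam.eventually_pullback_sigma_of_isRegular (hP : P.Admissible) (hq : q.IsRegular)
    (h : IsStdParam q γ k) : ∀ᶠ t in 𝓝 (0 : ℂ), pullback P.sigma γ t = 2 * k t := by
  have hn := branchOrder_eq_zero hP hq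
  filter_upwards [h.eventually_pullback P.sigma, h.fibre] with t h1 h2
  rw [fibreCoord_eq (Or.inr hq.1), hq.1, hn] at h2
  rw [h1, coeffIn_sigma, hn]
  simp only [pow_zero, mul_one, one_mul] at h2
  rw [h2]
  simp

lemma IsStdParam.meromorphicAt_pullback_sigma (h : IsStdParam q γ k) :
    MeromorphicAt (pullback P.sigma γ) 0 := by
  refine MeromorphicAt.congr ?_ (EventuallyEq.symm h.eventually_pullback_sigma)
  have := h.k_analytic.meromorphicAt
  fun_prop

lemma IsStdParam.order_pullback_sigma (h : IsStdParam q γ k) :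
    meromorphicOrderAt (pullback P.sigma γ) 0 = ((2 * (P.branchOrder (proj q) : ℤ)
      - ((P.branchOrder (proj q) : ℤ) + 1) * D (proj q) : ℤ) : WithTop ℤ) := by
  refine (meromorphicOrderAt_eq_int_iff h.meromorphicAt_pullback_sigma).2
    ⟨fun t => 2 * ((P.branchOrder (proj q) : ℂ) + 1) * k t, ?_, ?_, ?_⟩
  · have := h.k_analytic
    fun_prop
  · exact mul_ne_zero (mul_ne_zero two_ne_zero (Nat.cast_add_one_ne_zero _)) h.k_ne
  · simpa using h.eventually_pullback_sigma

/-- Shifting a curve with analytic coordinates gives local parameters at the nearby points. -/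
lemma isLocalParam_shift (he : e ∈ Coord X) {t : ℂ} (hD : D (proj (γ t)) = 0)
    (hmem : ∀ᶠ s in 𝓝 t, proj (γ s) ∈ e.source)
    (hx : AnalyticAt ℂ (fun s => e (proj (γ s))) t)
    (hx' : deriv (fun s => e (proj (γ s))) t ≠ 0)
    (hy : AnalyticAt ℂ (fun s => coeffIn e P.liouville (γ s)) t) :
    IsLocalParam (γ t) (fun s => γ (t + s)) := by
  have ht : Tendsto (fun s : ℂ => t + s) (𝓝 0) (𝓝 t) := by
    have : ContinuousAt (fun s : ℂ => t + s) 0 := by fun_prop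
    simpa using this.tendsto
  have hs : AnalyticAt ℂ (fun s : ℂ => t + s) 0 := by fun_prop
  refine isLocalParam_of_coeff he hD (by simp) (ht.eventually hmem) ?_ ?_ ?_
  · exact AnalyticAt.comp (g := fun s => e (proj (γ s))) (by simpa using hx) hs
  · have := deriv_comp_const_add (fun s => e (proj (γ s))) t 0
    rw [add_zero] at this
    rwa [this]
  · exact AnalyticAt.comp (g := fun s => coeffIn e P.liouville (γ s)) (by simpa using hy) hs

lemma pullback_shift (α : P.Form) (γ : ℂ → P.SpectralCurve) (t : ℂ) :
    pullback α (fun s => γ (t + s)) 0 = pullback α γ t := by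
  unfold pullback
  have := deriv_comp_const_add (fun s => chartAt ℂ (proj (γ t)) (proj (γ s))) t 0
  simp only [add_zero] at this ⊢
  rw [this]

/-- This lets one standard curve serve as a parameter at all nearby points, so that V can be
computed along it. -/
lemma IsStdParam.eventually_isLocalParam (hP : P.Admissible) (h : IsStdParam q γ k) :
    ∀ᶠ t in 𝓝[≠] (0 : ℂ), IsLocalParam (γ t) (fun s => γ (t + s)) := by
  have h1 := h.eventually_coeffIn
  rw [eventually_nhdsWithin_iff] at h1
  filter_upwards [h.eventually_isRegular hP, h.coord.eventually_nhds.filter_mono nhdsWithin_le_nhds,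
    h1.eventually_nhds.filter_mono nhdsWithin_le_nhds, eventually_mem_nhdsWithin,
    h.k_analytic.eventually_analyticAt.filter_mono nhdsWithin_le_nhds] with t hr hc hl ht hk
  have ht0 : t ≠ 0 := ht
  have hx : (fun s => chartAt ℂ (proj q) (proj (γ s))) =ᶠ[𝓝 t]
      fun s => chartAt ℂ (proj q) (proj q) + s ^ (P.branchOrder (proj q) + 1) :=
    hc.mono fun _ h => h.2
  refine isLocalParam_shift (chart_mem_coord (proj q)) hr.1 (hc.mono fun _ h => h.1)
    (AnalyticAt.congr (by fun_prop) hx.symm) ?_ ?_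
  · rw [hx.deriv_eq]
    simpa using ⟨Nat.cast_add_one_ne_zero _, fun h => absurd h ht0⟩
  · refine AnalyticAt.congr (f := fun t => k t * t ^ ((P.branchOrder (proj q) : ℤ) -
          ((P.branchOrder (proj q) : ℤ) + 1) * D (proj q))) ?_ ?_
    · exact hk.mul (analyticAt_id.zpow ht0)
    · filter_upwards [hl, eventually_ne_nhds ht0] with s hs hs0
      exact (hs hs0).symm

/-- Near a regular point all local parameters factor through the standard one. -/
lemma IsStdParam.compare (hP : P.Admissible) (hq : q.IsRegular) (h : IsStdParam q γ k)
    (h₁ : IsLocalParam q γ₁) : γ₁ =ᶠ[𝓝 0]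
      fun t => γ (chartAt ℂ (proj q) (proj (γ₁ t)) - chartAt ℂ (proj q) (proj q)) := by
  obtain ⟨g, hg⟩ := exists_isLocalForm hP (proj q)
  set e := chartAt ℂ (proj q) with he
  have hn := branchOrder_eq_zero hP hq
  have hτ : Tendsto (fun t => e (proj (γ₁ t)) - e (proj q)) (𝓝 0) (𝓝 0) := by
    have := h₁.x_analytic.continuousAt.tendsto.sub_const (e (proj q))
    rwa [h₁.base, ← he, sub_self] at this
  have hfc := h.isLocalParam.fibreCoord_sq hg
  have hyc : ContinuousAt (fun t => fibreCoord (proj q) (γ₁ t)) 0 := h₁.y_analytic.continuousAt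
  -- The two fibre coordinates have equal squares, and their sum stays near 2 fib q ≠ 0; hence they
  -- agree.
  have hys : Tendsto (fun t => fibreCoord (proj q) (γ₁ t)
      + fibreCoord (proj q) (γ (e (proj (γ₁ t)) - e (proj q)))) (𝓝 0) (𝓝 (fib q + fib q)) := by
    refine Tendsto.add ?_ ?_
    · have := hyc.tendsto
      rwa [h₁.base, fibreCoord_self] at this
    · have := h.isLocalParam.y_analytic.continuousAt.tendsto.comp hτ
      rwa [h.base, fibreCoord_self] at this
  have hne := hys.eventually_ne (by
    rw [← two_mul]; exact mul_ne_zero two_ne_zero (fib_ne_zero hq) : fib q + fib q ≠ 0)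
  filter_upwards [h₁.mem_chart, hτ.eventually h.coord, hτ.eventually hfc, h₁.fibreCoord_sq hg, hne]
    with t h1 h2 h3 h4 h5
  have hpe : proj (γ₁ t) = proj (γ (e (proj (γ₁ t)) - e (proj q))) := by
    refine e.injOn h1 h2.1 ?_
    rw [h2.2, hn, zero_add, pow_one]
    change e _ = e (proj q) + (e _ - e (proj q))
    ring
  have hfe : fibreCoord (proj q) (γ₁ t)
      = fibreCoord (proj q) (γ (e (proj (γ₁ t)) - e (proj q))) := by
    rw [← hpe, hn] at h3
    rw [hn] at h4
    refine sub_eq_zero.1 ((mul_eq_zero.1 ?_).resolve_left h5)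
    linear_combination h4 - h3
  refine point_ext (chart_mem_coord (proj q)) h1 hpe ?_
  rw [fibreCoord_eq (Or.inr hq.1), fibreCoord_eq (Or.inr hq.1), hq.1] at hfe
  simpa only [pow_zero, mul_one] using hfe

lemma deriv_x_ne_zero_of_isRegular (hP : P.Admissible) (hq : q.IsRegular)
    (h : IsLocalParam q γ) : deriv (fun t => chartAt ℂ (proj q) (proj (γ t))) 0 ≠ 0 := by
  obtain ⟨g, hg⟩ := exists_isLocalForm hP (proj q)
  exact h.deriv_x_ne_zero hg (branchOrder_eq_zero hP hq)

lemma pullback_sigma_zero (h : IsLocalParam q γ) : pullback P.sigma γ 0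
    = 2 * fib q * deriv (fun t => chartAt ℂ (proj q) (proj (γ t))) 0 := by
  rw [pullback, sigma_eq, h.base]

lemma pullback_sigma_ne_zero (hP : P.Admissible) (hq : q.IsRegular) (h : IsLocalParam q γ) :
    pullback P.sigma γ 0 ≠ 0 := by
  rw [pullback_sigma_zero h]
  exact mul_ne_zero (mul_ne_zero two_ne_zero (fib_ne_zero hq))
    (deriv_x_ne_zero_of_isRegular hP hq h)

/-- Meromorphic functions on `Σ` with poles only at transition points, in terms of standard
parameters. -/
structure IsNice (f : P.SpectralCurve → ℂ) : Prop where
  an : ∀ q γ k, IsStdParam q γ k → q.IsRegular → AnalyticAt ℂ (f ∘ γ) 0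
  mer : ∀ q γ k, IsStdParam q γ k → MeromorphicAt (f ∘ γ) 0
  ord : ∀ q γ k, IsStdParam q γ k → RDelta q = 0 → 0 ≤ meromorphicOrderAt (f ∘ γ) 0

/-- `IsNice` quantifies over every standard parameter, which makes sums and products immediate;
`IsFunSection` asks only for one parameter at each point. -/
lemma IsNice.isFunSection (hP : P.Admissible) (hf : IsNice f) : IsFunSection f where
  hol q hq := by
    obtain ⟨γ, k, h⟩ := exists_isStdParam hP q
    exact ⟨γ, h.isLocalParam, hf.an q γ k h hq⟩
  mer q := by
    obtain ⟨γ, k, h⟩ := exists_isStdParam hP q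
    exact ⟨γ, h.isLocalParam, hf.mer q γ k h, hf.ord q γ k h⟩

lemma order_nonneg_add {f g : ℂ → ℂ} {x : ℂ} (hf : MeromorphicAt f x) (hg : MeromorphicAt g x)
    (h : 0 ≤ meromorphicOrderAt f x) (h' : 0 ≤ meromorphicOrderAt g x) :
    0 ≤ meromorphicOrderAt (f + g) x :=
  (le_min h h').trans (meromorphicOrderAt_add hf hg)

lemma IsNice.add (hf : IsNice f) (hg : IsNice g) : IsNice (fun q => f q + g q) where
  an q γ k h hq := (hf.an q γ k h hq).add (hg.an q γ k h hq)
  mer q γ k h := (hf.mer q γ k h).add (hg.mer q γ k h)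
  ord q γ k h hq := order_nonneg_add (hf.mer q γ k h) (hg.mer q γ k h) (hf.ord q γ k h hq)
    (hg.ord q γ k h hq)

lemma IsNice.mul (hf : IsNice f) (hg : IsNice g) : IsNice (fun q => f q * g q) where
  an q γ k h hq := (hf.an q γ k h hq).mul (hg.an q γ k h hq)
  mer q γ k h := (hf.mer q γ k h).mul (hg.mer q γ k h)
  ord q γ k h hq := by
    have := meromorphicOrderAt_mul (hf.mer q γ k h) (hg.mer q γ k h)
    change 0 ≤ meromorphicOrderAt ((f ∘ γ) * (g ∘ γ)) 0
    rw [this]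
    exact add_nonneg (hf.ord q γ k h hq) (hg.ord q γ k h hq)

lemma isNice_const (a : ℂ) : IsNice (fun _ : P.SpectralCurve => a) where
  an _ _ _ _ _ := analyticAt_const
  mer _ _ _ _ := analyticAt_const.meromorphicAt
  ord _ _ _ _ _ := analyticAt_const.meromorphicOrderAt_nonneg

lemma IsNice.neg (hf : IsNice f) : IsNice (fun q => -f q) := by
  simpa using (isNice_const (-1)).mul hf

lemma IsNice.sub (hf : IsNice f) (hg : IsNice g) : IsNice (fun q => f q - g q) := by
  simpa [sub_eq_add_neg] using hf.add hg.neg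

lemma isNice_sum {ι : Type*} (s : Finset ι) {F : ι → P.SpectralCurve → ℂ}
    (h : ∀ i ∈ s, IsNice (F i)) : IsNice (fun q => ∑ i ∈ s, F i q) := by
  classical
  induction s using Finset.induction_on with
  | empty => simpa using isNice_const 0
  | insert a s ha ih =>
    simp only [Finset.sum_insert ha]
    exact (h a (Finset.mem_insert_self a s)).add
      (ih fun i hi => h i (Finset.mem_insert_of_mem hi))

lemma IsStdParam.eventually_isRegular_nhds (hP : P.Admissible) (hq : q.IsRegular)
    (h : IsStdParam q γ k) : ∀ᶠ t in 𝓝 (0 : ℂ), (γ t).IsRegular :=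
  h.isLocalParam.tendsto_proj.eventually (IsRegularPoint.eventually hP hq)

/-- Every point has a punctured neighbourhood of regular points, so values at critical points play
no role. -/
lemma IsNice.congr (hP : P.Admissible) (hf : IsNice f)
    (hfg : ∀ q : P.SpectralCurve, q.IsRegular → f q = g q) : IsNice g where
  an q γ k h hq := (hf.an q γ k h hq).congr
    ((h.eventually_isRegular_nhds hP hq).mono fun t ht => hfg _ ht)
  mer q γ k h := (hf.mer q γ k h).congr
    ((h.eventually_isRegular hP).mono fun t ht => hfg _ ht)
  ord q γ k h hq := by
    have : f ∘ γ =ᶠ[𝓝[≠] 0] g ∘ γ := (h.eventually_isRegular hP).mono fun t ht => hfg _ ht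
    rw [← meromorphicOrderAt_congr this]
    exact hf.ord q γ k h hq

lemma comp_eq_of_std (hP : P.Admissible) (hq : q.IsRegular) (h : IsStdParam q γ k)
    (h₁ : IsLocalParam q γ₁) (f : P.SpectralCurve → ℂ) : f ∘ γ₁ =ᶠ[𝓝 0] (f ∘ γ) ∘
      fun t => chartAt ℂ (proj q) (proj (γ₁ t)) - chartAt ℂ (proj q) (proj q) :=
  (h.compare hP hq h₁).fun_comp f

lemma IsNice.analyticAt (hP : P.Admissible) (hf : IsNice f) (hq : q.IsRegular)
    (h : IsLocalParam q γ) : AnalyticAt ℂ (f ∘ γ) 0 := by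
  obtain ⟨γ₀, k, h₀⟩ := exists_isStdParam hP q
  refine AnalyticAt.congr (f := (f ∘ γ₀) ∘ fun t => chartAt ℂ (proj q) (proj (γ t))
    - chartAt ℂ (proj q) (proj q)) ?_ (comp_eq_of_std hP hq h₀ h f).symm
  refine AnalyticAt.comp ?_ (h.x_analytic.sub analyticAt_const)
  rw [h.base, sub_self]
  exact hf.an q γ₀ k h₀ hq

/-- By `IsStdParam.compare` any parameter is the standard one reparametrised by x - x(q). Its
nonzero speed cancels, so `d` does not depend on the parameter witnessing `HasVDeriv`. -/
lemma IsNice.hasVDeriv_unique (hP : P.Admissible) (hf : IsNice f) (hq : q.IsRegular)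
    (h : IsStdParam q γ k) {d : ℂ} (hd : HasVDeriv f q d) :
    d * (2 * fib q) = deriv (f ∘ γ) 0 := by
  obtain ⟨γ₁, h₁, hd⟩ := hd
  have hx := (h₁.x_analytic.differentiableAt.hasDerivAt.sub_const (chartAt ℂ (proj q) (proj q)))
  have hF : HasDerivAt (f ∘ γ) (deriv (f ∘ γ) 0)
      (chartAt ℂ (proj q) (proj (γ₁ 0)) - chartAt ℂ (proj q) (proj q)) := by
    rw [h₁.base, sub_self]
    exact (hf.an q γ k h hq).differentiableAt.hasDerivAt
  have hc := (HasDerivAt.comp (0 : ℂ) hF hx).congr_of_eventuallyEq (comp_eq_of_std hP hq h h₁ f)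
  have := hd.unique hc
  rw [pullback_sigma_zero h₁, ← mul_assoc] at this
  exact mul_right_cancel₀ (deriv_x_ne_zero_of_isRegular hP hq h₁) this

open Classical in
/-- The derivative of a function along the vector field `V` with `σ(V) = 1`. -/
noncomputable def vderiv (f : P.SpectralCurve → ℂ) (q : P.SpectralCurve) : ℂ :=
  if h : ∃ d, HasVDeriv f q d then h.choose else 0

lemma IsNice.vderiv_eq (hP : P.Admissible) (hf : IsNice f) (hq : q.IsRegular) {d : ℂ}
    (hd : HasVDeriv f q d) : vderiv f q = d := by
  have h : ∃ d, HasVDeriv f q d := ⟨d, hd⟩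
  obtain ⟨γ, k, hγ⟩ := exists_isStdParam hP q
  rw [vderiv, dif_pos h]
  refine mul_right_cancel₀ (mul_ne_zero two_ne_zero (fib_ne_zero hq)) ?_
  rw [hf.hasVDeriv_unique hP hq hγ h.choose_spec, hf.hasVDeriv_unique hP hq hγ hd]

lemma IsNice.hasDerivAt (hP : P.Admissible) (hf : IsNice f) (hq : q.IsRegular)
    (h : IsLocalParam q γ) : HasDerivAt (f ∘ γ) (vderiv f q * pullback P.sigma γ 0) 0 := by
  have h0 := pullback_sigma_ne_zero hP hq h
  have h1 := (hf.analyticAt hP hq h).differentiableAt.hasDerivAt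
  have h2 : deriv (f ∘ γ) 0 = deriv (f ∘ γ) 0 / pullback P.sigma γ 0 * pullback P.sigma γ 0 := by
    field_simp
  rw [hf.vderiv_eq hP hq ⟨γ, h, h2 ▸ h1⟩, ← h2]
  exact h1

lemma IsNice.hasVDeriv (hP : P.Admissible) (hf : IsNice f) (hq : q.IsRegular) :
    HasVDeriv f q (vderiv f q) := by
  obtain ⟨γ, k, h⟩ := exists_isStdParam hP q
  exact ⟨γ, h.isLocalParam, hf.hasDerivAt hP hq h.isLocalParam⟩

lemma IsNice.deriv_comp (hP : P.Admissible) (hf : IsNice f) {t : ℂ} (hq : (γ t).IsRegular)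
    (h : IsLocalParam (γ t) (fun s => γ (t + s))) :
    HasDerivAt (f ∘ γ) (vderiv f (γ t) * pullback P.sigma γ t) t := by
  have h1 := hf.hasDerivAt hP hq h
  rw [pullback_shift] at h1
  simpa [Function.comp_def] using (show HasDerivAt (fun s => f (γ (t + (s - t)))) _ t from by
    have h2 : HasDerivAt (f ∘ fun s => γ (t + s)) (vderiv f (γ t) * pullback P.sigma γ t)
      (t - t) := by rwa [sub_self]
    exact h2.comp_sub_const t t)

/-- Along a standard parameter V(f) = (f∘γ)'/γ^*σ. Off the transition points σ has order -Δ ≤ 0, so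
the division creates no pole. -/
lemma IsNice.vderiv (hP : P.Admissible) (hf : IsNice f) : IsNice (vderiv f) := by
  have key : ∀ {q : P.SpectralCurve} {γ k}, IsStdParam q γ k →
      SchrodingerOperator.vderiv f ∘ γ =ᶠ[𝓝[≠] 0] deriv (f ∘ γ) / pullback P.sigma γ := by
    intro q γ k h
    filter_upwards [h.eventually_isRegular hP, h.eventually_isLocalParam hP] with t h1 h2
    have h3 := (hf.deriv_comp hP h1 h2).deriv
    have h4 := pullback_sigma_ne_zero hP h1 h2
    rw [pullback_shift] at h4
    rw [Pi.div_apply, h3, mul_div_cancel_right₀ _ h4]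
    rfl
  have hmer : ∀ {q : P.SpectralCurve} {γ k}, IsStdParam q γ k →
      MeromorphicAt (SchrodingerOperator.vderiv f ∘ γ) 0 := fun {q γ k} h =>
    ((hf.mer q γ k h).deriv.div h.meromorphicAt_pullback_sigma).congr (key h).symm
  refine ⟨fun q γ k h hq => ?_, fun q γ k h => hmer h, fun q γ k h hq => ?_⟩
  · have hps := h.eventually_pullback_sigma_of_isRegular hP hq
    -- `key` only covers the punctured disc, whereas analyticity at a regular point also needs the
    -- right value at t = 0.
    have hall : SchrodingerOperator.vderiv f ∘ γ =ᶠ[𝓝 0]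
        fun t => deriv (f ∘ γ) t / (2 * k t) := by
      have h1 := key h
      rw [EventuallyEq, eventually_nhdsWithin_iff] at h1
      filter_upwards [h1, hps] with t h1 h2
      by_cases ht : t = 0
      · subst ht
        have h3 := (hf.hasDerivAt hP hq h.isLocalParam).deriv
        have h4 := pullback_sigma_ne_zero hP hq h.isLocalParam
        rw [← h2, h3, mul_div_cancel_right₀ _ h4, Function.comp_apply, h.base]
      · rw [h1 ht, Pi.div_apply, h2]
    refine AnalyticAt.congr ?_ hall.symm
    exact (hf.an q γ k h hq).deriv.div (analyticAt_const.mul h.k_analytic)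
      (mul_ne_zero two_ne_zero h.k_ne)
  · have ho := hf.ord q γ k h hq
    have hm := hf.mer q γ k h
    obtain ⟨G, hG, hfG⟩ := hm.meromorphicOrderAt_nonneg_iff.1 ho
    have hd : deriv (f ∘ γ) =ᶠ[𝓝[≠] 0] deriv G := hfG.nhdsNE_deriv
    rw [meromorphicOrderAt_congr (key h), meromorphicOrderAt_div hm.deriv
      h.meromorphicAt_pullback_sigma, meromorphicOrderAt_congr hd, h.order_pullback_sigma,
      ← neg_Delta_eq hP hq]
    have h1 := hG.deriv.meromorphicOrderAt_nonneg
    generalize meromorphicOrderAt (deriv G) 0 = o at *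
    induction o using WithTop.recTopCoe with
    | top => simp
    | coe m =>
      have h2 : (0 : ℤ) ≤ m := by exact_mod_cast h1
      have h3 : (0 : ℤ) ≤ m - -(Delta q : ℤ) := by omega
      exact_mod_cast h3

/-- Functions on `X` with poles only at transition points pull back to nice functions. -/
lemma isNice_comp_proj (hP : P.Admissible) {F : X → ℂ} (hmer : ∀ p, MerAt F p)
    (hol : ∀ p, P.IsRegularPoint p → HolAt F p)
    (ho : ∀ p, NonTransition P p → 0 ≤ ordAt F p) :
    IsNice (fun q : P.SpectralCurve => F (proj q)) := by
  have key : ∀ {q : P.SpectralCurve} {γ k}, IsStdParam q γ k →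
      (fun q : P.SpectralCurve => F (proj q)) ∘ γ =ᶠ[𝓝 0] (F ∘ (chartAt ℂ (proj q)).symm) ∘
        fun t => chartAt ℂ (proj q) (proj q) + t ^ (P.branchOrder (proj q) + 1) := by
    intro q γ k h
    filter_upwards [h.coord] with t ht
    simp only [Function.comp_apply]
    rw [← ht.2, (chartAt ℂ (proj q)).left_inv ht.1]
  have hx : ∀ q : P.SpectralCurve, AnalyticAt ℂ (fun t : ℂ => chartAt ℂ (proj q) (proj q)
      + t ^ (P.branchOrder (proj q) + 1)) 0 := fun q => by fun_prop
  have hx0 : ∀ q : P.SpectralCurve, chartAt ℂ (proj q) (proj q)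
      + (0 : ℂ) ^ (P.branchOrder (proj q) + 1) = chartAt ℂ (proj q) (proj q) := fun q => by simp
  have hm : ∀ {q : P.SpectralCurve} {γ k}, IsStdParam q γ k →
      MeromorphicAt ((fun q : P.SpectralCurve => F (proj q)) ∘ γ) 0 := fun {q γ k} h => by
    refine MeromorphicAt.congr ?_ ((key h).symm.filter_mono nhdsWithin_le_nhds)
    exact MeromorphicAt.comp_analyticAt (by rw [hx0]; exact hmer (proj q)) (hx q)
  refine ⟨fun q γ k h hq => ?_, fun q γ k h => hm h, fun q γ k h hq => ?_⟩
  · refine AnalyticAt.congr ?_ (key h).symm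
    exact AnalyticAt.comp (by rw [hx0]; exact hol _ hq) (hx q)
  · obtain ⟨G, hG, hFG⟩ := (MeromorphicAt.meromorphicOrderAt_nonneg_iff (hmer (proj q))).1
      (ho (proj q) (nonTransition_of_RDelta hP hq))
    refine (hm h).meromorphicOrderAt_nonneg_iff.2
      ⟨G ∘ fun t => chartAt ℂ (proj q) (proj q) + t ^ (P.branchOrder (proj q) + 1),
        AnalyticAt.comp (by rw [hx0]; exact hG) (hx q), ?_⟩
    have hT : Tendsto (fun t : ℂ => chartAt ℂ (proj q) (proj q)
        + t ^ (P.branchOrder (proj q) + 1)) (𝓝[≠] 0) (𝓝[≠] (chartAt ℂ (proj q) (proj q))) := by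
      refine tendsto_nhdsWithin_iff.2 ⟨?_, ?_⟩
      · have := (hx q).continuousAt.tendsto
        rw [hx0] at this
        exact this.mono_left nhdsWithin_le_nhds
      · filter_upwards [eventually_mem_nhdsWithin] with t ht hh
        have h0 : t ^ (P.branchOrder (proj q) + 1) = 0 := by simpa using hh
        exact ht (by simpa using h0)
    exact ((key h).filter_mono nhdsWithin_le_nhds).trans (hFG.comp_tendsto hT)

end Nice

end SchrodingerOperator

/-! ## Canonical generators and the coefficients of the Riccati equation -/

lemma AnalyticAt.exists_log {g : ℂ → ℂ} {x : ℂ} (hg : AnalyticAt ℂ g x) (h0 : g x ≠ 0) :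
    ∃ l : ℂ → ℂ, AnalyticAt ℂ l x ∧ ∀ᶠ z in 𝓝 x, Complex.exp (l z) = g z := by
  refine ⟨fun z => Complex.log (g z / g x) + Complex.log (g x), ?_, ?_⟩
  · exact ((hg.div analyticAt_const h0).clog (by simp [div_self h0])).add analyticAt_const
  · filter_upwards [hg.continuousAt.eventually_ne h0] with z hz
    rw [Complex.exp_add, Complex.exp_log (div_ne_zero hz h0), Complex.exp_log h0,
      div_mul_cancel₀ _ h0]

lemma HolAt.exists_log {X : Type*} [TopologicalSpace X] [ChartedSpace ℂ X] [IsManifold 𝓘(ℂ) ω X]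
    {F : X → ℂ} {p : X} (h : HolAt F p) (h0 : F p ≠ 0) :
    ∃ L : X → ℂ, HolAt L p ∧ ∀ᶠ x in 𝓝 p, Complex.exp (L x) = F x := by
  have hp := mem_chart_source ℂ p
  obtain ⟨l, hl, hl'⟩ := AnalyticAt.exists_log (g := F ∘ (chartAt ℂ p).symm) h (by simpa using h0)
  refine ⟨fun x => l (chartAt ℂ p x), holAt_comp_coord (chart_mem_coord p) hp hl, ?_⟩
  rw [eventually_nhds_iff_symm hp]
  filter_upwards [hl', eventually_mem_target hp] with z hz hz'
  rw [(chartAt ℂ p).right_inv hz', hz]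
  rfl

namespace SchrodingerOperator

section Canonical

variable {X : Type*} [TopologicalSpace X] [ChartedSpace ℂ X] [IsManifold 𝓘(ℂ) ω X] [T1Space X]
  {S : SpinStructure X} {D : X →₀ ℕ} {b c e e' : OpenPartialHomeomorph X ℂ} {p : X}
  {P : SchrodingerOperator S D}

variable (P) in
/-- The quotient `φ_k/φ₀`. -/
noncomputable def ratio (k : ℕ) (p : X) : ℂ := P.Q (chartAt ℂ p) k p / P.Q (chartAt ℂ p) 0 p

lemma ratio_eq (he : e ∈ Coord X) (hp : p ∈ e.source) (hD : D p = 0) {k : ℕ} (hk : k ≠ 2) :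
    P.ratio k p = P.Q e k p / P.Q e 0 p := by
  have hJ := pd_ne_zero he (chart_mem_coord p) hp (mem_chart_source ℂ p)
  rw [P.Q_transform he (chart_mem_coord p) hp (mem_chart_source ℂ p) hD hk,
    P.Q_transform he (chart_mem_coord p) hp (mem_chart_source ℂ p) hD (by norm_num : 0 ≠ 2),
    mul_div_mul_left _ _ (pow_ne_zero _ hJ), ratio]

/-- `PolesDominated` only concerns those Q_k that have a pole. Away from transition points Q₀ has
order at most 0, which settles the rest. -/
lemma ordAt_Q_dominated (hP : P.Admissible) (h : NonTransition P p) (he : e ∈ Coord X)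
    (hp : p ∈ e.source) (k : ℕ) : ordAt (P.Q e 0) p ≤ ordAt (P.Q e k) p := by
  by_cases hneg : ordAt (P.Q e k) p < 0
  · exact hP.2 e he k p hp hneg
  · refine le_trans ?_ (not_lt.1 hneg)
    rw [ordAt_Q_zero hP he hp]
    have : (P.branchOrder p : ℤ) - 2 * D p ≤ 0 := by
      rcases h with h | h
      · have := (isRegularPoint_iff hP).1 h
        rw [this.1, this.2]
        simp
      · omega
    exact_mod_cast this

lemma ordAt_div_nonneg {F G : X → ℂ} (hF : MerAt F p) (hG : MerAt G p) {m : ℤ}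
    (hm : ordAt G p = m) (h : (m : WithTop ℤ) ≤ ordAt F p) :
    0 ≤ ordAt (fun x => F x / G x) p := by
  have := meromorphicOrderAt_div hF hG
  change 0 ≤ meromorphicOrderAt ((F ∘ (chartAt ℂ p).symm) / (G ∘ (chartAt ℂ p).symm)) _
  rw [this]
  change 0 ≤ ordAt F p - ordAt G p
  rw [hm]
  generalize ordAt F p = o at *
  induction o using WithTop.recTopCoe with
  | top => simp
  | coe l =>
    have h2 : m ≤ l := by exact_mod_cast h
    have h3 : 0 ≤ l - m := by omega
    exact_mod_cast h3

/-- For k ≠ 2 the Jacobians cancel in Q_k/Q₀, so one chart computes it on a whole punctured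
neighbourhood; `ordAt_Q_dominated` excludes poles. -/
lemma isNice_ratio (hP : P.Admissible) {k : ℕ} (hk : k ≠ 2) :
    IsNice (fun q : P.SpectralCurve => P.ratio k (SpectralCurve.proj q)) := by
  have key : ∀ p, P.ratio k =ᶠ[𝓝[≠] p]
      fun x => P.Q (chartAt ℂ p) k x / P.Q (chartAt ℂ p) 0 x := fun p => by
    filter_upwards [eventually_divisor_eq_zero D p, ((chartAt ℂ p).open_source.eventually_mem
      (mem_chart_source ℂ p)).filter_mono nhdsWithin_le_nhds] with x h1 h2
    exact ratio_eq (chart_mem_coord p) h2 h1 hk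
  have hm : ∀ p k, MerAt (P.Q (chartAt ℂ p) k) p := fun p k =>
    (P.Q_pole _ (chart_mem_coord p) k p (mem_chart_source ℂ p)).1
  refine isNice_comp_proj hP (fun p => ?_) (fun p hp => ?_) (fun p hp => ?_)
  · refine MeromorphicAt.congr ((hm p k).div (hm p 0)) ?_
    exact (key p).symm.comp_tendsto (tendsto_symm_nhdsNE (mem_chart_source ℂ p))
  · have h1 := P.Q_hol _ (chart_mem_coord p) k p (mem_chart_source ℂ p) hp.1
    have h2 := P.Q_hol _ (chart_mem_coord p) 0 p (mem_chart_source ℂ p) hp.1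
    refine HolAt.congr (h1.mul (h2.inv hp.2)) ?_
    filter_upwards [eventually_divisor_eq_zero' hp.1, (chartAt ℂ p).open_source.eventually_mem
      (mem_chart_source ℂ p)] with x h1 h2
    rw [ratio_eq (chart_mem_coord p) h2 h1 hk, div_eq_mul_inv]
  · rw [ordAt_congr (key p)]
    have hd := ordAt_Q_dominated hP hp (chart_mem_coord p) (mem_chart_source ℂ p) k
    have h0 := ordAt_Q_zero hP (chart_mem_coord p) (mem_chart_source ℂ p)
    rw [h0] at hd
    exact ordAt_div_nonneg (hm p k) (hm p 0) h0 hd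

variable (P) in
/-- The logarithmic derivative `-¼ Q₀'/Q₀` of a canonical generator in the coordinate `e`. -/
noncomputable def canonicalLog (e : OpenPartialHomeomorph X ℂ) (p : X) : ℂ :=
  -(pd e (P.Q e 0) p / P.Q e 0 p) / 4

lemma holAt_canonicalLog (he : e ∈ Coord X) (hp : p ∈ e.source) (h : P.IsRegularPoint p) :
    HolAt (P.canonicalLog e) p := by
  have h0 := (isRegularPoint_iff_of_mem he hp).1 h
  have h1 := P.Q_hol e he 0 p hp h0.1
  have h2 := ((h1.pd he hp).mul (h1.inv h0.2)).mul (holAt_const (-1 / 4) p)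
  refine h2.congr (Eventually.of_forall fun x => ?_)
  simp only [canonicalLog]
  ring

lemma IsCanonicalGenerator.pd_eq {U : Set X} {a₀ : OpenPartialHomeomorph X ℂ → X → ℂ}
    (h : P.IsCanonicalGenerator U a₀) (hb : b ∈ S.frames) (hp : p ∈ U ∩ b.source) :
    a₀ b p ≠ 0 ∧ pd b (a₀ b) p = P.canonicalLog b p * a₀ b p := by
  obtain ⟨L, hL⟩ := h.formula b hb p hp
  obtain ⟨h1, h2, h3⟩ := hL.self_of_nhds
  have hbC := S.frames_subset hb
  refine ⟨by rw [h3]; exact Complex.exp_ne_zero _, ?_⟩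
  have h4 : a₀ b =ᶠ[𝓝 p] fun x => Complex.exp (-(L x) / 4) := hL.mono fun x hx => hx.2.2
  rw [pd_congr hp.2 h4]
  have h5 := (((h1.hasDerivAt hbC hp.2).neg.div_const 4).cexp).deriv
  change deriv (fun z => Complex.exp (-(L (b.symm z)) / 4)) (b p) = _
  refine Eq.trans h5 ?_
  simp only [Pi.neg_apply, Function.comp_apply, b.left_inv hp.2]
  rw [h2, h3, canonicalLog]
  ring

lemma IsCanonicalGenerator.holAt {U : Set X} {a₀ : OpenPartialHomeomorph X ℂ → X → ℂ}
    (h : P.IsCanonicalGenerator U a₀) (hb : b ∈ S.frames) (hp : p ∈ U ∩ b.source) :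
    HolAt (a₀ b) p := h.isSection.hol b hb p hp rfl

lemma IsCanonicalGenerator.pd_pd_eq {U : Set X} {a₀ : OpenPartialHomeomorph X ℂ → X → ℂ}
    (hU : IsOpen U) (h : P.IsCanonicalGenerator U a₀) (hb : b ∈ S.frames) (hp : p ∈ U ∩ b.source) :
    pd b (pd b (a₀ b)) p
      = (pd b (P.canonicalLog b) p + P.canonicalLog b p ^ 2) * a₀ b p := by
  have hbC := S.frames_subset hb
  have h1 : pd b (a₀ b) =ᶠ[𝓝 p] fun x => P.canonicalLog b x * a₀ b x := by
    filter_upwards [(hU.inter b.open_source).eventually_mem hp] with x hx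
    exact (h.pd_eq hb hx).2
  rw [pd_congr hp.2 h1, HolAt.pd_mul (holAt_canonicalLog hbC hp.2 (h.regular p hp.1))
    (h.holAt hb hp) hbC hp.2, (h.pd_eq hb hp).2]
  ring

/-- Take exp(-L/4) with e^L = Q₀ in one frame and transport it to the others. The relation a₀⁴ Q₀ =
1 is frame independent, and its derivative gives the logarithmic derivative -Q₀'/(4Q₀) in every
frame. -/
lemma exists_isCanonicalGenerator (hP : P.Admissible) (hp : P.IsRegularPoint p) :
    ∃ (U : Set X) (a₀ : OpenPartialHomeomorph X ℂ → X → ℂ), IsOpen U ∧ p ∈ U ∧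
      P.IsCanonicalGenerator U a₀ := by
  obtain ⟨b, hb, hpb⟩ := S.covers p
  have hbC := S.frames_subset hb
  have hQ := P.Q_hol b hbC 0 p hpb hp.1
  have hQ0 := ((isRegularPoint_iff_of_mem hbC hpb).1 hp).2
  obtain ⟨L, hL, hLe⟩ := hQ.exists_log hQ0
  obtain ⟨U, hU, hUo, hpU⟩ := eventually_nhds_iff.1
    (((IsRegularPoint.eventually hP hp).and (b.open_source.eventually_mem hpb)).and
      (hL.eventually.and hLe))
  set a₀ : OpenPartialHomeomorph X ℂ → X → ℂ :=
    fun c x => Complex.exp (-(L x) / 4) * (S.trans c b x)⁻¹ with ha₀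
  have hExp : ∀ x ∈ U, HolAt (fun x => Complex.exp (-(L x) / 4)) x := fun x hx => by
    have h1 : AnalyticAt ℂ (L ∘ (chartAt ℂ x).symm) _ := (hU x hx).2.1
    exact ((h1.neg.div analyticAt_const (by norm_num : (4 : ℂ) ≠ 0))).cexp
  have hhol : ∀ c ∈ S.frames, ∀ x ∈ U ∩ c.source, HolAt (a₀ c) x := fun c hc x hx =>
    (hExp x hx.1).mul ((S.trans_hol c hc b hb x ⟨hx.2, (hU x hx.1).1.2⟩).inv
      (SpinStructure.trans_ne_zero hc hb hx.2 (hU x hx.1).1.2))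
  have hne : ∀ c ∈ S.frames, ∀ x ∈ U ∩ c.source, a₀ c x ≠ 0 := fun c hc x hx =>
    mul_ne_zero (Complex.exp_ne_zero _)
      (inv_ne_zero (SpinStructure.trans_ne_zero hc hb hx.2 (hU x hx.1).1.2))
  have hfour : ∀ c ∈ S.frames, ∀ x ∈ U ∩ c.source, a₀ c x ^ 4 * P.Q c 0 x = 1 := by
    intro c hc x hx
    have hxb := (hU x hx.1).1.2
    have ht := SpinStructure.trans_ne_zero hc hb hx.2 hxb
    rw [P.Q_transform (S.frames_subset hc) hbC hx.2 hxb (hU x hx.1).1.1.1 (by norm_num),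
      ← S.trans_sq c hc b hb x ⟨hx.2, hxb⟩, ← (hU x hx.1).2.2, ha₀]
    simp only
    rw [mul_pow, ← Complex.exp_nat_mul]
    have h1 : Complex.exp ((4 : ℕ) * (-(L x) / 4)) * Complex.exp (L x) = 1 := by
      rw [← Complex.exp_add]
      push_cast
      ring_nf
      exact Complex.exp_zero
    generalize Complex.exp ((4 : ℕ) * (-(L x) / 4)) = E at h1 ⊢
    field_simp
    linear_combination h1
  refine ⟨U, a₀, hUo, hpU, fun x hx => (hU x hx).1.1, ?_, ?_⟩
  · refine SpinStructure.isSection_of_holAt hhol fun c hc d hd x hx => ?_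
    rw [ha₀]
    simp only
    rw [S.trans_cocycle c hc d hd b hb x ⟨hx.2, (hU x hx.1).1.2⟩, zpow_neg, zpow_one, mul_inv]
    ring
  · intro c hc x hx
    have hcC := S.frames_subset hc
    obtain ⟨M, hM, hMe⟩ := (hhol c hc x hx).exists_log (hne c hc x hx)
    -- M is a local logarithm of a₀ in the frame `c`, so -4M is the primitive of dlog Q₀ asked for.
    refine ⟨fun y => -4 * M y, ?_⟩
    filter_upwards [hM.eventually, hMe.eventually_nhds, (hUo.inter c.open_source).eventually_mem hx]
      with y hy hye hyU
    have hMd := (hy.hasDerivAt hcC hyU.2)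
    have h1 := ((hasDerivAt_const (c y) (-4 : ℂ)).mul hMd).deriv
    have ha := hye.self_of_nhds
    have hda : pd c (a₀ c) y = pd c M y * a₀ c y := by
      have h2 : a₀ c =ᶠ[𝓝 y] fun z => Complex.exp (M z) := hye.mono fun z hz => hz.symm
      rw [pd_congr hyU.2 h2, ← ha]
      have h3 := hMd.cexp.deriv
      refine Eq.trans h3 ?_
      simp only [Function.comp_apply, c.left_inv hyU.2]
      ring
    have hQy := P.Q_hol c hcC 0 y hyU.2 (hU y hyU.1).1.1.1
    have h4 := (((hhol c hc y hyU).hasDerivAt hcC hyU.2).pow 4).mul (hQy.hasDerivAt hcC hyU.2)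
    have h5 : ((a₀ c ∘ c.symm) ^ 4 * (P.Q c 0 ∘ c.symm)) =ᶠ[𝓝 (c y)] fun _ => 1 := by
      have := (eventually_nhds_iff_symm hyU.2).1 ((hUo.inter c.open_source).eventually_mem hyU)
      filter_upwards [this] with z hz
      exact hfour c hc _ hz
    have h6 := h4.unique ((hasDerivAt_const (c y) (1 : ℂ)).congr_of_eventuallyEq h5)
    simp only [Function.comp_apply, Pi.pow_apply, c.left_inv hyU.2, hda] at h6
    have hQ0 : P.Q c 0 y ≠ 0 :=
      ((isRegularPoint_iff_of_mem hcC hyU.2).1 (hU y hyU.1).1.1).2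
    refine ⟨(holAt_const (-4) y).mul hy, ?_, ?_⟩
    · have h7 : pd c (fun y => -4 * M y) y = -4 * pd c M y := by
        refine Eq.trans h1 ?_
        simp
      rw [h7, eq_div_iff hQ0]
      refine mul_left_cancel₀ (pow_ne_zero 4 (hne c hc y hyU)) ?_
      push_cast at h6
      linear_combination -h6
    · rw [← ha]
      congr 1
      ring

variable (P) in
/-- The coefficient of `ħ²` of the action of `-P` on a canonical generator, relative to that
generator, in the coordinate `e`. -/
noncomputable def secondCoeff (e : OpenPartialHomeomorph X ℂ) (p : X) : ℂ :=
  P.Q e 2 p - (pd e (P.canonicalLog e) p + P.canonicalLog e p ^ 2)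

variable (P) in
/-- The global function which is `secondCoeff / (4 Q₀)` in every frame. -/
noncomputable def secondRatio (p : X) : ℂ :=
  P.secondCoeff (S.covers p).choose p / (4 * P.Q (S.covers p).choose 0 p)

/-- Here α' + α² = a₀''/a₀, so `secondCoeff` is the combination Q₂ - a₀''/a₀ to which
`frame_transform` applies. It scales like Q₀ between frames, and the quotient is global. -/
lemma secondRatio_eq (hP : P.Admissible) (hb : b ∈ S.frames) (hpb : p ∈ b.source)
    (hp : P.IsRegularPoint p) : P.secondRatio p = P.secondCoeff b p / (4 * P.Q b 0 p) := by
  obtain ⟨hc, hpc⟩ := (S.covers p).choose_spec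
  rw [secondRatio]
  set c := (S.covers p).choose
  obtain ⟨U, a₀, hU, hpU, ha⟩ := exists_isCanonicalGenerator hP hp
  have key := P.frame_transform hc hb hU (fun x hx => (ha.regular x hx).1) ha.isSection
    ⟨hpU, hpc, hpb⟩ (ha.pd_eq hc ⟨hpU, hpc⟩).1 (ha.pd_eq hb ⟨hpU, hpb⟩).1
  rw [ha.pd_pd_eq hU hc ⟨hpU, hpc⟩, ha.pd_pd_eq hU hb ⟨hpU, hpb⟩,
    mul_div_cancel_right₀ _ (ha.pd_eq hc ⟨hpU, hpc⟩).1,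
    mul_div_cancel_right₀ _ (ha.pd_eq hb ⟨hpU, hpb⟩).1] at key
  rw [secondCoeff, secondCoeff, key,
    P.Q_transform (S.frames_subset hc) (S.frames_subset hb) hpc hpb hp.1 (by norm_num : 0 ≠ 2),
    mul_left_comm, mul_div_mul_left _ _
      (pow_ne_zero 2 (pd_ne_zero (S.frames_subset hc) (S.frames_subset hb) hpc hpb))]

lemma holAt_secondCoeff (he : e ∈ Coord X) (hpe : p ∈ e.source) (hp : P.IsRegularPoint p) :
    HolAt (P.secondCoeff e) p := by
  have h1 := P.Q_hol e he 2 p hpe hp.1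
  have h2 := holAt_canonicalLog he hpe hp
  exact AnalyticAt.sub h1 (AnalyticAt.add (h2.pd he hpe) (AnalyticAt.pow h2 2))

lemma secondCoeff_comp_symm (he : p ∈ e.source) : P.secondCoeff e ∘ e.symm =ᶠ[𝓝 (e p)]
    fun z => P.Q e 2 (e.symm z) - (deriv (fun w => -(1 / 4) * logDeriv (P.Q e 0 ∘ e.symm) w) z
      + (-(1 / 4) * logDeriv (P.Q e 0 ∘ e.symm) z) ^ 2) := by
  have h1 : P.canonicalLog e ∘ e.symm =ᶠ[𝓝 (e p)]
      fun w => -(1 / 4) * logDeriv (P.Q e 0 ∘ e.symm) w := by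
    filter_upwards [eventually_pd_eq_deriv he (P.Q e 0)] with w hw
    simp only [Function.comp_apply, canonicalLog, logDeriv, Pi.div_apply] at hw ⊢
    rw [hw]
    simp only [Function.comp_def]
    ring
  filter_upwards [h1, h1.eventuallyEq_nhds, eventually_pd_eq_deriv he (P.canonicalLog e)]
    with z hz hz' hz''
  simp only [Function.comp_apply, secondCoeff] at hz hz'' ⊢
  rw [hz, hz'', hz'.deriv_eq]

/-- The critical case is a pole of Q₀ of order at least 2. There α has a simple pole, so α' + α² has
order at least -2, which is no less than the order of Q₀; Q₂ is dominated as well. -/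
lemma isNice_secondRatio (hP : P.Admissible) :
    IsNice (fun q : P.SpectralCurve => P.secondRatio (SpectralCurve.proj q)) := by
  have hreg : ∀ p, P.IsRegularPoint p → HolAt P.secondRatio p := by
    intro p hp
    obtain ⟨b, hb, hpb⟩ := S.covers p
    have hbC := S.frames_subset hb
    have h1 := (isRegularPoint_iff_of_mem hbC hpb).1 hp
    have h2 := (holAt_secondCoeff hbC hpb hp).mul
      (((holAt_const 4 p).mul (P.Q_hol b hbC 0 p hpb hp.1)).inv
        (mul_ne_zero (by norm_num) h1.2))
    refine h2.congr ?_
    filter_upwards [IsRegularPoint.eventually hP hp, b.open_source.eventually_mem hpb]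
      with x hx hxb
    rw [secondRatio_eq hP hb hxb hx, div_eq_mul_inv]
  have hmer : ∀ b ∈ S.frames, ∀ p ∈ b.source, MerAt (P.secondCoeff b) p := by
    intro b hb p hpb
    have hbC := S.frames_subset hb
    have hm : ∀ k, MeromorphicAt (P.Q b k ∘ b.symm) (b p) := fun k =>
      (merAt_iff hbC hpb).1 (P.Q_pole b hbC k p hpb).1
    refine (merAt_iff hbC hpb).2 (MeromorphicAt.congr ?_
      ((secondCoeff_comp_symm hpb).symm.filter_mono nhdsWithin_le_nhds))
    have hA : MeromorphicAt (fun w => -(1 / 4) * logDeriv (P.Q b 0 ∘ b.symm) w) (b p) :=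
      (MeromorphicAt.const _ _).mul (hm 0).logDeriv
    exact (hm 2).sub (hA.deriv.add (hA.pow 2))
  have key : ∀ b ∈ S.frames, ∀ p ∈ b.source, P.secondRatio =ᶠ[𝓝[≠] p]
      fun x => P.secondCoeff b x / (4 * P.Q b 0 x) := by
    intro b hb p hpb
    filter_upwards [eventually_isRegularPoint hP p,
      (b.open_source.eventually_mem hpb).filter_mono nhdsWithin_le_nhds] with x hx hxb
    exact secondRatio_eq hP hb hxb hx
  have h4Q : ∀ b ∈ S.frames, ∀ p ∈ b.source, MerAt (fun x => 4 * P.Q b 0 x) p := by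
    intro b hb p hpb
    exact (MeromorphicAt.const _ _).mul (P.Q_pole b (S.frames_subset hb) 0 p hpb).1
  refine isNice_comp_proj hP (fun p => ?_) hreg (fun p hp => ?_)
  · obtain ⟨b, hb, hpb⟩ := S.covers p
    refine MeromorphicAt.congr ((hmer b hb p hpb).div (h4Q b hb p hpb)) ?_
    exact (key b hb p hpb).symm.comp_tendsto (tendsto_symm_nhdsNE (mem_chart_source ℂ p))
  · by_cases hpr : P.IsRegularPoint p
    · exact AnalyticAt.meromorphicOrderAt_nonneg (hreg p hpr)
    · obtain ⟨b, hb, hpb⟩ := S.covers p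
      have hbC := S.frames_subset hb
      have hm2 := hp.resolve_left hpr
      rw [ordAt_congr (key b hb p hpb)]
      have h0 := ordAt_Q_zero hP hbC hpb
      have h04 : ordAt (fun x => 4 * P.Q b 0 x) p =
          (((P.branchOrder p : ℤ) - 2 * D p : ℤ) : WithTop ℤ) := by
        rw [← h0]
        exact HolAt.ordAt_mul (holAt_const 4 p) (by norm_num) _
      refine ordAt_div_nonneg (hmer b hb p hpb) (h4Q b hb p hpb) h04 ?_
      have h2 := ordAt_Q_dominated hP hp hbC hpb 2
      rw [h0] at h2
      rw [ordAt_eq hbC hpb] at h0 h2 ⊢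
      have hm : ∀ k, MeromorphicAt (P.Q b k ∘ b.symm) (b p) := fun k =>
        (merAt_iff hbC hpb).1 (P.Q_pole b hbC k p hpb).1
      rw [meromorphicOrderAt_congr
        ((secondCoeff_comp_symm hpb).filter_mono nhdsWithin_le_nhds)]
      set A : ℂ → ℂ := fun w => -(1 / 4) * logDeriv (P.Q b 0 ∘ b.symm) w with hA
      have hAm : MeromorphicAt A (b p) := (MeromorphicAt.const _ _).mul (hm 0).logDeriv
      have hAo : meromorphicOrderAt A (b p) = ((-1 : ℤ) : WithTop ℤ) := by
        have h5 : meromorphicOrderAt A (b p)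
            = meromorphicOrderAt (logDeriv (P.Q b 0 ∘ b.symm)) (b p) :=
          meromorphicOrderAt_mul_of_ne_zero (g := fun _ => -(1 / 4 : ℂ)) analyticAt_const
            (by norm_num)
        rw [h5, meromorphicOrderAt_logDeriv_eq_neg_one (hm 0) ?_ ?_]
        · rfl
        · rw [h0]
          intro h6
          have : (P.branchOrder p : ℤ) - 2 * D p = 0 := by exact_mod_cast h6
          omega
        · rw [h0]
          exact WithTop.coe_ne_top
      have hA' : meromorphicOrderAt (deriv A) (b p) = ((-1 - 1 : ℤ) : WithTop ℤ) :=
        meromorphicOrderAt_deriv_eq_sub_one (by norm_num) hAo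
      have hA2 : meromorphicOrderAt (A ^ 2) (b p) = ((-2 : ℤ) : WithTop ℤ) := by
        rw [meromorphicOrderAt_pow hAm, hAo]
        rfl
      have hle : (((P.branchOrder p : ℤ) - 2 * D p : ℤ) : WithTop ℤ) ≤ ((-2 : ℤ) : WithTop ℤ) :=
        WithTop.coe_le_coe.2 hm2
      have hsum : (((P.branchOrder p : ℤ) - 2 * D p : ℤ) : WithTop ℤ)
          ≤ meromorphicOrderAt (deriv A + A ^ 2) (b p) := by
        refine le_trans ?_ (meromorphicOrderAt_add hAm.deriv (hAm.pow 2))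
        rw [hA', hA2]
        exact le_min hle hle
      have hfin := meromorphicOrderAt_add (hm 2) (hAm.deriv.add (hAm.pow 2)).neg
      rw [← meromorphicOrderAt_neg (f := deriv A + A ^ 2)] at hfin
      have := (le_min h2 hsum).trans hfin
      rwa [← sub_eq_add_neg] at this

end Canonical

end SchrodingerOperator

/-! ## Coefficientwise derivatives of power series and the formal exponential -/

section FormalSeries

open PowerSeries

/-- The family `Φ` of power series is coefficientwise differentiable at `z`, with derivative
`Φ'`. -/
def HasCoeffDeriv (Φ : ℂ → PowerSeries ℂ) (Φ' : PowerSeries ℂ) (z : ℂ) : Prop :=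
  ∀ n, HasDerivAt (fun w => coeff n (Φ w)) (coeff n Φ') z

variable {Φ Ψ : ℂ → PowerSeries ℂ} {Φ' Ψ' : PowerSeries ℂ} {z : ℂ}

lemma HasCoeffDeriv.add (h : HasCoeffDeriv Φ Φ' z) (h' : HasCoeffDeriv Ψ Ψ' z) :
    HasCoeffDeriv (fun w => Φ w + Ψ w) (Φ' + Ψ') z := fun n => by
  simp only [map_add]
  exact (h n).add (h' n)

lemma HasCoeffDeriv.neg (h : HasCoeffDeriv Φ Φ' z) :
    HasCoeffDeriv (fun w => -Φ w) (-Φ') z := fun n => by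
  simp only [map_neg]
  exact (h n).neg

lemma HasCoeffDeriv.sub (h : HasCoeffDeriv Φ Φ' z) (h' : HasCoeffDeriv Ψ Ψ' z) :
    HasCoeffDeriv (fun w => Φ w - Ψ w) (Φ' - Ψ') z := fun n => by
  simp only [map_sub]
  exact (h n).sub (h' n)

lemma HasCoeffDeriv.mul (h : HasCoeffDeriv Φ Φ' z) (h' : HasCoeffDeriv Ψ Ψ' z) :
    HasCoeffDeriv (fun w => Φ w * Ψ w) (Φ' * Ψ z + Φ z * Ψ') z := fun n => by
  simp only [map_add, coeff_mul, ← Finset.sum_add_distrib]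
  exact HasDerivAt.fun_sum fun i _ => (h i.1).mul (h' i.2)

lemma hasCoeffDeriv_const (A : PowerSeries ℂ) (z : ℂ) : HasCoeffDeriv (fun _ => A) 0 z :=
  fun n => by simpa using hasDerivAt_const z (coeff n A)

lemma hasCoeffDeriv_C {f : ℂ → ℂ} {f' : ℂ} (h : HasDerivAt f f' z) :
    HasCoeffDeriv (fun w => C (f w)) (C f') z := fun n => by
  simp only [coeff_C]
  split_ifs
  · exact h
  · exact hasDerivAt_const z 0

lemma HasCoeffDeriv.pow (h : HasCoeffDeriv Φ Φ' z) (m : ℕ) :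
    HasCoeffDeriv (fun w => Φ w ^ m) (C (m : ℂ) * Φ z ^ (m - 1) * Φ') z := by
  induction m with
  | zero => simpa using hasCoeffDeriv_const 1 z
  | succ m ih =>
    have := ih.mul h
    simp only [← pow_succ] at this
    convert this using 1
    rcases m with _ | m
    · simp
    · simp only [Nat.cast_add, Nat.cast_one, map_add, map_one, Nat.add_sub_cancel]
      ring

lemma hasCoeffDeriv_sum {ι : Type*} (s : Finset ι) {F : ι → ℂ → PowerSeries ℂ}
    {F' : ι → PowerSeries ℂ} (h : ∀ i ∈ s, HasCoeffDeriv (F i) (F' i) z) :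
    HasCoeffDeriv (fun w => ∑ i ∈ s, F i w) (∑ i ∈ s, F' i) z := fun n => by
  simp only [map_sum]
  exact HasDerivAt.fun_sum fun i hi => h i hi n

lemma HasCoeffDeriv.congr_deriv (h : HasCoeffDeriv Φ Φ' z) (hΨ : Φ' = Ψ') :
    HasCoeffDeriv Φ Ψ' z := hΨ ▸ h

/-- The truncated formal exponential. -/
noncomputable def truncExp (N : ℕ) (F : PowerSeries ℂ) : PowerSeries ℂ :=
  C (Complex.exp (coeff 0 F)) * ∑ m ∈ Finset.range N,
    C ((m.factorial : ℂ)⁻¹) * (F - C (coeff 0 F)) ^ m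

lemma X_dvd_sub_C (F : PowerSeries ℂ) : (X : PowerSeries ℂ) ∣ F - C (coeff 0 F) := by
  rw [X_dvd_iff]
  simp

lemma coeff_pow_eq_zero {G : PowerSeries ℂ} (hG : X ∣ G) {k m : ℕ} (h : k < m) :
    coeff k (G ^ m) = 0 :=
  X_pow_dvd_iff.1 (pow_dvd_pow_of_dvd hG m) k h

/-- X divides F - F₀, so terms with m > n do not reach degree n. One truncation length thus serves
all coefficients up to n, and the product rule applies to a finite sum. -/
lemma coeff_formalExp_eq (F : PowerSeries ℂ) {n N : ℕ} (h : n < N) :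
    coeff n (formalExp F) = coeff n (truncExp N F) := by
  rw [formalExp, coeff_mk, truncExp, coeff_C_mul, map_sum]
  congr 1
  simp only [coeff_C_mul]
  refine Finset.sum_subset (Finset.range_mono (by omega)) fun m _ hm => ?_
  rw [coeff_pow_eq_zero (X_dvd_sub_C F) (by simpa using hm), mul_zero]

lemma formalExp_zero : formalExp 0 = 1 := by
  ext n
  rw [coeff_formalExp_eq 0 (Nat.lt_succ_self n), truncExp]
  rw [Finset.sum_range_succ']
  simp

/-- The rule (exp F)' = F' exp F, with the constant term differentiated through the honest
exponential and the rest through the truncated series. -/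
lemma HasCoeffDeriv.formalExp (h : HasCoeffDeriv Φ Φ' z) :
    HasCoeffDeriv (fun w => formalExp (Φ w)) (Φ' * formalExp (Φ z)) z := by
  intro n
  set G : ℂ → PowerSeries ℂ := fun w => Φ w - C (coeff 0 (Φ w)) with hG
  set G' : PowerSeries ℂ := Φ' - C (coeff 0 Φ') with hG'
  have hGd : HasCoeffDeriv G G' z := h.sub (hasCoeffDeriv_C (h 0))
  have hE := (hasCoeffDeriv_C (h 0).cexp).mul (hasCoeffDeriv_sum (Finset.range (n + 1))
    fun m _ => (hasCoeffDeriv_const (C ((m.factorial : ℂ)⁻¹)) z).mul (hGd.pow m))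
  have hsum : ∑ m ∈ Finset.range (n + 1), ((0 : PowerSeries ℂ) * G z ^ m
      + C ((m.factorial : ℂ)⁻¹) * (C (m : ℂ) * G z ^ (m - 1) * G'))
      = G' * ∑ m ∈ Finset.range n, C ((m.factorial : ℂ)⁻¹) * G z ^ m := by
    rw [Finset.sum_range_succ', Finset.mul_sum]
    simp only [zero_mul, zero_add, Nat.cast_zero, map_zero, mul_zero, add_zero]
    refine Finset.sum_congr rfl fun m _ => ?_
    have : C (((m + 1).factorial : ℂ)⁻¹) * C ((m + 1 : ℕ) : ℂ)
        = (C ((m.factorial : ℂ)⁻¹) : PowerSeries ℂ) := by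
      rw [← map_mul, Nat.factorial_succ]
      have h1 : ((m + 1 : ℕ) : ℂ) ≠ 0 := Nat.cast_ne_zero.2 (Nat.succ_ne_zero m)
      congr 1
      push_cast at h1 ⊢
      field_simp
    rw [Nat.add_sub_cancel, ← this]
    ring
  have hprod : coeff n (Φ' * WKB.formalExp (Φ z)) = coeff n (Φ' * truncExp (n + 1) (Φ z)) := by
    rw [coeff_mul, coeff_mul]
    refine Finset.sum_congr rfl fun i hi => ?_
    rw [coeff_formalExp_eq (Φ z) (N := n + 1)]
    have := Finset.HasAntidiagonal.mem_antidiagonal.1 hi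
    omega
  have hfun : (fun w => coeff n (WKB.formalExp (Φ w))) = fun w => coeff n (truncExp (n + 1) (Φ w)) := by
    funext w
    exact coeff_formalExp_eq (Φ w) (Nat.lt_succ_self n)
  rw [hfun, hprod]
  refine (show HasDerivAt (fun w => coeff n (truncExp (n + 1) (Φ w))) _ z from
    hE n).congr_deriv (Eq.symm ?_)
  rw [hsum, truncExp]
  change coeff n (Φ' * (C _ * ∑ m ∈ Finset.range (n + 1), C ((m.factorial : ℂ)⁻¹) * G z ^ m)) = _
  -- Differentiation shortens the truncated sum by its top term. That term is divisible by X^{n+1},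
  -- as X divides G' and Xⁿ divides Gⁿ, so degree n is unaffected.
  have hlast : coeff n (C (Complex.exp (coeff 0 (Φ z))) *
      (G' * (C ((n.factorial : ℂ)⁻¹) * G z ^ n))) = 0 := by
    have hd : (X : PowerSeries ℂ) ^ (n + 1) ∣ C (Complex.exp (coeff 0 (Φ z))) *
      (G' * (C ((n.factorial : ℂ)⁻¹) * G z ^ n)) := by
      obtain ⟨A, hA⟩ := X_dvd_sub_C Φ'
      obtain ⟨B, hB⟩ := pow_dvd_pow_of_dvd (X_dvd_sub_C (Φ z)) n
      refine ⟨C (Complex.exp (coeff 0 (Φ z))) * (A * (C ((n.factorial : ℂ)⁻¹) * B)), ?_⟩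
      simp only [hG, hG']
      rw [hA, hB]
      ring
    exact X_pow_dvd_iff.1 hd n (Nat.lt_succ_self n)
  have hΦ' : Φ' = G' + C (coeff 0 Φ') := by rw [hG']; ring
  rw [Finset.sum_range_succ, map_mul (C : ℂ →+* PowerSeries ℂ)]
  conv_lhs => rw [hΦ']
  rw [← sub_eq_zero, ← map_sub, ← hlast]
  congr 1
  ring

/-- The Riccati equation in terms of coefficients. -/
lemma riccati_iff_coeff (w : ℂ) (V f W : ℕ → ℂ) :
    (X * mk V - mk f : PowerSeries ℂ) = X * (mk f ^ 2 + C w * mk f + mk W) ↔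
      f 0 = 0 ∧ ∀ n, V n - f (n + 1) =
        ∑ i : Fin (n + 1), f i.1 * f (n - i.1) + w * f n + W n := by
  have h0 : ∀ n, coeff n (mk f ^ 2) = ∑ i : Fin (n + 1), f i.1 * f (n - i.1) := fun n => by
    rw [sq, coeff_mul, Finset.Nat.sum_antidiagonal_eq_sum_range_succ_mk, Finset.sum_range]
    simp
  constructor
  · intro h
    refine ⟨?_, fun n => ?_⟩
    · have := congrArg (coeff 0) h
      simpa using this
    · have := congrArg (coeff (n + 1)) h
      simp only [map_sub, coeff_succ_X_mul, coeff_mk, map_add, coeff_C_mul, h0] at this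
      exact this
  · rintro ⟨h1, h2⟩
    ext n
    rcases n with _ | n
    · simp [h1]
    · simp only [map_sub, coeff_succ_X_mul, coeff_mk, map_add, coeff_C_mul, h0]
      exact h2 n

end FormalSeries

/-- The algebra behind the reduction of the Schrödinger equation to the global Riccati
equation. -/
lemma riccati_algebra {R : Type*} [CommRing R] {x l l₁ α α₁ Q₀ Q₁ Q₂ w w₁ f₁ f Vf W Qs M M' : R}
    (h0 : l ^ 2 = Q₀) (h1 : l₁ = -(2 * l * α)) (h2 : 2 * l * (l * w) = Q₁)
    (hM : M = l * w + 2 * l * f)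
    (hM' : M' = l₁ * w + 2 * l ^ 2 * w₁ + 2 * l₁ * f + 4 * l ^ 2 * Vf)
    (hR : x * Vf - f = x * (f ^ 2 + w * f + W))
    (hW : 4 * l ^ 2 * x ^ 2 * W = -(4 * l ^ 2 * f₁ * x ^ 2) - (Qs - Q₀ - Q₁ * x - Q₂ * x ^ 2))
    (hf : 4 * l ^ 2 * f₁ = Q₂ - (α₁ + α ^ 2) - l ^ 2 * w ^ 2 + 2 * l ^ 2 * w₁) :
    l ^ 2 - x * (l₁ + 2 * l * (α - M)) + x ^ 2 * (α₁ - M' + (α - M) ^ 2) - Qs = 0 := by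
  -- Here l is the coefficient of λ, α that of dlog a₀, M that of Λ̂, and l₁, α₁, M' are their
  -- derivatives; w₁ and Vf are derivatives along V. The combination below adds order 0, order 1,
  -- the Riccati equation scaled by 4l²x, the definition of W, and order 2, which fixes f₁.
  subst hM hM' h1
  linear_combination h0 + x * h2 - 4 * l ^ 2 * x * hR - hW + x ^ 2 * hf

/-! ## The solution of the Riccati equation and the formal differential -/

namespace SchrodingerOperator

section Riccati

variable {X : Type*} [TopologicalSpace X] [ChartedSpace ℂ X] [IsManifold 𝓘(ℂ) ω X] [T1Space X]
  {S : SpinStructure X} {D : X →₀ ℕ} {P : SchrodingerOperator S D} {q : P.SpectralCurve}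

open SpectralCurve

lemma pullQuad_div_sigma_sq (hq : q.IsRegular) (k : ℕ) :
    P.pullQuad k q / P.sigma q ^ 2 = P.ratio k (proj q) / 4 := by
  have h := fib_sq hq.1
  rw [sigma_eq, mul_pow, h, pullQuad, ratio]
  have := hq.2
  field_simp
  norm_num

lemma w_eq (hq : q.IsRegular) : P.w q = P.ratio 1 (proj q) / 2 := by
  rw [w, mul_div_assoc, pullQuad_div_sigma_sq hq]
  ring

lemma isNice_w (hP : P.Admissible) : IsNice P.w := by
  refine IsNice.congr hP ((isNice_const (1 / 2)).mul (isNice_ratio hP (k := 1) (by norm_num)))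
    fun q hq => ?_
  rw [w_eq hq]
  ring

lemma sigma_ne_zero (hq : q.IsRegular) : P.sigma q ≠ 0 := by
  rw [sigma_eq]
  exact mul_ne_zero two_ne_zero (fib_ne_zero hq)

variable (P) in
/-- The coefficients, independent of `Λ`, of `W` in degrees `k ≥ 1`. -/
noncomputable def tail (k : ℕ) (q : P.SpectralCurve) : ℂ :=
  -(P.pullQuad (k + 2) q) / P.sigma q ^ 2

lemma isNice_tail (hP : P.Admissible) {k : ℕ} (hk : k ≠ 0) : IsNice (P.tail k) := by
  refine IsNice.congr hP ((isNice_const (-1 / 4)).mul (isNice_ratio hP (k := k + 2) (by omega)))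
    fun q hq => ?_
  rw [tail, neg_div _ (P.pullQuad _ q), pullQuad_div_sigma_sq hq]
  ring

variable (P) in
/-- The coefficients of the solution `f` of the global Riccati equation. -/
noncomputable def riccatiSol : ℕ → P.SpectralCurve → ℂ
  | 0 => fun _ => 0
  -- The Riccati equation gives only f₁ = -W₀ = Λ₁/σ, which is circular. This value solves the ħ²
  -- coefficient of the Schrödinger equation: 4l² f₁ = Q₂ - (α' + α²) - l²w² + 2l² V(w).
  | 1 => fun q => P.secondRatio (proj q) - P.w q ^ 2 / 4 + vderiv P.w q / 2
  | n + 2 => fun q => vderiv (riccatiSol (n + 1)) q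
      - ∑ i : Fin (n + 2), riccatiSol i.1 q * riccatiSol (n + 1 - i.1) q
      - P.w q * riccatiSol (n + 1) q - P.tail (n + 1) q
termination_by n => n
decreasing_by all_goals omega

lemma riccatiSol_zero : P.riccatiSol 0 = fun _ => 0 := by rw [riccatiSol]

lemma riccatiSol_one : P.riccatiSol 1 = fun q =>
    P.secondRatio (proj q) - P.w q ^ 2 / 4 + vderiv P.w q / 2 := by rw [riccatiSol]

lemma riccatiSol_add_two (n : ℕ) : P.riccatiSol (n + 2) = fun q => vderiv (P.riccatiSol (n + 1)) q
      - ∑ i : Fin (n + 2), P.riccatiSol i.1 q * P.riccatiSol (n + 1 - i.1) q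
      - P.w q * P.riccatiSol (n + 1) q - P.tail (n + 1) q := by rw [riccatiSol]

lemma isNice_riccatiSol (hP : P.Admissible) (n : ℕ) : IsNice (P.riccatiSol n) := by
  induction n using Nat.strong_induction_on with
  | _ n ih =>
    rcases n with _ | _ | n
    · rw [riccatiSol_zero]
      exact isNice_const 0
    · rw [riccatiSol_one]
      refine IsNice.congr hP (((isNice_secondRatio hP).sub ((isNice_const (1 / 4)).mul
        ((isNice_w hP).mul (isNice_w hP)))).add
          ((isNice_const (1 / 2)).mul ((isNice_w hP).vderiv hP))) fun q _ => ?_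
      ring
    · rw [riccatiSol_add_two]
      exact ((((ih (n + 1) (by omega)).vderiv hP).sub (isNice_sum _ fun i _ =>
        (ih i.1 (by omega)).mul (ih (n + 1 - i.1) (by omega)))).sub
        ((isNice_w hP).mul (ih (n + 1) (by omega)))).sub (isNice_tail hP (by omega))

variable (P) in
/-- The formal differential expressing the formal WKB solutions. -/
noncomputable def formalDifferential (n : ℕ) : P.Form := fun q =>
  if n = 0 then P.pullQuad 1 q / P.sigma q else P.riccatiSol n q * P.sigma q

lemma formalDifferential_zero (q : P.SpectralCurve) :
    P.formalDifferential 0 q = P.pullQuad 1 q / P.sigma q := if_pos rfl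

lemma formalDifferential_of_ne {n : ℕ} (hn : n ≠ 0) (q : P.SpectralCurve) :
    P.formalDifferential n q = P.riccatiSol n q * P.sigma q := if_neg hn

variable (P) in
/-- The quotients `Λ_n/σ`. -/
noncomputable def formalQuotient (n : ℕ) (q : P.SpectralCurve) : ℂ :=
  if n = 0 then P.w q / 2 else P.riccatiSol n q

lemma isNice_formalQuotient (hP : P.Admissible) (n : ℕ) : IsNice (P.formalQuotient n) := by
  by_cases hn : n = 0
  · refine IsNice.congr hP ((isNice_const (1 / 2)).mul (isNice_w hP)) fun q _ => ?_
    rw [formalQuotient, if_pos hn]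
    ring
  · refine IsNice.congr hP (isNice_riccatiSol hP n) fun q _ => ?_
    rw [formalQuotient, if_neg hn]

lemma formalDifferential_eq (hq : q.IsRegular) (n : ℕ) :
    P.formalDifferential n q = P.formalQuotient n q * P.sigma q := by
  unfold formalDifferential formalQuotient
  split_ifs
  · have := sigma_ne_zero hq
    rw [w]
    field_simp
  · rfl

/-- Away from transition points σ has order exactly -Δ, so multiplying by a function without poles
there respects the bound. -/
lemma IsNice.isFormSection (hP : P.Admissible) {F : P.SpectralCurve → ℂ} (hF : IsNice F)
    {α : P.Form} (hα : ∀ q : P.SpectralCurve, q.IsRegular → α q = F q * P.sigma q) :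
    IsFormSection α := by
  have key : ∀ {γ : ℂ → P.SpectralCurve} {t : ℂ}, (γ t).IsRegular →
      pullback α γ t = F (γ t) * pullback P.sigma γ t := fun {γ t} h => by
    rw [pullback, hα _ h, pullback, mul_assoc]
  refine ⟨fun q hq => ?_, fun q => ?_⟩
  · obtain ⟨γ, k, h⟩ := exists_isStdParam hP q
    refine ⟨γ, h.isLocalParam, AnalyticAt.congr (f := fun t => (F ∘ γ) t * (2 * k t))
      ((hF.an q γ k h hq).mul (analyticAt_const.mul h.k_analytic)) ?_⟩
    filter_upwards [h.eventually_isRegular_nhds hP hq,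
      h.eventually_pullback_sigma_of_isRegular hP hq] with t h1 h2
    rw [key h1, h2]
    rfl
  · obtain ⟨γ, k, h⟩ := exists_isStdParam hP q
    have hev : (F ∘ γ) * pullback P.sigma γ =ᶠ[𝓝[≠] 0] pullback α γ := by
      filter_upwards [h.eventually_isRegular hP] with t ht
      rw [key ht]
      rfl
    have hm := hF.mer q γ k h
    refine ⟨γ, h.isLocalParam, (hm.mul h.meromorphicAt_pullback_sigma).congr hev, fun hR => ?_⟩
    rw [← meromorphicOrderAt_congr hev, meromorphicOrderAt_mul hm h.meromorphicAt_pullback_sigma,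
      h.order_pullback_sigma, ← neg_Delta_eq hP hR]
    exact le_add_of_nonneg_left (hF.ord q γ k h hR)

lemma isFormSection_formalDifferential (hP : P.Admissible) (n : ℕ) :
    IsFormSection (P.formalDifferential n) :=
  (isNice_formalQuotient hP n).isFormSection hP fun _ hq => formalDifferential_eq hq n

lemma W_zero_eq (hq : q.IsRegular) : P.W P.formalDifferential 0 q = -(P.riccatiSol 1 q) := by
  rw [W, if_pos rfl, formalDifferential_of_ne one_ne_zero, neg_div,
    mul_div_cancel_right₀ _ (sigma_ne_zero hq)]

lemma W_succ_eq (Λ : ℕ → P.Form) {n : ℕ} (hn : n ≠ 0) : P.W Λ n q = P.tail n q := by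
  rw [W, if_neg hn, tail]

lemma isNice_W (hP : P.Admissible) (n : ℕ) : IsNice (P.W P.formalDifferential n) := by
  by_cases hn : n = 0
  · subst hn
    exact IsNice.congr hP (isNice_riccatiSol hP 1).neg fun q hq => (W_zero_eq hq).symm
  · exact IsNice.congr hP (isNice_tail hP hn) fun q _ => (W_succ_eq _ hn).symm

lemma vderiv_zero (hP : P.Admissible) (hq : q.IsRegular) :
    vderiv (fun _ : P.SpectralCurve => (0 : ℂ)) q = 0 := by
  obtain ⟨γ, k, h⟩ := exists_isStdParam hP q
  refine (isNice_const 0).vderiv_eq hP hq ⟨γ, h.isLocalParam, ?_⟩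
  rw [zero_mul]
  exact hasDerivAt_const 0 0

/-- The order-one coefficient is a tautology, since W₀ = -f₁ by definition of Λ₁; higher orders are
the recursion. -/
lemma riccatiSol_equation (hP : P.Admissible) (hq : q.IsRegular) :
    (PowerSeries.X * PowerSeries.mk (fun n => vderiv (P.riccatiSol n) q)
      - PowerSeries.mk (fun n => P.riccatiSol n q) : PowerSeries ℂ) =
      PowerSeries.X * (PowerSeries.mk (fun n => P.riccatiSol n q) ^ 2
        + PowerSeries.C (P.w q) * PowerSeries.mk (fun n => P.riccatiSol n q)
        + PowerSeries.mk (fun n => P.W P.formalDifferential n q)) := by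
  refine (riccati_iff_coeff _ _ _ _).2 ⟨by rw [riccatiSol_zero], fun n => ?_⟩
  rcases n with _ | n
  · rw [W_zero_eq hq, riccatiSol_zero, vderiv_zero hP hq]
    simp [riccatiSol_zero]
  · rw [W_succ_eq _ (Nat.succ_ne_zero n), riccatiSol_add_two]
    ring

lemma solvesRiccati_riccatiSol (hP : P.Admissible) :
    SolvesRiccati P.w (P.W P.formalDifferential) P.riccatiSol := fun q hq =>
  ⟨fun n => vderiv (P.riccatiSol n) q, fun n => (isNice_riccatiSol hP n).hasVDeriv hP hq,
    riccatiSol_equation hP hq⟩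

lemma HasVDeriv.congr (hP : P.Admissible) (hq : q.IsRegular) {f g : P.SpectralCurve → ℂ}
    (hfg : ∀ q : P.SpectralCurve, q.IsRegular → f q = g q) {d : ℂ} (h : HasVDeriv f q d) :
    HasVDeriv g q d := by
  obtain ⟨γ, hγ, hd⟩ := h
  refine ⟨γ, hγ, hd.congr_of_eventuallyEq ?_⟩
  filter_upwards [hγ.tendsto_proj.eventually (IsRegularPoint.eventually hP hq)] with t ht
  exact (hfg _ ht).symm

/-- The coefficient of ħ^{n+1} expresses f_{n+1} through f₀, …, f_n and V(f_n). No regularity of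
`f'` is assumed: V depends only on values near q, which the induction identifies with those of
`riccatiSol`. -/
lemma solvesRiccati_unique (hP : P.Admissible) {f' : ℕ → P.SpectralCurve → ℂ}
    (h : SolvesRiccati P.w (P.W P.formalDifferential) f') (n : ℕ) :
    ∀ q : P.SpectralCurve, q.IsRegular → f' n q = P.riccatiSol n q := by
  induction n using Nat.strong_induction_on with
  | _ n ih =>
    intro q hq
    obtain ⟨V, hV, heq⟩ := h q hq
    obtain ⟨h1, h2⟩ := (riccati_iff_coeff _ _ _ _).1 heq
    obtain ⟨h1', h2'⟩ := (riccati_iff_coeff _ _ _ _).1 (riccatiSol_equation hP hq)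
    rcases n with _ | n
    · rw [h1, h1']
    · have hv : vderiv (P.riccatiSol n) q = V n :=
        (isNice_riccatiSol hP n).vderiv_eq hP hq ((hV n).congr hP hq (ih n (Nat.lt_succ_self n)))
      have hs : ∑ i : Fin (n + 1), f' i.1 q * f' (n - i.1) q
          = ∑ i : Fin (n + 1), P.riccatiSol i.1 q * P.riccatiSol (n - i.1) q :=
        Finset.sum_congr rfl fun i _ => by
          rw [ih i.1 (by omega) q hq, ih (n - i.1) (by omega) q hq]
      have e1 := h2 n
      have e2 := h2' n
      rw [hs, ih n (Nat.lt_succ_self n) q hq] at e1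
      rw [hv] at e2
      linear_combination e2 - e1

end Riccati

end SchrodingerOperator

/-! ## Existence of the formal WKB solutions -/

namespace SchrodingerOperator

section Existence

variable {X : Type*} [TopologicalSpace X] [ChartedSpace ℂ X] [IsManifold 𝓘(ℂ) ω X] [T1Space X]
  {S : SpinStructure X} {D : X →₀ ℕ} {P : SchrodingerOperator S D} {q : P.SpectralCurve}
  {b e : OpenPartialHomeomorph X ℂ} {p : X} {r : ℝ} {v : ℂ → ℂ} {F : P.SpectralCurve → ℂ}

open SpectralCurve

/-- On the disc of radius `r` about `π q` in the coordinate `chartAt ℂ (π q)`, all points are regular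
and `v` is the branch of `√Q₀` singled out by `q`. -/
structure IsDisc (q : P.SpectralCurve) (r : ℝ) (v : ℂ → ℂ) : Prop where
  pos : 0 < r
  target : ∀ x ∈ Metric.ball (chartAt ℂ (proj q) (proj q)) r, x ∈ (chartAt ℂ (proj q)).target
  regular : ∀ x ∈ Metric.ball (chartAt ℂ (proj q) (proj q)) r,
    P.IsRegularPoint ((chartAt ℂ (proj q)).symm x)
  analytic : ∀ x ∈ Metric.ball (chartAt ℂ (proj q) (proj q)) r, AnalyticAt ℂ v x
  sq : ∀ x ∈ Metric.ball (chartAt ℂ (proj q) (proj q)) r,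
    v x ^ 2 = P.Q (chartAt ℂ (proj q)) 0 ((chartAt ℂ (proj q)).symm x)
  base : v (chartAt ℂ (proj q) (proj q)) = fib q

/-- The open set of `X` corresponding to a coordinate disc about `π q`. -/
def discDomain (q : P.SpectralCurve) (r : ℝ) : Set X :=
  (chartAt ℂ (proj q)).source ∩
    chartAt ℂ (proj q) ⁻¹' Metric.ball (chartAt ℂ (proj q) (proj q)) r

/-- The lift to the spectral curve determined by a branch `v` of `√Q₀`. -/
noncomputable def discLift (q : P.SpectralCurve) (v : ℂ → ℂ) (p : X) : P.SpectralCurve :=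
  pointOver (chartAt ℂ (proj q)) q p (v (chartAt ℂ (proj q) p))

lemma isOpen_discDomain (q : P.SpectralCurve) (r : ℝ) : IsOpen (discDomain q r) :=
  (chartAt ℂ (proj q)).isOpen_inter_preimage Metric.isOpen_ball

lemma exists_isDisc {U : Set X} (hU : IsOpen U) (hqU : proj q ∈ U)
    (hreg : ∀ p ∈ U, P.IsRegularPoint p) :
    ∃ r v, IsDisc q r v ∧ discDomain q r ⊆ U := by
  set e := chartAt ℂ (proj q) with he
  have heC : e ∈ Coord X := chart_mem_coord (proj q)
  have hpe : proj q ∈ e.source := mem_chart_source ℂ (proj q)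
  have hq := hreg _ hqU
  have hQ : AnalyticAt ℂ (P.Q e 0 ∘ e.symm) (e (proj q)) := P.Q_hol e heC 0 _ hpe hq.1
  obtain ⟨v, hv, hv0, hvs⟩ := AnalyticAt.exists_sqrt hQ (d := fib q)
    (by rw [fib_sq hq.1]; simp [he]) (fib_ne_zero hq)
  have hUe := (eventually_nhds_iff_symm hpe).1 (hU.eventually_mem hqU)
  obtain ⟨r, hr, hball⟩ := Metric.eventually_nhds_iff_ball.1
    ((eventually_mem_target hpe).and (hUe.and (hv.eventually_analyticAt.and hvs)))
  refine ⟨r, v, ⟨hr, fun x hx => (hball x hx).1, fun x hx => hreg _ (hball x hx).2.1,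
    fun x hx => (hball x hx).2.2.1, fun x hx => (hball x hx).2.2.2, hv0⟩, fun p hp => ?_⟩
  have := (hball _ hp.2).2.1
  rwa [e.left_inv hp.1] at this

namespace IsDisc

variable (h : IsDisc q r v)
include h

lemma proj_mem : proj q ∈ discDomain q r :=
  ⟨mem_chart_source ℂ _, Metric.mem_ball_self h.pos⟩

lemma regular_of_mem (hp : p ∈ discDomain q r) : P.IsRegularPoint p := by
  have := h.regular _ hp.2
  rwa [(chartAt ℂ (proj q)).left_inv hp.1] at this

lemma spec (hp : p ∈ discDomain q r) : proj (discLift q v p) = p ∧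
    coeffIn (chartAt ℂ (proj q)) P.liouville (discLift q v p) = v (chartAt ℂ (proj q) p) := by
  refine pointOver_spec (chart_mem_coord _) q hp.1 (h.regular_of_mem hp).1 ?_
  rw [h.sq _ hp.2, (chartAt ℂ (proj q)).left_inv hp.1]

lemma isRegular_lift (hp : p ∈ discDomain q r) : (discLift q v p).IsRegular := by
  unfold SpectralCurve.IsRegular
  rw [(h.spec hp).1]
  exact h.regular_of_mem hp

lemma lift_base : discLift q v (proj q) = q := by
  have h1 := h.spec h.proj_mem
  refine point_ext (chart_mem_coord (proj q)) ?_ h1.1 ?_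
  · rw [h1.1]
    exact mem_chart_source ℂ _
  · rw [h1.2, h.base, coeffIn_chart]
    rfl

lemma isPreconnected : IsPreconnected (discDomain q r) := by
  have : discDomain q r = (chartAt ℂ (proj q)).symm ''
      Metric.ball (chartAt ℂ (proj q) (proj q)) r := by
    ext p
    constructor
    · intro hp
      exact ⟨_, hp.2, (chartAt ℂ (proj q)).left_inv hp.1⟩
    · rintro ⟨x, hx, rfl⟩
      have ht := h.target x hx
      refine ⟨(chartAt ℂ (proj q)).map_target ht, ?_⟩
      rw [mem_preimage, (chartAt ℂ (proj q)).right_inv ht]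
      exact hx
  rw [this]
  exact (convex_ball _ _).isPreconnected.image _
    ((chartAt ℂ (proj q)).continuousOn_symm.mono fun x hx => h.target x hx)

lemma eventually_mem (hp : p ∈ discDomain q r) : ∀ᶠ p' in 𝓝 p, p' ∈ discDomain q r :=
  (isOpen_discDomain q r).eventually_mem hp

lemma holAt_coeff (he : e ∈ Coord X) (hpe : p ∈ e.source) (hp : p ∈ discDomain q r) :
    HolAt (fun p => coeffIn e P.liouville (discLift q v p)) p := by
  have h1 : HolAt (fun p => v (chartAt ℂ (proj q) p)) p :=
    holAt_comp_coord (chart_mem_coord _) hp.1 (h.analytic _ hp.2)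
  refine (h1.mul (holAt_jacobian he (chart_mem_coord (proj q)) hpe hp.1)).congr ?_
  filter_upwards [h.eventually_mem hp, e.open_source.eventually_mem hpe] with x hx hxe
  rw [coeffIn_change (chart_mem_coord (proj q)) he _ (by rw [(h.spec hx).1]; exact hx.1)
    (by rw [(h.spec hx).1]; exact hxe), (h.spec hx).2, (h.spec hx).1]

lemma coeff_sq (he : e ∈ Coord X) (hpe : p ∈ e.source) (hp : p ∈ discDomain q r) :
    coeffIn e P.liouville (discLift q v p) ^ 2 = P.Q e 0 p := by
  have h1 := (h.spec hp).1
  rw [coeffIn_liouville_sq he (by rwa [h1]) (by rw [h1]; exact (h.regular_of_mem hp).1), h1]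

lemma isLift : IsLift q (discDomain q r) (discLift q v) where
  base := h.lift_base
  proj_eq p hp := (h.spec hp).1
  hol p hp := by
    refine (h.holAt_coeff (chart_mem_coord (proj q)) hp.1 hp).congr (Eventually.of_forall ?_)
    intro x
    have hD := (h.regular_of_mem h.proj_mem).1
    simp only
    rw [fibreCoord_eq (Or.inr hD), hD, pow_zero, mul_one]

/-- The lift followed along x is itself a local parameter of Σ, and σ pulls back to 2l dx; so d/dx
acts as 2l V. -/
lemma hasDerivAt_nice (hP : P.Admissible) (hF : IsNice F) (hp : p ∈ discDomain q r) :
    HolAt (fun p => F (discLift q v p)) p ∧ pd (chartAt ℂ (proj q)) (fun p => F (discLift q v p)) p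
      = vderiv F (discLift q v p)
        * (2 * coeffIn (chartAt ℂ (proj q)) P.liouville (discLift q v p)) := by
  set e := chartAt ℂ (proj q) with he
  have heC : e ∈ Coord X := chart_mem_coord _
  set γ : ℂ → P.SpectralCurve := fun x => discLift q v (e.symm x) with hγ
  have hγt : γ (e p) = discLift q v p := by simp only [hγ, e.left_inv hp.1]
  have hball : ∀ᶠ x in 𝓝 (e p), e.symm x ∈ discDomain q r ∧ x ∈ e.target :=
    ((eventually_nhds_iff_symm hp.1).1 (h.eventually_mem hp)).and (eventually_mem_target hp.1)
  have hx : (fun s => e (proj (γ s))) =ᶠ[𝓝 (e p)] id := by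
    filter_upwards [hball] with s hs
    rw [(h.spec hs.1).1, e.right_inv hs.2]
    rfl
  have hmem : ∀ᶠ s in 𝓝 (e p), proj (γ s) ∈ e.source := by
    filter_upwards [hball] with s hs
    rw [(h.spec hs.1).1]
    exact e.map_target hs.2
  have hreg : (γ (e p)).IsRegular := by rw [hγt]; exact h.isRegular_lift hp
  have hloc : IsLocalParam (γ (e p)) (fun s => γ (e p + s)) := by
    refine isLocalParam_shift heC hreg.1 hmem (analyticAt_id.congr hx.symm) ?_ ?_
    · rw [hx.deriv_eq]
      simp
    · refine (h.analytic _ hp.2).congr ?_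
      filter_upwards [hball] with s hs
      rw [(h.spec hs.1).2, ← he, e.right_inv hs.2]
  have hd := hF.deriv_comp hP hreg hloc
  have hps : pullback P.sigma γ (e p) = 2 * coeffIn e P.liouville (discLift q v p) := by
    rw [pullback_eq heC _ hmem (hx.differentiableAt_iff.2 differentiableAt_id), hx.deriv_eq,
      deriv_id, mul_one, coeffIn_sigma, hγt]
  rw [hps, hγt] at hd
  refine ⟨(holAt_iff heC hp.1).2 ?_, hd.deriv⟩
  have h1 := hF.analyticAt hP hreg hloc
  have h2 : AnalyticAt ℂ ((F ∘ fun s => γ (e p + s)) ∘ fun x => x - e p) (e p) :=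
    AnalyticAt.comp (by simpa using h1) (by fun_prop)
  refine h2.congr (Eventually.of_forall fun x => ?_)
  simp [hγ]

lemma pd_nice (hP : P.Admissible) (hF : IsNice F) (hp : p ∈ discDomain q r) (hb : b ∈ Coord X)
    (hpb : p ∈ b.source) : pd b (fun p => F (discLift q v p)) p
      = vderiv F (discLift q v p) * (2 * coeffIn b P.liouville (discLift q v p)) := by
  have h1 := h.hasDerivAt_nice hP hF hp
  rw [h1.1.pd_chain hb (chart_mem_coord (proj q)) hpb hp.1, h1.2,
    coeffIn_change (chart_mem_coord (proj q)) hb _ (by rw [(h.spec hp).1]; exact hp.1)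
    (by rw [(h.spec hp).1]; exact hpb), (h.spec hp).1]
  ring

lemma coeffIn_form (hp : p ∈ discDomain q r) {α : P.Form}
    (hα : ∀ q : P.SpectralCurve, q.IsRegular → α q = F q * P.sigma q)
    (b : OpenPartialHomeomorph X ℂ) : coeffIn b α (discLift q v p)
      = F (discLift q v p) * (2 * coeffIn b P.liouville (discLift q v p)) := by
  rw [← coeffIn_sigma, coeffIn, hα _ (h.isRegular_lift hp), coeffIn, mul_assoc]

/-- A holomorphic function on a disc has a primitive, so all the integrals exist on one common
domain. -/
lemma exists_isIntegral (hP : P.Admissible) (hF : IsNice F) {α : P.Form}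
    (hα : ∀ q : P.SpectralCurve, q.IsRegular → α q = F q * P.sigma q) :
    ∃ L, IsIntegral q (discDomain q r) (discLift q v) α L := by
  set e := chartAt ℂ (proj q) with he
  have heC : e ∈ Coord X := chart_mem_coord _
  have hmem : ∀ x ∈ Metric.ball (e (proj q)) r, e.symm x ∈ discDomain q r := fun x hx =>
    ⟨e.map_target (h.target x hx), by
      rw [mem_preimage, ← he, e.right_inv (h.target x hx)]; exact hx⟩
  set G : X → ℂ := fun p => F (discLift q v p) * (2 * coeffIn e P.liouville (discLift q v p))
  have hG : ∀ p ∈ discDomain q r, HolAt G p := fun p hp =>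
    (h.hasDerivAt_nice hP hF hp).1.mul ((holAt_const 2 p).mul (h.holAt_coeff heC hp.1 hp))
  have hdiff : DifferentiableOn ℂ (G ∘ e.symm) (Metric.ball (e (proj q)) r) := fun x hx => by
    have h1 := (holAt_iff heC (hmem x hx).1).1 (hG _ (hmem x hx))
    rw [e.right_inv (h.target x hx)] at h1
    exact h1.differentiableAt.differentiableWithinAt
  obtain ⟨g, hg0, hg⟩ := hdiff.isExactOn_ball.with_val_at (e (proj q)) 0
  have hgd : DifferentiableOn ℂ g (Metric.ball (e (proj q)) r) := fun x hx =>
    (hg x hx).differentiableAt.differentiableWithinAt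
  refine ⟨fun p => g (e p), hg0, fun p hp => ?_, fun p hp => ?_⟩
  · exact holAt_comp_coord heC hp.1 (hgd.analyticAt (Metric.isOpen_ball.mem_nhds hp.2))
  · rw [pd_comp_coord hp.1, (hg _ hp.2).deriv, h.coeffIn_form hp hα]
    simp only [G, Function.comp_apply, ← he, e.left_inv hp.1]

lemma pd_integral {α : P.Form} {L : X → ℂ}
    (hL : IsIntegral q (discDomain q r) (discLift q v) α L) (hp : p ∈ discDomain q r)
    (hb : b ∈ Coord X) (hpb : p ∈ b.source) : pd b L p = coeffIn b α (discLift q v p) := by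
  rw [(hL.hol p hp).pd_chain hb (chart_mem_coord (proj q)) hpb hp.1, hL.deriv_eq p hp,
    coeffIn_change (chart_mem_coord (proj q)) hb _ (by rw [(h.spec hp).1]; exact hp.1)
    (by rw [(h.spec hp).1]; exact hpb), (h.spec hp).1]

/-- Differentiating l² = Q₀ gives l' = -2lα, the transport equation for which the canonical
generator was chosen. -/
lemma pd_coeff (hp : p ∈ discDomain q r) (hb : b ∈ Coord X) (hpb : p ∈ b.source) :
    pd b (fun p => coeffIn b P.liouville (discLift q v p)) p
      = -(2 * coeffIn b P.liouville (discLift q v p) * P.canonicalLog b p) := by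
  have hl := h.holAt_coeff hb hpb hp
  have h1 := hl.pd_mul hl hb hpb
  have h2 : (fun x => coeffIn b P.liouville (discLift q v x)
      * coeffIn b P.liouville (discLift q v x)) =ᶠ[𝓝 p] P.Q b 0 := by
    filter_upwards [h.eventually_mem hp, b.open_source.eventually_mem hpb] with x hx hxb
    rw [← pow_two, h.coeff_sq hb hxb hx]
  rw [pd_congr hpb h2] at h1
  have h3 := h.coeff_sq hb hpb hp
  have h4 := ((isRegularPoint_iff_of_mem hb hpb).1 (h.regular_of_mem hp)).2
  rw [canonicalLog, h1, ← h3]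
  rw [← h3] at h4
  have h5 : coeffIn b P.liouville (discLift q v p) ≠ 0 := fun h0 => h4 (by rw [h0]; simp)
  field_simp
  ring

end IsDisc

end Existence

end SchrodingerOperator

/-! ### Verification of the Schrödinger equation on a coordinate disc. -/

namespace SchrodingerOperator

section Equation

variable {X : Type*} [TopologicalSpace X] [ChartedSpace ℂ X] [IsManifold 𝓘(ℂ) ω X] [T1Space X]
  {S : SpinStructure X} {D : X →₀ ℕ} {P : SchrodingerOperator S D} {q : P.SpectralCurve}
  {b e : OpenPartialHomeomorph X ℂ} {p : X} {r : ℝ} {v : ℂ → ℂ} {L : ℕ → X → ℂ} {s : X → ℂ}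
  {U : Set X} {a₀ : OpenPartialHomeomorph X ℂ → X → ℂ}

open SpectralCurve

/-- The exponential of minus a formal integral. -/
noncomputable def expFactor (L : ℕ → X → ℂ) (p : X) : PowerSeries ℂ :=
  formalExp (-PowerSeries.mk fun k => L k p)

variable (P) in
/-- The formal differential in the coordinate `b`, as a power series. -/
noncomputable def logSeries (b : OpenPartialHomeomorph X ℂ) (q : P.SpectralCurve) : PowerSeries ℂ :=
  PowerSeries.C (coeffIn b P.liouville q) * PowerSeries.C (P.w q)
    + 2 * PowerSeries.C (coeffIn b P.liouville q) * PowerSeries.mk fun n => P.riccatiSol n q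

lemma pd_coeff_eq {Φ : X → PowerSeries ℂ} {Φ' : PowerSeries ℂ}
    (h : HasCoeffDeriv (fun z => Φ (b.symm z)) Φ' (b p)) (n : ℕ) :
    pd b (fun x => PowerSeries.coeff n (Φ x)) p = PowerSeries.coeff n Φ' := (h n).deriv

namespace IsDisc

variable (h : IsDisc q r v)
include h

lemma mk_coeffIn_eq (hp : p ∈ discDomain q r) (b : OpenPartialHomeomorph X ℂ) :
    PowerSeries.mk (fun k => coeffIn b (P.formalDifferential k) (discLift q v p))
      = P.logSeries b (discLift q v p) := by
  ext n
  rw [PowerSeries.coeff_mk, h.coeffIn_form hp fun q hq => formalDifferential_eq hq n, logSeries,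
    map_add, mul_assoc, ← map_ofNat (PowerSeries.C (R := ℂ)), ← map_mul,
    PowerSeries.coeff_C_mul, PowerSeries.coeff_C_mul, PowerSeries.coeff_mk,
    PowerSeries.coeff_C, formalQuotient]
  split_ifs with h0
  · rw [h0, riccatiSol_zero]
    ring
  · ring

lemma hasCoeffDeriv_expFactor
    (hL : ∀ k, IsIntegral q (discDomain q r) (discLift q v) (P.formalDifferential k) (L k))
    (hp : p ∈ discDomain q r) (hb : b ∈ Coord X) (hpb : p ∈ b.source) :
    HasCoeffDeriv (fun z => expFactor L (b.symm z))
      (-P.logSeries b (discLift q v p) * expFactor L p) (b p) := by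
  have h1 : HasCoeffDeriv (fun z => PowerSeries.mk fun k => L k (b.symm z))
      (P.logSeries b (discLift q v p)) (b p) := fun n => by
    rw [← h.mk_coeffIn_eq hp]
    simp only [PowerSeries.coeff_mk]
    rw [← h.pd_integral (hL n) hp hb hpb]
    exact ((hL n).hol p hp).hasDerivAt hb hpb
  have h2 := h1.neg.formalExp
  simp only [b.left_inv hpb] at h2
  exact h2

/-- Product rule for M = lw + 2lf, using w' = 2l V(w) and f' = 2l V(f). -/
lemma hasCoeffDeriv_logSeries (hP : P.Admissible)
    (hp : p ∈ discDomain q r) (hb : b ∈ Coord X) (hpb : p ∈ b.source) {l l₁ : PowerSeries ℂ}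
    (hl : l = PowerSeries.C (coeffIn b P.liouville (discLift q v p)))
    (hl₁ : l₁ = PowerSeries.C (pd b (fun p => coeffIn b P.liouville (discLift q v p)) p)) :
    HasCoeffDeriv (fun z => P.logSeries b (discLift q v (b.symm z)))
      (l₁ * PowerSeries.C (P.w (discLift q v p))
        + 2 * l ^ 2 * PowerSeries.C (vderiv P.w (discLift q v p))
        + 2 * l₁ * PowerSeries.mk (fun n => P.riccatiSol n (discLift q v p))
        + 4 * l ^ 2 * PowerSeries.mk (fun n => vderiv (P.riccatiSol n) (discLift q v p))) (b p) := by
  have key : ∀ {F : P.SpectralCurve → ℂ}, IsNice F →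
      HasDerivAt ((fun p => F (discLift q v p)) ∘ b.symm) (vderiv F (discLift q v p)
        * (2 * coeffIn b P.liouville (discLift q v p))) (b p) := fun hF => by
    rw [← h.pd_nice hP hF hp hb hpb]
    exact (h.hasDerivAt_nice hP hF hp).1.hasDerivAt hb hpb
  have h1 := hasCoeffDeriv_C ((h.holAt_coeff hb hpb hp).hasDerivAt hb hpb)
  have h2 := hasCoeffDeriv_C (key (isNice_w hP))
  have h3 : HasCoeffDeriv (fun z => PowerSeries.mk fun n => P.riccatiSol n (discLift q v (b.symm z)))
      (2 * l * PowerSeries.mk (fun n => vderiv (P.riccatiSol n) (discLift q v p))) (b p) :=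
    fun n => by
      rw [hl, ← map_ofNat (PowerSeries.C (R := ℂ)), ← map_mul, PowerSeries.coeff_C_mul]
      simp only [PowerSeries.coeff_mk]
      rw [mul_comm]
      exact key (isNice_riccatiSol hP n)
  have h4 := (h1.mul h2).add (((hasCoeffDeriv_const 2 (b p)).mul h1).mul h3)
  simp only [Function.comp_apply, b.left_inv hpb, ← hl, ← hl₁] at h4
  refine (show HasCoeffDeriv (fun z => P.logSeries b (discLift q v (b.symm z))) _ (b p) from
    h4).congr_deriv ?_
  rw [map_mul, map_mul PowerSeries.C 2, ← hl, map_ofNat]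
  ring

lemma logSeries_algebra (hP : P.Admissible) (hp : p ∈ discDomain q r) (hb : b ∈ S.frames)
    (hpb : p ∈ b.source) {l l₁ α α₁ M M' : PowerSeries ℂ}
    (hl : l = PowerSeries.C (coeffIn b P.liouville (discLift q v p)))
    (hl₁ : l₁ = PowerSeries.C (pd b (fun p => coeffIn b P.liouville (discLift q v p)) p))
    (hα : α = PowerSeries.C (P.canonicalLog b p))
    (hα₁ : α₁ = PowerSeries.C (pd b (P.canonicalLog b) p))
    (hM : M = P.logSeries b (discLift q v p))
    (hM' : M' = l₁ * PowerSeries.C (P.w (discLift q v p))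
        + 2 * l ^ 2 * PowerSeries.C (vderiv P.w (discLift q v p))
        + 2 * l₁ * PowerSeries.mk (fun n => P.riccatiSol n (discLift q v p))
        + 4 * l ^ 2 * PowerSeries.mk (fun n => vderiv (P.riccatiSol n) (discLift q v p))) :
    l ^ 2 - PowerSeries.X * (l₁ + 2 * l * (α - M))
      + PowerSeries.X ^ 2 * (α₁ - M' + (α - M) ^ 2) - PowerSeries.mk (fun k => P.Q b k p) = 0 := by
  have hbC := S.frames_subset hb
  have hreg := h.isRegular_lift hp
  have hpr := (h.spec hp).1
  have hsq := h.coeff_sq hbC hpb hp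
  have hQ0 := ((isRegularPoint_iff_of_mem hbC hpb).1 (h.regular_of_mem hp)).2
  have hDp := (h.regular_of_mem hp).1
  have h2C : (2 : PowerSeries ℂ) = PowerSeries.C 2 := (map_ofNat _ 2).symm
  have h4C : (4 : PowerSeries ℂ) = PowerSeries.C 4 := (map_ofNat _ 4).symm
  refine riccati_algebra (Q₀ := PowerSeries.C (P.Q b 0 p)) (Q₁ := PowerSeries.C (P.Q b 1 p))
    (Q₂ := PowerSeries.C (P.Q b 2 p)) (f₁ := PowerSeries.C (P.riccatiSol 1 (discLift q v p)))
    ?_ ?_ ?_ ?_ hM' (riccatiSol_equation hP hreg) ?_ ?_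
  · rw [hl, ← map_pow, hsq]
  · rw [hl, hl₁, hα, h.pd_coeff hp hbC hpb, h2C, ← map_mul, ← map_mul, ← map_neg]
  · rw [hl, h2C, ← map_mul, ← map_mul, ← map_mul, w_eq hreg, hpr,
      ratio_eq hbC hpb hDp (by norm_num)]
    congr 1
    calc _ = 2 * coeffIn b P.liouville (discLift q v p) ^ 2 * (P.Q b 1 p / P.Q b 0 p / 2) := by ring
      _ = _ := by rw [hsq]; field_simp
  · rw [hM, logSeries, hl]
  -- The definition of W, compared by degree: W₀ = -f₁ absorbs the f₁ term in degree 2, and W_k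
  -- contributes Q_{k+2} above that.
  · ext n
    rw [hl, h4C, ← map_pow, ← map_mul, ← map_mul, mul_assoc, PowerSeries.coeff_C_mul, hsq]
    simp only [map_sub, map_neg, PowerSeries.coeff_C_mul, PowerSeries.coeff_X_pow_mul',
      PowerSeries.coeff_X_pow, PowerSeries.coeff_X, PowerSeries.coeff_C, PowerSeries.coeff_mk]
    rcases n with _ | _ | _ | n
    · simp
    · simp
    · simp [W_zero_eq hreg]
    · have e1 : P.W P.formalDifferential (n + 1) (discLift q v p)
          = -(P.Q b (n + 3) p / P.Q b 0 p) / 4 := by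
        rw [W_succ_eq _ (Nat.succ_ne_zero n), tail, neg_div, pullQuad_div_sigma_sq hreg, hpr,
          ratio_eq hbC hpb hDp (by omega)]
        ring
      have e2 : n + 1 + 1 + 1 - 2 = n + 1 := by omega
      rw [if_pos (by omega), e2, e1, if_neg (by omega), if_neg (by omega), if_neg (by omega)]
      simp only [mul_zero, sub_zero, neg_zero, zero_sub]
      field_simp
  · rw [hl, hα, hα₁, h2C, h4C]
    simp only [← map_pow, ← map_mul, ← map_add, ← map_sub]
    congr 1
    rw [hsq, riccatiSol_one]
    simp only
    rw [hpr, secondRatio_eq hP hb hpb (h.regular_of_mem hp), secondCoeff]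
    field_simp
    ring

lemma hasCoeffDeriv_solution (ha : P.IsCanonicalGenerator U a₀) (hU : discDomain q r ⊆ U)
    (hL : ∀ k, IsIntegral q (discDomain q r) (discLift q v) (P.formalDifferential k) (L k))
    (hp : p ∈ discDomain q r) (hb : b ∈ S.frames) (hpb : p ∈ b.source) :
    HasCoeffDeriv (fun z => PowerSeries.C (a₀ b (b.symm z)) * expFactor L (b.symm z))
      ((PowerSeries.C (P.canonicalLog b p) - P.logSeries b (discLift q v p))
        * (PowerSeries.C (a₀ b p) * expFactor L p)) (b p) := by
  have hbC := S.frames_subset hb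
  have h1 := hasCoeffDeriv_C ((ha.holAt hb ⟨hU hp, hpb⟩).hasDerivAt hbC hpb)
  have h2 := h1.mul (h.hasCoeffDeriv_expFactor hL hp hbC hpb)
  simp only [Function.comp_apply, b.left_inv hpb] at h2
  refine h2.congr_deriv ?_
  rw [(ha.pd_eq hb ⟨hU hp, hpb⟩).2, map_mul]
  ring

lemma hasCoeffDeriv_solution_deriv (ha : P.IsCanonicalGenerator U a₀)
    (hU : discDomain q r ⊆ U)
    (hL : ∀ k, IsIntegral q (discDomain q r) (discLift q v) (P.formalDifferential k) (L k))
    (hp : p ∈ discDomain q r) (hb : b ∈ S.frames) (hpb : p ∈ b.source) {M' : PowerSeries ℂ}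
    (hM' : HasCoeffDeriv (fun z => P.logSeries b (discLift q v (b.symm z))) M' (b p)) :
    HasCoeffDeriv (fun z => (PowerSeries.C (P.canonicalLog b (b.symm z))
        - P.logSeries b (discLift q v (b.symm z)))
        * (PowerSeries.C (a₀ b (b.symm z)) * expFactor L (b.symm z)))
      ((PowerSeries.C (pd b (P.canonicalLog b) p) - M' + (PowerSeries.C (P.canonicalLog b p)
        - P.logSeries b (discLift q v p)) ^ 2)
        * (PowerSeries.C (a₀ b p) * expFactor L p)) (b p) := by
  have hbC := S.frames_subset hb
  have h1 := hasCoeffDeriv_C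
    ((holAt_canonicalLog hbC hpb (h.regular_of_mem hp)).hasDerivAt hbC hpb)
  have h2 := (h1.sub hM').mul (h.hasCoeffDeriv_solution ha hU hL hp hb hpb)
  simp only [Function.comp_apply, b.left_inv hpb] at h2
  refine h2.congr_deriv ?_
  ring

/-- Coefficientwise complex differentiability on a neighbourhood already gives analyticity. -/
lemma holAt_coeff_expFactor
    (hL : ∀ k, IsIntegral q (discDomain q r) (discLift q v) (P.formalDifferential k) (L k))
    (hp : p ∈ discDomain q r) (n : ℕ) :
    HolAt (fun x => PowerSeries.coeff n (expFactor L x)) p := by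
  refine (holAt_iff (chart_mem_coord (proj q)) hp.1).2
    (Complex.analyticAt_iff_eventually_differentiableAt.2 ?_)
  filter_upwards [(eventually_nhds_iff_symm hp.1).1 (h.eventually_mem hp),
    eventually_mem_target hp.1] with z hz hzt
  have h1 := h.hasCoeffDeriv_expFactor hL hz (chart_mem_coord (proj q)) hz.1 n
  rw [(chartAt ℂ (proj q)).right_inv hzt] at h1
  exact h1.differentiableAt

/-- With A = a₀ exp(-∫Λ̂) one has A' = (α - M)A and A'' = ((α - M)' + (α - M)²)A, so the equation is
A times `logSeries_algebra`. -/
lemma isFormalWKB (hP : P.Admissible) (ha : P.IsCanonicalGenerator U a₀)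
    (hU : discDomain q r ⊆ U)
    (hs : IsIntegral q (discDomain q r) (discLift q v) P.liouville s)
    (hL : ∀ k, IsIntegral q (discDomain q r) (discLift q v) (P.formalDifferential k) (L k)) :
    P.IsFormalWKB (discDomain q r) s
      (fun n b p => a₀ b p * PowerSeries.coeff n (expFactor L p)) where
  s_hol p hp := hs.hol p hp
  a_section n := by
    refine SpinStructure.isSection_of_holAt (fun b hb p hp => ?_) fun b hb c hc p hp => ?_
    · exact (ha.holAt hb ⟨hU hp.1, hp.2⟩).mul (h.holAt_coeff_expFactor hL hp.1 n)
    · rw [ha.isSection.glue b hb c hc p ⟨hU hp.1, hp.2⟩ rfl]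
      ring
  equation b hb p hp _ := by
    obtain ⟨hp, hpb⟩ := hp
    have hbC := S.frames_subset hb
    have hnear := (h.eventually_mem hp).and (b.open_source.eventually_mem hpb)
    set A : X → PowerSeries ℂ := fun x => PowerSeries.C (a₀ b x) * expFactor L x with hA
    set B : X → PowerSeries ℂ := fun x => (PowerSeries.C (P.canonicalLog b x)
        - P.logSeries b (discLift q v x)) * A x with hB
    have ea : ∀ n, (fun x => a₀ b x * PowerSeries.coeff n (expFactor L x))
        = fun x => PowerSeries.coeff n (A x) := fun n => by
      funext x
      rw [hA, PowerSeries.coeff_C_mul]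
    have e1 : ∀ x ∈ discDomain q r, x ∈ b.source → ∀ n,
        pd b (fun x => PowerSeries.coeff n (A x)) x = PowerSeries.coeff n (B x) :=
      fun x hx hxb n => pd_coeff_eq (h.hasCoeffDeriv_solution ha hU hL hx hb hxb) n
    have hM' := h.hasCoeffDeriv_logSeries hP hp hbC hpb rfl rfl
    have e2 : ∀ n, pd b (pd b (fun x => PowerSeries.coeff n (A x))) p = PowerSeries.coeff n _ :=
      fun n => by
        rw [pd_congr hpb (hnear.mono fun x hx => e1 x hx.1 hx.2 n)]
        exact pd_coeff_eq (h.hasCoeffDeriv_solution_deriv ha hU hL hp hb hpb hM') n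
    have es : pd b (pd b s) p = pd b (fun p => coeffIn b P.liouville (discLift q v p)) p :=
      pd_congr hpb (hnear.mono fun x hx => h.pd_integral hs hx.1 hbC hx.2)
    have hmk : ∀ Φ : PowerSeries ℂ, PowerSeries.mk (fun n => PowerSeries.coeff n Φ) = Φ :=
      fun Φ => by ext n; simp
    have ea' : ∀ n, a₀ b p * PowerSeries.coeff n (expFactor L p) = PowerSeries.coeff n (A p) :=
      fun n => congrFun (ea n) p
    simp only [ea, ea', e1 p hp hpb, e2, hmk, es, h.pd_integral hs hp hbC hpb, map_pow]
    have key := h.logSeries_algebra hP hp hb hpb rfl rfl rfl rfl rfl rfl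
    simp only [hB]
    linear_combination (A p) * key

lemma isBasedWKB (hP : P.Admissible) (ha : P.IsCanonicalGenerator U a₀)
    (hU : discDomain q r ⊆ U)
    (hs : IsIntegral q (discDomain q r) (discLift q v) P.liouville s)
    (hL : ∀ k, IsIntegral q (discDomain q r) (discLift q v) (P.formalDifferential k) (L k)) :
    P.IsBasedWKB q a₀ (discDomain q r) s
      (fun n b p => a₀ b p * PowerSeries.coeff n (expFactor L p)) where
  isOpen := isOpen_discDomain q r
  mem := h.proj_mem
  isFormalWKB := h.isFormalWKB hP ha hU hs hL
  s_base := hs.base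
  ds_base := by rw [hs.deriv_eq _ h.proj_mem, h.lift_base, coeffIn_chart]
  a_base b hb hqb n := by
    have : (PowerSeries.mk fun k => L k (proj q)) = 0 := by
      ext k
      simp [(hL k).base]
    rw [expFactor, this, neg_zero, formalExp_zero, PowerSeries.coeff_one]
    split_ifs <;> simp

end IsDisc

end Equation

end SchrodingerOperator

/-! ## Uniqueness of the formal WKB solutions -/

/-- Integrating factor: y exp(-∫g) has zero derivative on the disc. -/
lemma eq_zero_of_deriv_eq_mul {β : ℂ} {ρ : ℝ} {y g : ℂ → ℂ}
    (hy : ∀ z ∈ Metric.ball β ρ, HasDerivAt y (g z * y z) z)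
    (hg : DifferentiableOn ℂ g (Metric.ball β ρ)) (h0 : y β = 0) :
    ∀ z ∈ Metric.ball β ρ, y z = 0 := by
  intro z hz
  obtain ⟨G, -, hG⟩ := hg.isExactOn_ball.with_val_at β 0
  have hd : ∀ x ∈ Metric.ball β ρ, HasDerivAt (fun x => y x * Complex.exp (-G x)) 0 x :=
    fun x hx => ((hy x hx).mul (hG x hx).neg.cexp).congr_deriv (by ring)
  have hβ : β ∈ Metric.ball β ρ := Metric.mem_ball_self (Metric.pos_of_mem_ball hz)
  have := Metric.isOpen_ball.is_const_of_deriv_eq_zero (convex_ball β ρ).isPreconnected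
    (fun x hx => (hd x hx).differentiableAt.differentiableWithinAt) (fun x hx => (hd x hx).deriv)
    hz hβ
  simp only [h0, zero_mul] at this
  exact (mul_eq_zero.1 this).resolve_right (Complex.exp_ne_zero _)

section Transport

open PowerSeries

lemma mk_eq_X_pow_mul {d : ℕ → ℂ} {n : ℕ} (h : ∀ j < n, d j = 0) :
    PowerSeries.mk d = X ^ n * PowerSeries.mk fun j => d (n + j) := by
  ext m
  rw [coeff_mk, coeff_X_pow_mul']
  split_ifs with hm
  · rw [coeff_mk, Nat.add_sub_cancel' hm]
  · exact h m (not_le.1 hm)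

/-- Divide by Xⁿ and read the coefficient of X: the unknown d_{n+1} drops out because l² = Q₀, and
the second derivatives enter one order later. -/
lemma transport_of_equation {l l₁ : ℂ} {Q d d₁ d₂ : ℕ → ℂ} {n : ℕ} (hd : ∀ j < n, d j = 0)
    (hd₁ : ∀ j < n, d₁ j = 0) (hd₂ : ∀ j < n, d₂ j = 0) (hQ : l ^ 2 = Q 0)
    (h : (C (l ^ 2) * PowerSeries.mk d - X * (C l₁ * PowerSeries.mk d
      + 2 * C l * PowerSeries.mk d₁) + X ^ 2 * PowerSeries.mk d₂
      - PowerSeries.mk Q * PowerSeries.mk d : PowerSeries ℂ) = 0) :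
    2 * l * d₁ n = -(l₁ + Q 1) * d n := by
  rw [mk_eq_X_pow_mul hd, mk_eq_X_pow_mul hd₁, mk_eq_X_pow_mul hd₂] at h
  set T : PowerSeries ℂ := PowerSeries.mk fun j => d (n + j) with hT
  set T₁ : PowerSeries ℂ := PowerSeries.mk fun j => d₁ (n + j) with hT₁
  set T₂ : PowerSeries ℂ := PowerSeries.mk fun j => d₂ (n + j)
  have h1 : C (l ^ 2) * T - X * (C l₁ * T + C (2 * l) * T₁) + X * (X * T₂)
      - PowerSeries.mk Q * T = 0 := by
    refine mul_left_cancel₀ (pow_ne_zero n (X_ne_zero (R := ℂ))) ?_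
    rw [map_mul C 2, map_ofNat]
    linear_combination h
  have h2 := congrArg (coeff 1) h1
  have hX : ∀ Φ : PowerSeries ℂ, coeff 1 (X * Φ) = coeff 0 Φ := coeff_succ_X_mul 0
  have h3 : coeff 1 (PowerSeries.mk Q * T) = Q 0 * d (n + 1) + Q 1 * d n := by
    simp [coeff_mul, Finset.Nat.antidiagonal_succ, hT]
  rw [map_sub, map_add, map_sub, h3, hX, hX] at h2
  simp only [map_add, coeff_C_mul, coeff_zero_X_mul, hT, hT₁, coeff_mk, map_zero, add_zero] at h2
  linear_combination -h2 + d (n + 1) * hQ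

end Transport

namespace SchrodingerOperator

section Uniqueness

variable {X : Type*} [TopologicalSpace X] [ChartedSpace ℂ X] [IsManifold 𝓘(ℂ) ω X] [T1Space X]
  {S : SpinStructure X} {D : X →₀ ℕ} {P : SchrodingerOperator S D} {q : P.SpectralCurve}
  {b : OpenPartialHomeomorph X ℂ} {p : X} {s s' : X → ℂ} {U U' : Set X}
  {a₀ : OpenPartialHomeomorph X ℂ → X → ℂ} {a a' : ℕ → OpenPartialHomeomorph X ℂ → X → ℂ}

open SpectralCurve

lemma IsFormalWKB.eikonal (h : P.IsFormalWKB U s a) (hb : b ∈ S.frames) (hp : p ∈ U ∩ b.source)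
    (hD : D p = 0) (h0 : a 0 b p ≠ 0) : pd b s p ^ 2 = P.Q b 0 p := by
  have := congrArg (PowerSeries.coeff 0) (h.equation b hb p hp hD)
  refine mul_right_cancel₀ h0 ?_
  simpa [sub_eq_zero] using this

lemma IsFormalWKB.transport (h : P.IsFormalWKB U s a) (h' : P.IsFormalWKB U' s' a')
    (hb : b ∈ S.frames) (hp : p ∈ U ∩ b.source) (hp' : p ∈ U' ∩ b.source) (hD : D p = 0)
    (hs : s' =ᶠ[𝓝 p] s) {n : ℕ} (ha : ∀ j < n, a' j b =ᶠ[𝓝 p] a j b) (h0 : a 0 b p ≠ 0) :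
    2 * pd b s p * (pd b (a' n b) p - pd b (a n b) p)
      = -(pd b (pd b s) p + P.Q b 1 p) * (a' n b p - a n b p) := by
  have e1 := h.equation b hb p hp hD
  have e2 := h'.equation b hb p hp' hD
  rw [pd_congr hp.2 hs, pd_congr hp.2 (pd_congr_eventually hp.2 hs)] at e2
  refine transport_of_equation (d := fun j => a' j b p - a j b p)
    (d₁ := fun j => pd b (a' j b) p - pd b (a j b) p)
    (d₂ := fun j => pd b (pd b (a' j b)) p - pd b (pd b (a j b)) p) (Q := fun k => P.Q b k p)
    (fun j hj => sub_eq_zero.2 (ha j hj).self_of_nhds)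
    (fun j hj => sub_eq_zero.2 (pd_congr hp.2 (ha j hj)))
    (fun j hj => sub_eq_zero.2 (pd_congr hp.2 (pd_congr_eventually hp.2 (ha j hj))))
    (h.eikonal hb hp hD h0) ?_
  have hmk : ∀ f g : ℕ → ℂ, PowerSeries.mk (fun n => f n - g n)
      = PowerSeries.mk f - PowerSeries.mk g := fun f g => by ext; simp
  simp only [hmk]
  linear_combination e2 - e1

/-- First S', then S, then a_n by induction on n. Everything takes place on one disc N chosen
beforehand, so the neighbourhood does not shrink with n. -/
lemma IsBasedWKB.eventually_eq (hq : q.IsRegular) (h : P.IsBasedWKB q a₀ U s a)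
    (h' : P.IsBasedWKB q a₀ U' s' a') (h0 : ∀ b ∈ S.frames, proj q ∈ b.source → a₀ b (proj q) ≠ 0) :
    ∀ᶠ p in 𝓝 (proj q), s' p = s p ∧ ∀ b ∈ S.frames, p ∈ b.source → ∀ n, a' n b p = a n b p := by
  obtain ⟨b, hb, hqb⟩ := S.covers (proj q)
  have hbC := S.frames_subset hb
  have hcont : ∀ {U s a}, P.IsBasedWKB q a₀ U s a →
      (∀ᶠ p in 𝓝 (proj q), p ∈ U ∧ a 0 b p ≠ 0) ∧ ContinuousAt (pd b s) (proj q) ∧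
        pd b s (proj q) = coeffIn b P.liouville q := by
    intro U s a h
    refine ⟨(h.isOpen.eventually_mem h.mem).and (ContinuousAt.eventually_ne
      ((h.isFormalWKB.a_section 0).hol b hb _ ⟨h.mem, hqb⟩ rfl).continuousAt ?_),
      ((h.isFormalWKB.s_hol _ h.mem).pd hbC hqb).continuousAt, ?_⟩
    · rw [h.a_base b hb hqb, if_pos rfl]
      exact h0 b hb hqb
    · rw [(h.isFormalWKB.s_hol _ h.mem).pd_chain hbC (chart_mem_coord (proj q)) hqb
        (mem_chart_source ℂ _), h.ds_base]
      rfl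
  obtain ⟨c1, c2, c3⟩ := hcont h
  obtain ⟨c1', c2', c3'⟩ := hcont h'
  -- Both derivatives equal λ(q) at the base point, so their sum is nonzero nearby; equality of
  -- squares then becomes equality.
  have hne : pd b s (proj q) + pd b s' (proj q) ≠ 0 := by
    rw [c3, c3', ← two_mul, coeffIn]
    exact mul_ne_zero two_ne_zero (mul_ne_zero (fib_ne_zero hq)
      (pd_ne_zero hbC (chart_mem_coord _) hqb (mem_chart_source ℂ _)))
  have hev := (((c1.and c1').and ((c2.add c2').eventually_ne hne)).and
    (eventually_divisor_eq_zero' hq.1)).and (b.open_source.eventually_mem hqb)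
  rw [eventually_nhds_iff_symm hqb] at hev
  obtain ⟨ρ, hρ, hball⟩ := Metric.eventually_nhds_iff_ball.1
    ((eventually_mem_target hqb).and hev)
  set N : Set X := b.source ∩ b ⁻¹' Metric.ball (b (proj q)) ρ with hN
  have hNo : IsOpen N := b.isOpen_inter_preimage Metric.isOpen_ball
  have hqN : proj q ∈ N := ⟨hqb, Metric.mem_ball_self hρ⟩
  have hsymm : ∀ z ∈ Metric.ball (b (proj q)) ρ, b.symm z ∈ N ∧ b (b.symm z) = z := fun z hz => by
    have h1 := (hball z hz).1
    refine ⟨⟨b.map_target h1, ?_⟩, b.right_inv h1⟩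
    rw [mem_preimage, b.right_inv h1]
    exact hz
  have hNp : ∀ p ∈ N, ((((p ∈ U ∧ a 0 b p ≠ 0) ∧ p ∈ U' ∧ a' 0 b p ≠ 0) ∧
      pd b s p + pd b s' p ≠ 0) ∧ D p = 0) ∧ p ∈ b.source := fun p hp => by
    have := (hball _ hp.2).2
    rwa [b.left_inv hp.1] at this
  have hzero : ∀ {F G : X → ℂ}, (∀ p ∈ N, HolAt F p ∧ HolAt G p ∧ pd b F p = G p * F p) →
      F (proj q) = 0 → ∀ p ∈ N, F p = 0 := by
    intro F G hF hF0 p hp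
    have := eq_zero_of_deriv_eq_mul (y := F ∘ b.symm) (g := G ∘ b.symm) (β := b (proj q)) (ρ := ρ)
      (fun z hz => ?_) (fun z hz => ?_) (by simpa [b.left_inv hqb] using hF0) _ hp.2
    · simpa [b.left_inv hp.1] using this
    · obtain ⟨h1, h2⟩ := hsymm z hz
      have := (hF _ h1).1.hasDerivAt hbC h1.1
      rw [(hF _ h1).2.2, h2] at this
      exact this
    · obtain ⟨h1, h2⟩ := hsymm z hz
      have := (holAt_iff hbC h1.1).1 (hF _ h1).2.1
      rw [h2] at this
      exact this.differentiableAt.differentiableWithinAt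
  have hpd : ∀ p ∈ N, pd b s' p = pd b s p := fun p hp => by
    obtain ⟨⟨⟨⟨⟨hpU, ha0⟩, hpU', ha0'⟩, hsum⟩, hDp⟩, hpb⟩ := hNp p hp
    have e1 := h.isFormalWKB.eikonal hb ⟨hpU, hpb⟩ hDp ha0
    have e2 := h'.isFormalWKB.eikonal hb ⟨hpU', hpb⟩ hDp ha0'
    refine mul_left_cancel₀ hsum ?_
    linear_combination e2 - e1
  have hs_hol : ∀ p ∈ N, HolAt s p := fun p hp => h.isFormalWKB.s_hol p (hNp p hp).1.1.1.1.1
  have hs'_hol : ∀ p ∈ N, HolAt s' p := fun p hp => h'.isFormalWKB.s_hol p (hNp p hp).1.1.1.2.1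
  have hss : ∀ p ∈ N, s' p = s p := fun p hp => by
    refine sub_eq_zero.1 (hzero (F := fun p => s' p - s p) (G := fun _ => 0) (fun p hp => ?_)
      (by simp [h.s_base, h'.s_base]) p hp)
    refine ⟨AnalyticAt.sub (hs'_hol p hp) (hs_hol p hp), holAt_const 0 p, ?_⟩
    have := (((hs'_hol p hp).hasDerivAt hbC hp.1).sub ((hs_hol p hp).hasDerivAt hbC hp.1)).deriv
    rw [hpd p hp, sub_self] at this
    rw [zero_mul]
    exact this
  have haa : ∀ n, ∀ p ∈ N, a' n b p = a n b p := by
    intro n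
    induction n using Nat.strong_induction_on with
    | _ n ih =>
      -- `G` is the rate in the transport equation 2S'd' = -(S'' + Q₁)d for the difference d of the
      -- n-th coefficients.
      refine fun p hp => sub_eq_zero.1 (hzero (F := fun p => a' n b p - a n b p)
        (G := fun p => -(pd b (pd b s) p + P.Q b 1 p) * (2 * pd b s p)⁻¹) (fun p hp => ?_)
        (by simp [h.a_base b hb hqb, h'.a_base b hb hqb]) p hp)
      obtain ⟨⟨⟨⟨⟨hpU, ha0⟩, hpU', ha0'⟩, hsum⟩, hDp⟩, hpb⟩ := hNp p hp
      have hl : 2 * pd b s p ≠ 0 := by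
        rw [hpd p hp, ← two_mul] at hsum
        exact hsum
      have ha := (h.isFormalWKB.a_section n).hol b hb p ⟨hpU, hpb⟩ rfl
      have ha' := (h'.isFormalWKB.a_section n).hol b hb p ⟨hpU', hpb⟩ rfl
      have hds := (hs_hol p hp).pd hbC hpb
      refine ⟨AnalyticAt.sub ha' ha, HolAt.mul (AnalyticAt.neg (AnalyticAt.add (hds.pd hbC hpb)
        (P.Q_hol b hbC 1 p hpb hDp))) (((holAt_const 2 p).mul hds).inv hl), ?_⟩
      have hev := hNo.eventually_mem hp
      have ht := h.isFormalWKB.transport h'.isFormalWKB hb ⟨hpU, hpb⟩ ⟨hpU', hpb⟩ hDp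
        (hev.mono hss) (fun j hj => hev.mono (ih j hj)) ha0
      have hd := ((ha'.hasDerivAt hbC hpb).sub (ha.hasDerivAt hbC hpb)).deriv
      refine Eq.trans hd ?_
      have hl' := right_ne_zero_of_mul hl
      refine mul_left_cancel₀ hl (ht.trans ?_)
      field_simp
  filter_upwards [hNo.eventually_mem hqN] with p hp
  refine ⟨hss p hp, fun c hc hpc n => ?_⟩
  obtain ⟨⟨⟨⟨⟨hpU, ha0⟩, hpU', ha0'⟩, hsum⟩, hDp⟩, hpb⟩ := hNp p hp
  rw [(h.isFormalWKB.a_section n).glue c hc b hb p ⟨hpU, hpc, hpb⟩ rfl,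
    (h'.isFormalWKB.a_section n).glue c hc b hb p ⟨hpU', hpc, hpb⟩ rfl, haa n p hp]

lemma expressesWKB_formalDifferential (hP : P.Admissible) :
    ExpressesWKB P.formalDifferential := by
  intro q hq U a₀ hU hqU ha
  obtain ⟨r, v, h, hrU⟩ := exists_isDisc hU hqU ha.regular
  obtain ⟨s, hs⟩ := h.exists_isIntegral hP (isNice_const (1 / 2)) (α := P.liouville)
    fun q _ => by rw [sigma_eq, liouville]; ring
  choose L hL using fun k => h.exists_isIntegral hP (isNice_formalQuotient hP k)
    fun q hq => formalDifferential_eq hq k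
  have hbased := h.isBasedWKB hP ha hrU hs hL
  refine ⟨discDomain q r, discLift q v, s, L, isOpen_discDomain q r, h.isPreconnected, h.proj_mem,
    fun p hp => ⟨hrU hp, hp.1⟩, h.isLift, hs, hL, hbased, fun U' s' a' h' => ?_⟩
  exact hbased.eventually_eq hq h' fun b hb hqb => (ha.pd_eq hb ⟨hqU, hqb⟩).1

/-- All integrals vanish at the base point and `formalExp 0 = 1`, so the derivative of exp(-∫Λ̂)
there is -Λ̂(q). The expressions for `Λ` and `Λ'` coincide near π(q), and cancelling a₀ gives equal
derivatives. -/
lemma expressesWKB_unique (hP : P.Admissible) {Λ Λ' : ℕ → P.Form} (h : ExpressesWKB Λ)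
    (h' : ExpressesWKB Λ') (k : ℕ) (hq : q.IsRegular) : Λ' k q = Λ k q := by
  obtain ⟨U, a₀, hU, hqU, ha⟩ := exists_isCanonicalGenerator hP hq
  obtain ⟨V, l, s, L, hV, -, hqV, hVU, hl, hs, hL, hbased, huniq⟩ := h q hq U a₀ hU hqU ha
  obtain ⟨V', l', s', L', hV', -, hqV', hVU', hl', hs', hL', hbased', -⟩ := h' q hq U a₀ hU hqU ha
  have hev := huniq _ _ _ hbased'
  obtain ⟨b, hb, hqb⟩ := S.covers (proj q)
  set e := chartAt ℂ (proj q) with he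
  have heC : e ∈ Coord X := chart_mem_coord _
  have hqe : proj q ∈ e.source := mem_chart_source ℂ _
  have key : ∀ {Λ : ℕ → P.Form} {V : Set X} {l : X → P.SpectralCurve} {L : ℕ → X → ℂ}, proj q ∈ V → IsLift q V l →
      (∀ k, IsIntegral q V l (Λ k) (L k)) →
      HasCoeffDeriv (fun z => formalExp (-PowerSeries.mk fun k => L k (e.symm z)))
        (-PowerSeries.mk fun k => Λ k q) (e (proj q)) := by
    intro Λ V l L hqV hl hL
    have h1 : HasCoeffDeriv (fun z => PowerSeries.mk fun k => L k (e.symm z))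
        (PowerSeries.mk fun k => Λ k q) (e (proj q)) := fun n => by
      simp only [PowerSeries.coeff_mk]
      have h2 := ((hL n).hol _ hqV).hasDerivAt heC hqe
      rw [(hL n).deriv_eq _ hqV, hl.base, coeffIn_chart] at h2
      exact h2
    have h3 : (PowerSeries.mk fun k => L k (proj q)) = 0 := by
      ext k
      simp [(hL k).base]
    refine h1.neg.formalExp.congr_deriv ?_
    rw [e.left_inv hqe, h3, neg_zero, formalExp_zero, mul_one]
  have h1 := key hqV hl hL k
  have h2 := key hqV' hl' hL' k
  have h3 : (fun z => PowerSeries.coeff k (formalExp (-PowerSeries.mk fun k => L' k (e.symm z))))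
      =ᶠ[𝓝 (e (proj q))]
      fun z => PowerSeries.coeff k (formalExp (-PowerSeries.mk fun k => L k (e.symm z))) := by
    filter_upwards [(eventually_nhds_iff_symm hqe).1 (hev.and ((b.open_source.eventually_mem
      hqb).and (hU.eventually_mem hqU)))] with z hz
    exact mul_left_cancel₀ (ha.pd_eq hb ⟨hz.2.2, hz.2.1⟩).1 (hz.1.2 b hb hz.2.1 k)
  have h4 := h2.unique (h1.congr_of_eventuallyEq h3)
  simpa using h4

end Uniqueness

end SchrodingerOperator

end WKB

/-! ### Assembly of the two statements. -/

theorem proposition240916114621 {X : Type*} [TopologicalSpace X] [T2Space X] [CompactSpace X]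
    [ConnectedSpace X] [ChartedSpace ℂ X] [IsManifold 𝓘(ℂ) ω X]
    (S : WKB.SpinStructure X) (D : X →₀ ℕ) (P : WKB.SchrodingerOperator S D)
    (hzeros : P.ZerosSimple) (hpoles : P.PolesDominated) :
    ∃ Λ : ℕ → P.Form,
      ((∀ k, WKB.SchrodingerOperator.IsFormSection (Λ k)) ∧
        WKB.SchrodingerOperator.ExpressesWKB Λ ∧
        (∀ Λ' : ℕ → P.Form, (∀ k, WKB.SchrodingerOperator.IsFormSection (Λ' k)) →
          WKB.SchrodingerOperator.ExpressesWKB Λ' →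
          ∀ k (q : P.SpectralCurve), q.IsRegular → Λ' k q = Λ k q) ∧
        (∀ q : P.SpectralCurve, q.IsRegular →
          Λ 0 q = P.pullQuad 1 q / P.sigma q)) ∧
      (WKB.SchrodingerOperator.IsFunSection P.w ∧
        (∀ k, WKB.SchrodingerOperator.IsFunSection (P.W Λ k)) ∧
        (∀ q : P.SpectralCurve, q.IsRegular →
          P.w q = Λ 0 q / P.liouville q) ∧
        ∃ f : ℕ → P.SpectralCurve → ℂ,
          (∀ n, WKB.SchrodingerOperator.IsFunSection (f n)) ∧
          (∀ q : P.SpectralCurve, q.IsRegular → ∀ n,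
            Λ n q = (if n = 0 then Λ 0 q else 0) + f n q * P.sigma q) ∧
          WKB.SchrodingerOperator.SolvesRiccati P.w (P.W Λ) f ∧
          ∀ f' : ℕ → P.SpectralCurve → ℂ,
            WKB.SchrodingerOperator.SolvesRiccati P.w (P.W Λ) f' →
            ∀ n (q : P.SpectralCurve), q.IsRegular → f' n q = f n q) := by
  have hP : P.Admissible := ⟨hzeros, hpoles⟩
  refine ⟨P.formalDifferential,
    ⟨WKB.SchrodingerOperator.isFormSection_formalDifferential hP,
      WKB.SchrodingerOperator.expressesWKB_formalDifferential hP,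
      fun Λ' _ h' k q hq => WKB.SchrodingerOperator.expressesWKB_unique hP
        (WKB.SchrodingerOperator.expressesWKB_formalDifferential hP) h' k hq,
      fun q _ => WKB.SchrodingerOperator.formalDifferential_zero q⟩,
    (WKB.SchrodingerOperator.isNice_w hP).isFunSection hP,
    fun k => (WKB.SchrodingerOperator.isNice_W hP k).isFunSection hP, fun q hq => ?_,
    P.riccatiSol, fun n => (WKB.SchrodingerOperator.isNice_riccatiSol hP n).isFunSection hP,
    fun q _ n => ?_, WKB.SchrodingerOperator.solvesRiccati_riccatiSol hP,
    fun f' h n q hq => WKB.SchrodingerOperator.solvesRiccati_unique hP h n q hq⟩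
  · rw [WKB.SchrodingerOperator.formalDifferential_zero, WKB.SchrodingerOperator.w,
      WKB.SchrodingerOperator.sigma_eq]
    have h0 := WKB.SchrodingerOperator.fib_ne_zero hq
    simp only [WKB.SchrodingerOperator.liouville]
    field_simp
  · by_cases hn : n = 0
    · subst hn
      rw [if_pos rfl, WKB.SchrodingerOperator.riccatiSol_zero, zero_mul, add_zero]
    · rw [if_neg hn, zero_add, WKB.SchrodingerOperator.formalDifferential_of_ne hn]
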